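/- **Setting.** Let $m\ge 1$, $\sigma>0$, and let $b_1,\dots,b_m\ge 1$ be integers with $B=\sum_{i=1}^m b_i$. Machine $i$ observes $X_i$, where $X_1,\dots,X_m$ are i.i.d. $N(\theta,\sigma^2)$ with $\theta\in[0,1]$ unknown and $\sigma$ known; it sends a string of $b_i$ bits computed from $X_i$ to a central machine, which computes the estimate $\hat\theta_D$ from the $m$ strings. Throughout $\log=\log_2$, $\lambda=\lfloor\log\frac1\sigma\rfloor$, and $\tau_{[L,R]}$ is truncation of a real number to $[L,R]$. **Functions.** For an integer $k\ge 0$ the Gray function $g_k:\mathbb R\to\{0,1\}$ is $1$ iff $\lfloor 2^k\tau_{[0,1]}(x)\rfloor \bmod 4\in\{1,2\}$, and the conjugate Gray function $\bar g_k$ is $1$ iff $\lfloor 2^k\tau_{[0,1]}(x)\rfloor \bmod 4\in\{2,3\}$; $g_k=\bar g_k=0$ for $k<0$. Put $\mathrm{Dec}_K(y_1,\dots,y_K)=\{x\in[0,1]: g_k(x)=y_k,\ 1\le k\le K\}$, $h(x)=\lfloor 2^{\lambda-7}x\rfloor \bmod 2$, $\bar h(x)=\lfloor 2^{\lambda-7}x-\frac12\rfloor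 \bmod 2$, $\Phi_f(x)=\mathbb E f(Y)$ with $Y\sim N(x,\sigma^2)$, and $d(x,S)=\inf_{y\in S}|x-y|$ ($=\infty$ if $S=\emptyset$). **The MODGAME estimator** $\hat\theta_D$. *Procedure L (localization).* The machines send, in order, the bits $U_1,\dots,U_B$: machine $i$ sends $U_k=g_k(X_i)$ for $b_1+\dots+b_{i-1}<k\le b_1+\dots+b_i$. Then $\hat\theta_D=\min \mathrm{Dec}_B(U_1,\dots,U_B)$. *Procedure R (localization and refinement).* Let $n=\max\{s\in\mathbb N:\lfloor\log s\rfloor^2+2s\le B-\lambda\}$, $l=\lfloor\log n\rfloor$, $f_1=g_{\lambda-l-2}$, $f_2=\bar g_{\lambda-l-2}$ and $f_k=g_{\lambda-l-4+k}$ for $k\ge3$. The last bit sent by machine $(k-1)l+j$ ($1\le k,j\le l$) is $W_{k,j}=f_k(X_{(k-1)l+j})$; the last bit sent by machine $l^2+j$ ($1\le j\le n$) is $V_j=h(X_{l^2+j})$; the last bit sent by machine $l^2+n+j$ ($1\le j\le n$) is $\bar V_j=\bar h(X_{l^2+n+j})$. All other bits, numbered consecutively $1,2,\dots$ through the machines in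 order, are crude localization bits: the one numbered $k$, if it is sent by machine $i$, is $U_k=g_k(X_i)$. Let $W_k=1$ if $\sum_{j=1}^l W_{k,j}\ge l/2$ and $W_k=0$ otherwise. The central machine computes: 1. If $\lambda-l\le3$, $I_1=[0,1]$. Otherwise $I_1=\{x\in[0,1]: d(x,I_1')\le 2^{-(\lambda-l-2)}\}$ with $I_1'=\mathrm{Dec}_{\lambda-l-3}(U_1,\dots,U_{\lambda-l-3})$. 2. If $\lambda-l\le3$ and $\lambda\le4$, $I_2=[0,1]$. Otherwise $I_2=\{x\in\mathbb R: d(x,I_2')\le2^{-(\lambda-3)}\}$, where: if $\lambda-l\le 3$ and $\lambda\ge5$, $I_2'=\mathrm{Dec}_{\lambda-4}(W_{l-\lambda+5},\dots,W_l)$, with the first argument replaced by $W_1$ when $\lambda-l=3$ (so that the $r$-th argument is always the vote for $g_r$); if $\lambda-l\ge4$, $I_2'=\{x\in I_1: f_k(x)=W_k,\ 1\le k\le l\}$. 3. Let $w=2^{-(\lambda-6)}$. (a) If $I_2\ne\emptyset$ and $I_2\subseteq[(2j-\frac34)w,(2j+\frac34)w]$ for some $j\in\mathbb Z$, then $\hat\theta_D=\Phi_h^{-1}\big(\tau_{[L,R]}(\frac1n\sum_{j=1}^nV_j)\big)$,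 where $\Phi_h^{-1}$ is the inverse of $\Phi_h$ restricted to $I_2$, $L=\inf_{I_2}\Phi_h$, $R=\sup_{I_2}\Phi_h$. (b) Otherwise, if $I_2\ne\emptyset$ and $I_2\subseteq[(2j+\frac14)w,(2j+\frac74)w]$ for some $j\in\mathbb Z$, the same with $\Phi_{\bar h}$ and $\bar V_j$ in place of $\Phi_h$ and $V_j$. (c) On the remaining exceptional transcripts, $\hat\theta_D$ is an arbitrary point of $I_1$. *Choice of the procedure.* - If $\sigma<1$ and $B<\log\frac1\sigma+2$: Procedure L. - If $\sigma<1$ and $\log\frac1\sigma+2\le B\le\log\frac1\sigma+m$: Procedure R. - If $\sigma<1$ and $B>\log\frac1\sigma+m$: choose any integers $1\le b_i'\le b_i$ with $\sum_i b_i'=\lambda+m$ and run Procedure R (Procedure L if $m=1$) with the budgets $b_i'$ instead of $b_i$. (For $m=1$ and $\log\frac1\sigma+1<B<\log\frac1\sigma+2$ either the first or this third rule may be used.) - If $\sigma\ge1$: machine $i$ sends the single bit $Z_i=\mathbf 1\{X_i\ge0\}$ and $\hat\theta_D=\tau_{[0,1]}\big(\sigma\Phi^{-1}(\frac1m\sum_iZ_i)\big)$,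 with $\Phi$ the standard normal distribution function, $\Phi^{-1}(0)=-\infty$, $\Phi^{-1}(1)=\infty$. **Theorem.** There is a universal constant $C>0$ such that for all $m\ge1$, all $\sigma>0$ and all budgets $b_1,\dots,b_m\ge1$ with $B=\sum_i b_i$, the MODGAME procedure can be carried out, and every MODGAME estimator $\hat\theta_D$ satisfies $$\sup_{\theta\in[0,1]}\mathbb E(\hat\theta_D-\theta)^2\le\begin{cases}C\cdot2^{-2B}&\text{if }B<\log\frac1\sigma+2,\\ C\cdot\dfrac{\sigma^2}{B-\log\frac1\sigma}&\text{if }\log\frac1\sigma+2\le B<\log\frac1\sigma+m,\\ C\cdot\big(\frac{\sigma^2}{m}\wedge1\big)&\text{if }B\ge\log\frac1\sigma+m\end{cases}$$ (where two of the conditions hold, both bounds hold). -/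

import Mathlib

open MeasureTheory ProbabilityTheory Set
open scoped ENNReal NNReal

namespace Modgame

noncomputable section

/-! ### Distributed protocols -/

/-- The family of transcripts that the central machine receives: `b i` bits from machine `i`. -/
abbrev Transcripts {m : ℕ} (b : Fin m → ℕ) : Type := ∀ i : Fin m, Fin (b i) → Bool

/-- A deterministic distributed protocol with budgets `b`: machine `i` turns its own real observation
into `b i` bits, and the central machine turns the transcripts into an estimate. -/
structure Protocol {m : ℕ} (b : Fin m → ℕ) where
  encode : ∀ i : Fin m, ℝ → Fin (b i) → Bool
  estimate : Transcripts b → ℝ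

/-- A protocol with smaller budgets, run within larger ones: the additional bits are constant and
are ignored by the central machine. -/
def Protocol.pad {m : ℕ} {b b' : Fin m → ℕ} (P : Protocol b') (h : ∀ i, b' i ≤ b i) :
    Protocol b where
  encode := fun i x t => if ht : (t : ℕ) < b' i then P.encode i x ⟨t, ht⟩ else false
  estimate := fun z => P.estimate (fun i t => z i (Fin.castLE (h i) t))

/-- The estimate as a function of the observations `x i`. -/
def Protocol.apply {m : ℕ} {b : Fin m → ℕ} (P : Protocol b) (x : Fin m → ℝ) : ℝ :=
  P.estimate (fun i => P.encode i (x i))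

/-- The normal distribution `N(θ, σ²)`. -/
def normal (θ σ : ℝ) : Measure ℝ := gaussianReal θ ⟨σ ^ 2, sq_nonneg σ⟩

/-- Maximal mean squared error over `θ ∈ [0,1]` when the observations are i.i.d. `N(θ, σ²)`. -/
def Protocol.maxRisk {m : ℕ} {b : Fin m → ℕ} (P : Protocol b) (σ : ℝ) : ℝ≥0∞ :=
  ⨆ θ ∈ Icc (0 : ℝ) 1,
    ∫⁻ x, ENNReal.ofReal ((P.apply x - θ) ^ 2) ∂(Measure.pi (fun _ : Fin m => normal θ σ))

/-! ### Auxiliary functions -/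

open Classical in
/-- Truncation to `[l, r]`. -/
def trunc (l r x : ℝ) : ℝ := if x ≤ l then l else if x < r then x else r

/-- Gray function `g_k`, identically `0` for `k < 0`. -/
def gray (k : ℤ) (x : ℝ) : Bool :=
  decide (0 ≤ k ∧ (⌊(2 : ℝ) ^ k * trunc 0 1 x⌋ % 4 = 1 ∨ ⌊(2 : ℝ) ^ k * trunc 0 1 x⌋ % 4 = 2))

/-- Conjugate Gray function, identically `0` for `k < 0`. -/
def conjGray (k : ℤ) (x : ℝ) : Bool :=
  decide (0 ≤ k ∧ (⌊(2 : ℝ) ^ k * trunc 0 1 x⌋ % 4 = 2 ∨ ⌊(2 : ℝ) ^ k * trunc 0 1 x⌋ % 4 = 3))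

/-- `⌊log₂ (1/σ)⌋`. -/
def lev (σ : ℝ) : ℤ := ⌊Real.logb 2 (1 / σ)⌋

/-- Refinement function `h`. -/
def refine (σ : ℝ) (x : ℝ) : Bool :=
  decide (⌊(2 : ℝ) ^ (lev σ - 7) * x⌋ % 2 = 1)

/-- Conjugate refinement function. -/
def conjRefine (σ : ℝ) (x : ℝ) : Bool :=
  decide (⌊(2 : ℝ) ^ (lev σ - 7) * x - 1 / 2⌋ % 2 = 1)

/-- A bit as the real number `0` or `1`. -/
def bit (v : Bool) : ℝ := if v then 1 else 0

/-- Gaussian convolution `Φ_f(x) = 𝔼 f(X)`, `X ∼ N(x, σ²)`. -/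
def conv (σ : ℝ) (f : ℝ → Bool) (x : ℝ) : ℝ := ∫ y, bit (f y) ∂(normal x σ)

/-- `Dec_K(y_1, …, y_K)`. -/
def dec (K : ℕ) (y : ℕ → Bool) : Set ℝ :=
  {x | x ∈ Icc (0 : ℝ) 1 ∧ ∀ k : ℕ, 1 ≤ k → k ≤ K → gray k x = y k}

/-! ### Layout of the crude localization bits

Machines are numbered `0, …, m - 1` here, while bits are numbered from `1`. The first `q` machines
reserve the last bit of their transcript for another purpose. -/

/-- Number of crude localization bits sent by machine `i`. -/
def crudeCount {m : ℕ} (b : Fin m → ℕ) (q : ℕ) (i : Fin m) : ℕ :=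
  b i - if (i : ℕ) < q then 1 else 0

/-- Number of crude localization bits sent by the machines before machine `i`. -/
def offset {m : ℕ} (b : Fin m → ℕ) (q : ℕ) (i : Fin m) : ℕ :=
  ∑ j ∈ Finset.univ.filter (fun j : Fin m => j < i), crudeCount b q j

open Classical in
/-- The crude localization bit `U_k`, read off the transcripts. -/
def crudeBit {m : ℕ} (b : Fin m → ℕ) (q : ℕ) (z : Transcripts b) (k : ℕ) : Bool :=
  decide (∃ (i : Fin m) (t : Fin (b i)),
    (t : ℕ) < crudeCount b q i ∧ offset b q i + t + 1 = k ∧ z i t = true)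

open Classical in
/-- The last bit of the transcript of machine number `p`. -/
def lastBit {m : ℕ} (b : Fin m → ℕ) (z : Transcripts b) (p : ℕ) : Bool :=
  decide (∃ (i : Fin m) (t : Fin (b i)), (i : ℕ) = p ∧ (t : ℕ) + 1 = b i ∧ z i t = true)

/-! ### Pure localization: all bits are crude localization bits -/

/-- `Z_i` consists of the Gray functions number `s_{i-1} + 1, …, s_{i-1} + b_i` at `X_i`; the estimate
is the smallest element of `Dec_B(U_1, …, U_B)`. -/
def localization {m : ℕ} (b : Fin m → ℕ) : Protocol b where
  encode := fun i x t => gray ((offset b 0 i + t + 1 : ℕ) : ℤ) x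
  estimate := fun z => sInf (dec (∑ i, b i) (crudeBit b 0 z))

/-! ### Localization and refinement -/

/-- `n = max {s : ⌊log₂ s⌋² + 2 s ≤ B - ⌊log₂ (1/σ)⌋}`. -/
def numRef (σ : ℝ) (B : ℕ) : ℕ :=
  sSup {s : ℕ | (((Nat.log 2 s) ^ 2 + 2 * s : ℕ) : ℤ) ≤ (B : ℤ) - lev σ}

/-- Finer localization functions `f_k` (`k ≥ 1`), where `l = ⌊log₂ n⌋`. -/
def finer (σ : ℝ) (l k : ℕ) : ℝ → Bool :=
  if k = 1 then gray (lev σ - l - 2)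
  else if k = 2 then conjGray (lev σ - l - 2)
  else gray (lev σ - l - 4 + k)

section Refinement

variable {m : ℕ} (σ : ℝ) (b : Fin m → ℕ)

/-- The number `n` for the budgets `b`. -/
def nn : ℕ := numRef σ (∑ i, b i)

/-- `⌊log₂ n⌋`. -/
def ll : ℕ := Nat.log 2 (nn σ b)

/-- Number of machines that send a finer localization bit or a refinement bit. -/
def special : ℕ := ll σ b ^ 2 + 2 * nn σ b

/-- The transcripts: machines `0, …, l² - 1` end with a finer localization bit, the next `n` with a value
of `h`, the next `n` with a value of the conjugate of `h`; all other bits are crude localization bits. -/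
def refEncode (i : Fin m) (x : ℝ) (t : Fin (b i)) : Bool :=
  if (i : ℕ) < special σ b ∧ (t : ℕ) + 1 = b i then
    if (i : ℕ) < ll σ b ^ 2 then finer σ (ll σ b) ((i : ℕ) / ll σ b + 1) x
    else if (i : ℕ) < ll σ b ^ 2 + nn σ b then refine σ x
    else conjRefine σ x
  else gray ((offset b (special σ b) i + t + 1 : ℕ) : ℤ) x

variable (z : Transcripts b)

/-- `I_1'`. -/
def I1' : Set ℝ :=
  if lev σ - ll σ b ≤ 3 then Icc 0 1
  else dec (lev σ - ll σ b - 3).toNat (crudeBit b (special σ b) z)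

open Metric in
/-- The crude interval `I_1`, a subset of the parameter space `[0,1]`. -/
def I1 : Set ℝ :=
  if lev σ - ll σ b ≤ 3 then Icc 0 1
  else cthickening ((2 : ℝ) ^ (-(lev σ - ll σ b - 2))) (I1' σ b z) ∩ Icc 0 1

open Classical in
/-- The majority vote `W_k` over `W_{k,1}, …, W_{k,l}`, for `1 ≤ k ≤ l`. -/
def vote (k : ℕ) : Bool :=
  decide ((ll σ b : ℝ) / 2 ≤
    ∑ j ∈ Finset.range (ll σ b), bit (lastBit b z ((k - 1) * ll σ b + j)))

/-- The index `j` for which `f_j = g_r` (`1 ≤ r ≤ ⌊log₂ (1/σ)⌋ - 4`) when `⌊log₂ (1/σ)⌋ - l ≤ 3`: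
it is `l - ⌊log₂ (1/σ)⌋ + 4 + r`, but `1` where this expression is `2`, since `f_2` is a conjugate
Gray function and `f_1 = g_1` in that case. -/
def voteIndex (r : ℕ) : ℕ :=
  if (ll σ b : ℤ) - lev σ + 4 + r = 2 then 1 else ((ll σ b : ℤ) - lev σ + 4 + r).toNat

/-- `I_2'`. -/
def I2' : Set ℝ :=
  if lev σ - ll σ b ≤ 3 then
    if lev σ ≤ 4 then Icc 0 1
    else dec (lev σ - 4).toNat (fun r => vote σ b z (voteIndex σ b r))
  else {x | x ∈ I1 σ b z ∧
    ∀ k : ℕ, 1 ≤ k → k ≤ ll σ b → finer σ (ll σ b) k x = vote σ b z k}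

open Metric in
/-- The finer interval `I_2`. -/
def I2 : Set ℝ :=
  if lev σ - ll σ b ≤ 3 ∧ lev σ ≤ 4 then Icc 0 1
  else cthickening ((2 : ℝ) ^ (-(lev σ - 3))) (I2' σ b z)

/-- `I_2` is a non-empty subset of `[(2j - 3/4) w, (2j + 3/4) w]`, `w = 2^{-(⌊log₂ (1/σ)⌋ - 6)}`, for
some integer `j`. -/
def WindowA : Prop :=
  (I2 σ b z).Nonempty ∧ ∃ j : ℤ, I2 σ b z ⊆
    Icc ((2 * j - 3 / 4) * (2 : ℝ) ^ (-(lev σ - 6))) ((2 * j + 3 / 4) * (2 : ℝ) ^ (-(lev σ - 6)))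

/-- `I_2` is a non-empty subset of `[(2j + 1/4) w, (2j + 7/4) w]`, `w = 2^{-(⌊log₂ (1/σ)⌋ - 6)}`, for
some integer `j`. -/
def WindowB : Prop :=
  (I2 σ b z).Nonempty ∧ ∃ j : ℤ, I2 σ b z ⊆
    Icc ((2 * j + 1 / 4) * (2 : ℝ) ^ (-(lev σ - 6))) ((2 * j + 7 / 4) * (2 : ℝ) ^ (-(lev σ - 6)))

/-- `Φ⁻¹(τ_{[L,R]}(y))`, where `Φ⁻¹` is the inverse of `Φ` on the set `I` and `L`, `R` are the infimum
and the supremum of `Φ` on `I`. -/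
def invert (Φ : ℝ → ℝ) (I : Set ℝ) (y : ℝ) : ℝ :=
  Function.invFunOn Φ I (trunc (sInf (Φ '' I)) (sSup (Φ '' I)) y)

/-- `(V_1 + … + V_n) / n`. -/
def meanV : ℝ := (1 / (nn σ b : ℝ)) *
  ∑ j ∈ Finset.range (nn σ b), bit (lastBit b z (ll σ b ^ 2 + j))

/-- The mean of the conjugate refinement bits. -/
def meanVbar : ℝ := (1 / (nn σ b : ℝ)) *
  ∑ j ∈ Finset.range (nn σ b), bit (lastBit b z (ll σ b ^ 2 + nn σ b + j))

open Classical in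
/-- The final estimate. On the exceptional transcripts for which `I_2` is in neither kind of window,
the estimate is `e z`; below, `e z` is an arbitrary point of `I_1`. -/
def refEstimate (e : Transcripts b → ℝ) : ℝ :=
  if WindowA σ b z then invert (conv σ (refine σ)) (I2 σ b z) (meanV σ b z)
  else if WindowB σ b z then invert (conv σ (conjRefine σ)) (I2 σ b z) (meanVbar σ b z)
  else e z

/-- The protocol with crude localization, finer localization and refinement bits. -/
def refinement (e : Transcripts b → ℝ) : Protocol b where
  encode := refEncode σ b
  estimate := fun z => refEstimate σ b z e

end Refinement

/-! ### One bit per machine, for `σ ≥ 1` -/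

open Classical in
/-- `τ_{[0,1]}(σ Φ⁻¹(p))` with `Φ` the standard normal distribution function, where
`Φ⁻¹(0) = -∞` and `Φ⁻¹(1) = ∞`. -/
def probit (σ p : ℝ) : ℝ :=
  if p ≤ 0 then 0 else if 1 ≤ p then 1
  else trunc 0 1 (σ * Function.invFun (fun x => cdf (gaussianReal 0 1) x) p)

open Classical in
/-- Every machine sends the bit `1{X_i ≥ 0}`. -/
def oneBit (m : ℕ) (σ : ℝ) : Protocol (fun _ : Fin m => 1) where
  encode := fun _ x _ => decide (0 ≤ x)
  estimate := fun z => probit σ ((1 / (m : ℝ)) * ∑ i, bit (z i 0))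

/-! ### The whole procedure -/

/-- `IsModgame σ b P`: the protocol `P` with budgets `b` is an instance of the MODGAME procedure. The
constructors are its cases; what the procedure leaves open (the reduced budgets `b'` and
the points `e z`) is arbitrary. -/
inductive IsModgame {m : ℕ} (σ : ℝ) (b : Fin m → ℕ) : Protocol b → Prop
  | localize (hσ : σ < 1) (hB : ((∑ i, b i : ℕ) : ℝ) < Real.logb 2 (1 / σ) + 2) :
      IsModgame σ b (localization b)
  | refine (hσ : σ < 1) (hB : Real.logb 2 (1 / σ) + 2 ≤ ((∑ i, b i : ℕ) : ℝ))
      (hB' : ((∑ i, b i : ℕ) : ℝ) ≤ Real.logb 2 (1 / σ) + m)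
      (e : Transcripts b → ℝ) (he : ∀ z, e z ∈ I1 σ b z) :
      IsModgame σ b (refinement σ b e)
  | reduce (hσ : σ < 1) (hB : Real.logb 2 (1 / σ) + m < ((∑ i, b i : ℕ) : ℝ)) (hm : 2 ≤ m)
      (b' : Fin m → ℕ) (hb' : ∀ i, 1 ≤ b' i) (hle : ∀ i, b' i ≤ b i)
      (hsum : ((∑ i, b' i : ℕ) : ℤ) = lev σ + m)
      (e : Transcripts b' → ℝ) (he : ∀ z, e z ∈ I1 σ b' z) :
      IsModgame σ b ((refinement σ b' e).pad hle)
  | reduceOne (hσ : σ < 1) (hB : Real.logb 2 (1 / σ) + m < ((∑ i, b i : ℕ) : ℝ)) (hm : m = 1)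
      (b' : Fin m → ℕ) (hb' : ∀ i, 1 ≤ b' i) (hle : ∀ i, b' i ≤ b i)
      (hsum : ((∑ i, b' i : ℕ) : ℤ) = lev σ + m) :
      IsModgame σ b ((localization b').pad hle)
  | large (hσ : 1 ≤ σ) (hb : ∀ i, 1 ≤ b i) :
      IsModgame σ b ((oneBit m σ).pad hb)

end

end Modgame

/-!
The risk is bounded pointwise in the observations, so that nothing has to be known about the
measurability of the estimate: its squared error is at most a sum of terms whose expectations are known.

**Crude localization.** The `k`-fold iterated tent map folds `[0,1]` so that the Gray function number
`k + 1` tells on which side of `1/2` the image of `x` lies. A false Gray bit therefore does not spoil the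
following ones: it reflects the decoded point at the switching point next to `θ`, and moves it by twice
the distance `gap k θ` from `θ` to that point. So the error of decoding is at most one cell plus
`slip`, the sum of these distances over the false bits (`abs_place_cell_sub_le`). A bit is false with a
probability that decreases quickly in `gap k θ / σ`, and the switching points of different Gray functions
are separated (`le_gap_add_gap`); hence the fourth moment of `slip` is of the order `σ ^ 4`
(`lintegral_slip_pow_le`). This settles pure localization (`maxRisk_localization_le`).

**Finer localization.** At most one of the finer localization functions switches near `θ`
(`finerCell_switch_unique`), so that, whatever the vote for it may be, correct votes for all others are
consistent with a point of the same or of the neighbouring cell (`exists_consistent`). These functions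
determine the cell modulo `2 ^ l` (`floor_sub_eq_of_finer_eq`), and `I_1` selects the right one. The
interval `I_2` then contains `θ` and is short enough to be in a window
(`refEstimate_error_of_votes`, `refEstimate_error_of_votes_of_le`). The votes fail with a probability of
the order `l · 16⁻ˡ` (`measure_not_votesGood_le`), which compensates for an error of the order `2ˡ σ`.

**Refinement.** In a window, `h` or its conjugate is a single step near `I_2`, on a scale much larger
than `σ`. Its Gaussian convolution is therefore bi-Lipschitz there, in units of `σ`
(`conv_sub_bounds_of_isStep`), and its inversion turns the mean of the refinement bits into an estimate
with mean squared error of the order `σ² / n` (`refEstimate_error_of_mem`). For the inversion to be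
meaningful on every transcript, `I_2` has to be an interval whenever it is in a window; this holds since
gaps in `I_2'` are either closed by the thickening or too wide for a window (`ordConnected_I2`).

Finally `B - λ ≤ 8 n` (`numRef_spec`). For `σ ≥ 1`, the probit estimate inverts the bi-Lipschitz map
`θ ↦ Φ (θ / σ)` (`maxRisk_oneBit_le`).
-/

namespace Modgame

/-! ### The tent map and the switching points of the Gray functions -/

/-- The tent map. Iterating it `k` times folds `[0,1]` so that the switching points of the Gray
function number `k + 1` all come to lie at `1/2`. -/
def tent (x : ℝ) : ℝ := 1 - |2 * x - 1|

lemma tent_mem {x : ℝ} (hx : x ∈ Icc (0 : ℝ) 1) : tent x ∈ Icc (0 : ℝ) 1 := by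
  obtain ⟨h0, h1⟩ := hx
  unfold tent
  constructor
  · have : |2 * x - 1| ≤ 1 := abs_le.2 ⟨by linarith, by linarith⟩
    linarith
  · linarith [abs_nonneg (2 * x - 1)]

lemma tent_iterate_mem {x : ℝ} (hx : x ∈ Icc (0 : ℝ) 1) (k : ℕ) :
    tent^[k] x ∈ Icc (0 : ℝ) 1 := by
  induction k with
  | zero => simpa using hx
  | succ k ih => rw [Function.iterate_succ_apply']; exact tent_mem ih

lemma tent_of_le {x : ℝ} (h : x ≤ 1 / 2) : tent x = 2 * x := by
  unfold tent; rw [abs_of_nonpos (by linarith)]; ring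

lemma tent_of_ge {x : ℝ} (h : 1 / 2 ≤ x) : tent x = 2 - 2 * x := by
  unfold tent; rw [abs_of_nonneg (by linarith)]; ring

lemma abs_tent_iterate_sub_le (k : ℕ) (x y : ℝ) :
    |tent^[k] x - tent^[k] y| ≤ 2 ^ k * |x - y| := by
  induction k with
  | zero => simp
  | succ k ih =>
    rw [Function.iterate_succ_apply', Function.iterate_succ_apply']
    have lip : ∀ u v : ℝ, |tent u - tent v| ≤ 2 * |u - v| := by
      intro u v
      have h := abs_abs_sub_abs_le_abs_sub (2 * v - 1) (2 * u - 1)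
      have e1 : 2 * v - 1 - (2 * u - 1) = -(2 * (u - v)) := by ring
      have e2 : tent u - tent v = |2 * v - 1| - |2 * u - 1| := by unfold tent; ring
      rw [e1, abs_neg, abs_mul, abs_two] at h
      rwa [e2]
    have h1 := lip (tent^[k] x) (tent^[k] y)
    rw [pow_succ]
    linarith

/-- The distance from `x` to the switching points `(2 j + 1) / 2 ^ (k + 1)` of the Gray function
number `k + 1`, expressed through the tent map. -/
noncomputable def gap (k : ℕ) (x : ℝ) : ℝ := |tent^[k] x - 1 / 2| / 2 ^ k

lemma gap_nonneg (k : ℕ) (x : ℝ) : 0 ≤ gap k x := by unfold gap; positivity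

/-- Switching points of different Gray functions are separated: they are different multiples of
`2 ^ (-k - 1)`. -/
lemma le_gap_add_gap {j k : ℕ} (h : j < k) (x : ℝ) :
    (2 ^ (k + 1) : ℝ)⁻¹ ≤ gap j x + gap k x := by
  obtain ⟨r, rfl⟩ : ∃ r, k = (r + 1) + j := ⟨k - j - 1, by omega⟩
  have hz : ∀ s : ℕ, tent^[s] 0 = 0 := by
    intro s
    induction s with
    | zero => simp
    | succ s ih => rw [Function.iterate_succ_apply', ih]; simp [tent]
  have hhalf : |tent^[r + 1] (1 / 2 : ℝ) - 1 / 2| = 1 / 2 := by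
    rw [Function.iterate_succ_apply]
    have e : tent (1 / 2 : ℝ) = 1 := by simp [tent]
    rw [e]
    cases r with
    | zero => norm_num
    | succ r =>
      rw [Function.iterate_succ_apply]
      have e : tent (1 : ℝ) = 0 := by norm_num [tent]
      rw [e, hz]; norm_num
  set y := tent^[j] x
  have hk : tent^[r + 1 + j] x = tent^[r + 1] y := Function.iterate_add_apply _ _ _ _
  have hL := abs_tent_iterate_sub_le (r + 1) (1 / 2) y
  have htri : 1 / 2 ≤ |tent^[r + 1] (1 / 2 : ℝ) - tent^[r + 1] y| + |tent^[r + 1] y - 1 / 2| := by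
    refine hhalf.symm.trans_le ?_
    exact abs_sub_le (tent^[r + 1] (1 / 2 : ℝ)) (tent^[r + 1] y) (1 / 2)
  unfold gap
  rw [hk]
  change _ ≤ |y - 1 / 2| / 2 ^ j + _
  rw [abs_sub_comm y]
  have hp : (0 : ℝ) < 2 ^ j := by positivity
  have hq : (0 : ℝ) < 2 ^ (r + 1) := by positivity
  rw [pow_succ, pow_add, inv_le_iff_one_le_mul₀ (by positivity)]
  have : (|1 / 2 - y| / 2 ^ j + |tent^[r + 1] y - 1 / 2| / (2 ^ (r + 1) * 2 ^ j)) *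
      (2 ^ (r + 1) * 2 ^ j * 2) = 2 * (2 ^ (r + 1) * |1 / 2 - y| + |tent^[r + 1] y - 1 / 2|) := by
    field_simp
  linarith

/-- Summing `min (σ, σ² / gap)` over the scales: by the separation of the switching points, all
scales but one contribute a geometric series. -/
lemma sum_sq_div_max_gap_le {σ : ℝ} (hσ : 0 < σ) (x : ℝ) (K : ℕ) :
    ∑ k ∈ Finset.range K, σ ^ 2 / max σ (gap k x) ≤ σ + 4 * σ ^ 2 * 2 ^ K := by
  -- The term of the smallest gap is kept apart, so that it can be exchanged along the induction.
  have key : ∀ (K : ℕ) (d : ℝ), (∀ k < K, d ≤ gap k x) →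
      ∑ k ∈ Finset.range K, σ ^ 2 / max σ (gap k x) ≤ σ ^ 2 / max σ d + 4 * σ ^ 2 * 2 ^ K := by
    intro K
    induction K with
    | zero => intro d _; simp; positivity
    | succ K ih =>
      intro d hd
      have hbig : ∀ d : ℝ, (2 ^ (K + 2) : ℝ)⁻¹ ≤ d → σ ^ 2 / max σ d ≤ 4 * σ ^ 2 * 2 ^ K := by
        intro d hd
        have h1 : (0 : ℝ) < (2 ^ (K + 2))⁻¹ := by positivity
        calc σ ^ 2 / max σ d ≤ σ ^ 2 / (2 ^ (K + 2))⁻¹ := by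
              gcongr; exact hd.trans (le_max_right _ _)
          _ = 4 * σ ^ 2 * 2 ^ K := by rw [pow_add]; field_simp; norm_num
      rw [Finset.sum_range_succ, pow_succ (2 : ℝ) K]
      by_cases hg : (2 ^ (K + 2) : ℝ)⁻¹ ≤ gap K x
      · have h1 := hbig _ hg
        have h2 := ih d fun k hk => hd k (by omega)
        linarith
      · push Not at hg
        have hsep : ∀ k < K, (2 ^ (K + 2) : ℝ)⁻¹ ≤ gap k x := by
          intro k hk
          have := le_gap_add_gap hk x
          have e : (2 ^ (K + 1) : ℝ)⁻¹ = 2 * (2 ^ (K + 2) : ℝ)⁻¹ := by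
            rw [pow_succ (2 : ℝ) (K + 1)]; field_simp
          linarith
        have h1 := ih _ hsep
        have h2 := hbig _ le_rfl
        have h3 : σ ^ 2 / max σ (gap K x) ≤ σ ^ 2 / max σ d := by
          gcongr; exact hd K (by omega)
        linarith
  have hs := key K 0 fun k _ => gap_nonneg k x
  have e : σ ^ 2 / max σ 0 = σ := by rw [max_eq_left hσ.le]; field_simp
  rwa [e] at hs

/-! ### Decoding Gray bits -/

/-- The position in the dyadic cell number `a` of level `k` of the point that is folded to `t`:
cells of odd number are traversed backwards by the iterated tent map. -/
noncomputable def place (k a : ℕ) (t : ℝ) : ℝ := (a + if a % 2 = 0 then t else 1 - t) / 2 ^ k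

/-- The number of the dyadic cell of level `k` that is encoded by the Gray bits `y 1, …, y k`. -/
def cell (y : ℕ → Bool) : ℕ → ℕ
  | 0 => 0
  | k + 1 => 2 * cell y k + if (y (k + 1) = true ↔ cell y k % 2 = 0) then 1 else 0

lemma cell_lt (y : ℕ → Bool) (k : ℕ) : cell y k < 2 ^ k := by
  induction k with
  | zero => simp [cell]
  | succ k ih => rw [cell, pow_succ]; split_ifs <;> omega

lemma place_mem_Icc (k a : ℕ) {t : ℝ} (ht : t ∈ Icc (0 : ℝ) 1) :
    place k a t ∈ Icc ((a : ℝ) / 2 ^ k) ((a + 1) / 2 ^ k) := by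
  obtain ⟨h0, h1⟩ := ht
  unfold place
  constructor <;> gcongr <;> split_ifs <;> linarith

/-- A correct bit leaves the decoded point where it is. -/
lemma place_succ_eq (y : ℕ → Bool) (k : ℕ) {t : ℝ}
    (h : y (k + 1) = true ∧ 1 / 2 ≤ t ∨ y (k + 1) = false ∧ t ≤ 1 / 2) :
    place (k + 1) (cell y (k + 1)) (tent t) = place k (cell y k) t := by
  have hmod : ∀ n : ℕ, (2 * n + 1) % 2 = 1 := by omega
  unfold place
  rw [cell, pow_succ]
  rcases h with ⟨h, ht⟩ | ⟨h, ht⟩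
  · rw [tent_of_ge ht]
    by_cases hp : cell y k % 2 = 0
    · simp [h, hp, hmod]; field_simp; ring
    · simp [h, hp]; field_simp
  · rw [tent_of_le ht]
    by_cases hp : cell y k % 2 = 0
    · simp [h, hp]; field_simp
    · simp [h, hp, hmod]; field_simp; ring

/-- A false bit reflects the decoded point at a switching point. -/
lemma abs_place_succ_sub (y : ℕ → Bool) (k : ℕ) {t : ℝ}
    (h : y (k + 1) = false ∧ 1 / 2 ≤ t ∨ y (k + 1) = true ∧ t ≤ 1 / 2) :
    |place (k + 1) (cell y (k + 1)) (tent t) - place k (cell y k) t| =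
      2 * (|t - 1 / 2| / 2 ^ k) := by
  have hmod : ∀ n : ℕ, (2 * n + 1) % 2 = 1 := by omega
  have main : place (k + 1) (cell y (k + 1)) (tent t) - place k (cell y k) t =
      2 * ((t - 1 / 2) / 2 ^ k) ∨
      place (k + 1) (cell y (k + 1)) (tent t) - place k (cell y k) t =
      - (2 * ((t - 1 / 2) / 2 ^ k)) := by
    unfold place
    rw [cell, pow_succ]
    rcases h with ⟨h, ht⟩ | ⟨h, ht⟩
    · rw [tent_of_ge ht]
      by_cases hp : cell y k % 2 = 0
      · right; simp [h, hp]; field_simp; ring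
      · left; simp [h, hp, hmod]; field_simp; ring
    · rw [tent_of_le ht]
      by_cases hp : cell y k % 2 = 0
      · right; simp [h, hp, hmod]; field_simp; ring
      · left; simp [h, hp]; field_simp; ring
  have e : |2 * ((t - 1 / 2) / 2 ^ k)| = 2 * (|t - 1 / 2| / 2 ^ k) := by
    rw [abs_mul, abs_div, abs_two, abs_of_pos (by positivity : (0 : ℝ) < 2 ^ k)]
  rcases main with h | h <;> rw [h]
  · exact e
  · rw [abs_neg]; exact e

lemma exists_eq_place {x : ℝ} (k : ℕ) : ∃ a : ℕ, x = place k a (tent^[k] x) := by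
  induction k with
  | zero => exact ⟨0, by simp [place]⟩
  | succ k ih =>
    obtain ⟨a, ha⟩ := ih
    have hmod : ∀ n : ℕ, (2 * n + 1) % 2 = 1 := by omega
    rw [Function.iterate_succ_apply']
    set t := tent^[k] x
    have hx : ∀ z, x = z ↔ place k a t = z := fun z => by rw [← ha]
    simp only [hx]
    unfold place
    rw [pow_succ]
    rcases le_total t (1 / 2) with ht | ht
    · rw [tent_of_le ht]
      by_cases hp : a % 2 = 0
      · exact ⟨2 * a, by simp [hp]; field_simp⟩
      · exact ⟨2 * a + 1, by simp [hp, hmod]; field_simp; ring⟩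
    · rw [tent_of_ge ht]
      by_cases hp : a % 2 = 0
      · exact ⟨2 * a + 1, by simp [hp, hmod]; field_simp; ring⟩
      · exact ⟨2 * a, by simp [hp]; field_simp⟩

lemma trunc_of_mem {l r x : ℝ} (hx : x ∈ Icc l r) : trunc l r x = x := by
  unfold trunc
  obtain ⟨h0, h1⟩ := hx
  split_ifs with h h'
  · linarith
  · rfl
  · linarith

lemma trunc_eq {l r : ℝ} (h : l ≤ r) (x : ℝ) : trunc l r x = max l (min r x) := by
  unfold trunc
  split_ifs with h1 h2
  · rw [min_eq_right (h1.trans h), max_eq_left h1]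
  · rw [min_eq_right h2.le, max_eq_right (not_le.1 h1).le]
  · rw [min_eq_left (not_lt.1 h2), max_eq_right h]

lemma trunc_mem {l r : ℝ} (h : l ≤ r) (x : ℝ) : trunc l r x ∈ Icc l r := by
  rw [trunc_eq h]; exact ⟨le_max_left _ _, max_le h (min_le_left _ _)⟩

lemma abs_trunc_sub_trunc_le {l r : ℝ} (h : l ≤ r) (x y : ℝ) :
    |trunc l r x - trunc l r y| ≤ |x - y| := by
  rw [trunc_eq h, trunc_eq h]
  refine (abs_max_sub_max_le_max _ _ _ _).trans ?_
  simp only [sub_self, abs_zero]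
  refine max_le (abs_nonneg _) ((abs_min_sub_min_le_max _ _ _ _).trans ?_)
  simp

lemma abs_trunc_sub_le {l r y : ℝ} (hy : y ∈ Icc l r) (x : ℝ) : |trunc l r x - y| ≤ |x - y| := by
  conv_lhs => rw [← trunc_of_mem hy]
  exact abs_trunc_sub_trunc_le (hy.1.trans hy.2) x y

lemma gray_eq {x : ℝ} (hx : x ∈ Icc (0 : ℝ) 1) (k : ℕ) :
    gray k x = decide (⌊(2 : ℝ) ^ k * x⌋ % 4 = 1 ∨ ⌊(2 : ℝ) ^ k * x⌋ % 4 = 2) := by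
  simp [gray, trunc_of_mem hx]

lemma gray_trunc (k : ℤ) (x : ℝ) : gray k (trunc 0 1 x) = gray k x := by
  simp [gray, trunc_of_mem (trunc_mem zero_le_one x)]

lemma conjGray_trunc (k : ℤ) (x : ℝ) : conjGray k (trunc 0 1 x) = conjGray k x := by
  simp [conjGray, trunc_of_mem (trunc_mem zero_le_one x)]

/-- Away from its switching points, the Gray function number `k + 1` tells on which side of `1/2`
the `k`-fold tent map is. -/
lemma gray_succ_side {x : ℝ} (hx : x ∈ Icc (0 : ℝ) 1) (k : ℕ) :
    (gray ((k + 1 : ℕ) : ℤ) x = true ∧ 1 / 2 ≤ tent^[k] x) ∨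
    (gray ((k + 1 : ℕ) : ℤ) x = false ∧ tent^[k] x ≤ 1 / 2) := by
  rw [gray_eq hx]
  obtain ⟨a, ha⟩ := exists_eq_place (x := x) k
  obtain ⟨h0, h1⟩ := tent_iterate_mem hx k
  set t := tent^[k] x
  have e : (2 : ℝ) ^ (k + 1) * x = 2 * (a + if a % 2 = 0 then t else 1 - t) := by
    rw [ha, place, pow_succ]; field_simp
  rw [e]
  set f := ⌊(2 : ℝ) * (a + if a % 2 = 0 then t else 1 - t)⌋ with hf
  have f1 := Int.floor_le ((2 : ℝ) * (a + if a % 2 = 0 then t else 1 - t))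
  have f2 := Int.lt_floor_add_one ((2 : ℝ) * (a + if a % 2 = 0 then t else 1 - t))
  rw [← hf] at f1 f2
  by_cases hp : a % 2 = 0
  · simp only [hp, if_true] at f1 f2
    rcases lt_or_ge t (1 / 2) with ht | ht
    · right
      have g1 : f < 2 * a + 1 := by exact_mod_cast (by push_cast; linarith : (f : ℝ) < (2 * a + 1 : ℤ))
      have g2 : 2 * (a : ℤ) < f + 1 := by
        exact_mod_cast (by push_cast; linarith : ((2 * a : ℤ) : ℝ) < (f + 1 : ℤ))
      exact ⟨by simp; omega, ht.le⟩
    · left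
      have g1 : f < 2 * a + 3 := by exact_mod_cast (by push_cast; linarith : (f : ℝ) < (2 * a + 3 : ℤ))
      have g2 : 2 * (a : ℤ) + 1 < f + 1 := by
        exact_mod_cast (by push_cast; linarith : ((2 * a + 1 : ℤ) : ℝ) < (f + 1 : ℤ))
      exact ⟨by simp; omega, ht⟩
  · simp only [hp, if_false] at f1 f2
    rcases le_or_gt t (1 / 2) with ht | ht
    · right
      have g1 : f < 2 * a + 3 := by exact_mod_cast (by push_cast; linarith : (f : ℝ) < (2 * a + 3 : ℤ))
      have g2 : 2 * (a : ℤ) + 1 < f + 1 := by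
        exact_mod_cast (by push_cast; linarith : ((2 * a + 1 : ℤ) : ℝ) < (f + 1 : ℤ))
      exact ⟨by simp; omega, ht⟩
    · left
      have g1 : f < 2 * a + 1 := by exact_mod_cast (by push_cast; linarith : (f : ℝ) < (2 * a + 1 : ℤ))
      have g2 : 2 * (a : ℤ) < f + 1 := by
        exact_mod_cast (by push_cast; linarith : ((2 * a : ℤ) : ℝ) < (f + 1 : ℤ))
      exact ⟨by simp; omega, ht.le⟩

/-- The Gray function number `k + 1` can take different values at two points only if their distance
is at least the gap. -/
lemma gap_le_of_gray_ne {x θ : ℝ} (hθ : θ ∈ Icc (0 : ℝ) 1) {k : ℕ}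
    (h : gray ((k + 1 : ℕ) : ℤ) x ≠ gray ((k + 1 : ℕ) : ℤ) θ) : gap k θ ≤ |x - θ| := by
  rw [← gray_trunc _ x] at h
  have hx := trunc_mem zero_le_one x
  have hL := abs_tent_iterate_sub_le k (trunc 0 1 x) θ
  have hT := abs_trunc_sub_le hθ x
  have key : |tent^[k] θ - 1 / 2| ≤ |tent^[k] (trunc 0 1 x) - tent^[k] θ| := by
    rcases gray_succ_side hx k with ⟨a, b⟩ | ⟨a, b⟩ <;>
      rcases gray_succ_side hθ k with ⟨a', b'⟩ | ⟨a', b'⟩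
    · exact absurd (a.trans a'.symm) h
    · rw [abs_of_nonpos (by linarith), abs_of_nonneg (by linarith)]; linarith
    · rw [abs_of_nonneg (by linarith), abs_of_nonpos (by linarith)]; linarith
    · exact absurd (a.trans a'.symm) h
  rw [gap, div_le_iff₀ (by positivity)]
  calc _ ≤ _ := key
    _ ≤ 2 ^ k * |trunc 0 1 x - θ| := hL
    _ ≤ 2 ^ k * |x - θ| := by gcongr
    _ = _ := mul_comm _ _

/-- The false bits among `y 1, …, y K`, each weighted with the distance by which it moves the decoded
point: twice the distance from `θ` to the switching points. -/
noncomputable def slip (θ : ℝ) (y : ℕ → Bool) (K : ℕ) : ℝ :=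
  ∑ k ∈ Finset.range K, if y (k + 1) = gray ((k + 1 : ℕ) : ℤ) θ then 0 else 2 * gap k θ

/-- The cell decoded from `y` contains a point whose distance from `θ` is at most `slip θ y K`. -/
lemma abs_place_cell_sub_le {θ : ℝ} (hθ : θ ∈ Icc (0 : ℝ) 1) (y : ℕ → Bool) (K : ℕ) :
    |place K (cell y K) (tent^[K] θ) - θ| ≤ slip θ y K := by
  unfold slip
  induction K with
  | zero => simp [place, cell]
  | succ K ih =>
    rw [Finset.sum_range_succ, Function.iterate_succ_apply']
    have tri := abs_sub_le (place (K + 1) (cell y (K + 1)) (tent (tent^[K] θ)))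
      (place K (cell y K) (tent^[K] θ)) θ
    have step : |place (K + 1) (cell y (K + 1)) (tent (tent^[K] θ)) -
        place K (cell y K) (tent^[K] θ)| ≤
        if y (K + 1) = gray ((K + 1 : ℕ) : ℤ) θ then 0 else 2 * gap K θ := by
      split_ifs with h
      · rw [place_succ_eq y K (by rw [h]; exact gray_succ_side hθ K)]; simp
      · refine (abs_place_succ_sub y K ?_).le
        rcases gray_succ_side hθ K with ⟨a, b⟩ | ⟨a, b⟩
        · left; exact ⟨by rw [a] at h; simpa using h, b⟩
        · right; exact ⟨by rw [a] at h; simpa using h, b⟩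
    linarith

/-- Up to its right end point, the decoded set is a dyadic cell. -/
lemma dec_subset (y : ℕ → Bool) (K : ℕ) :
    Ico ((cell y K : ℝ) / 2 ^ K) ((cell y K + 1) / 2 ^ K) ⊆ dec K y ∧
      dec K y ⊆ Icc ((cell y K : ℝ) / 2 ^ K) ((cell y K + 1) / 2 ^ K) := by
  have h01 : ∀ K, Icc ((cell y K : ℝ) / 2 ^ K) ((cell y K + 1) / 2 ^ K) ⊆ Icc (0 : ℝ) 1 := by
    intro K
    refine Icc_subset_Icc (by positivity) ?_
    rw [div_le_one (by positivity)]
    exact_mod_cast cell_lt y K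
  have hsucc : ∀ K, dec (K + 1) y = {x | x ∈ dec K y ∧ gray ((K + 1 : ℕ) : ℤ) x = y (K + 1)} := by
    intro K
    ext x
    constructor
    · rintro ⟨h, h'⟩
      exact ⟨⟨h, fun k h1 h2 => h' k h1 (by omega)⟩, h' _ (by omega) le_rfl⟩
    · rintro ⟨⟨h, h'⟩, h2⟩
      refine ⟨h, fun k h1 h3 => ?_⟩
      rcases Nat.le_succ_iff.1 h3 with h4 | rfl
      · exact h' k h1 h4
      · exact h2
  induction K with
  | zero =>
    have : dec 0 y = Icc 0 1 := by
      ext x; simp only [dec, mem_ofPred_eq, and_iff_left_iff_imp]; intro _ k h1 h2; omega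
    rw [this]; simp [cell, Ico_subset_Icc_self]
  | succ K ih =>
    set a := cell y K with ha
    have e0 : ((2 * a : ℕ) : ℝ) / 2 ^ (K + 1) = a / 2 ^ K := by
      rw [pow_succ]; push_cast; field_simp
    have e1 : ((2 * a + 1 + 1 : ℕ) : ℝ) / 2 ^ (K + 1) = (a + 1) / 2 ^ K := by
      rw [pow_succ]; push_cast; field_simp; ring
    -- the value of the next Gray function on the two halves of the cell
    have hleft : ∀ x ∈ Icc (0 : ℝ) 1, ((2 * a : ℕ) : ℝ) / 2 ^ (K + 1) ≤ x →
        x < ((2 * a + 1 : ℕ) : ℝ) / 2 ^ (K + 1) →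
        gray ((K + 1 : ℕ) : ℤ) x = decide (a % 2 = 1) := by
      intro x hx h1 h2
      rw [gray_eq hx]
      have : ⌊(2 : ℝ) ^ (K + 1) * x⌋ = (2 * a : ℕ) := by
        rw [Int.floor_eq_iff]
        rw [div_le_iff₀ (by positivity)] at h1
        rw [lt_div_iff₀ (by positivity)] at h2
        push_cast at h1 h2 ⊢
        constructor <;> linarith
      rw [this]; rw [decide_eq_decide]; push_cast; omega
    have hright : ∀ x ∈ Icc (0 : ℝ) 1, ((2 * a + 1 : ℕ) : ℝ) / 2 ^ (K + 1) ≤ x →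
        x ≤ ((2 * a + 1 + 1 : ℕ) : ℝ) / 2 ^ (K + 1) →
        gray ((K + 1 : ℕ) : ℤ) x = decide (a % 2 = 0) := by
      intro x hx h1 h2
      rw [gray_eq hx]
      have g1 := Int.floor_le ((2 : ℝ) ^ (K + 1) * x)
      have g2 := Int.lt_floor_add_one ((2 : ℝ) ^ (K + 1) * x)
      rw [div_le_iff₀ (by positivity)] at h1
      rw [le_div_iff₀ (by positivity)] at h2
      set f := ⌊(2 : ℝ) ^ (K + 1) * x⌋
      push_cast at h1 h2
      have g3 : f ≤ 2 * a + 2 := by exact_mod_cast (by push_cast; linarith : (f : ℝ) ≤ (2 * a + 2 : ℤ))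
      have g4 : 2 * (a : ℤ) + 1 < f + 1 := by
        exact_mod_cast (by push_cast; linarith : ((2 * a + 1 : ℤ) : ℝ) < (f + 1 : ℤ))
      rw [decide_eq_decide]; omega
    have hmid1 : ((2 * a : ℕ) : ℝ) / 2 ^ (K + 1) ≤ ((2 * a + 1 : ℕ) : ℝ) / 2 ^ (K + 1) := by
      gcongr; omega
    have hmid2 : ((2 * a + 1 : ℕ) : ℝ) / 2 ^ (K + 1) ≤ ((2 * a + 1 + 1 : ℕ) : ℝ) / 2 ^ (K + 1) := by
      gcongr; omega
    obtain ⟨ih1, ih2⟩ := ih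
    rw [← e0, ← e1] at ih1 ih2
    have hsub : ∀ x, x ∈ Icc (((2 * a : ℕ) : ℝ) / 2 ^ (K + 1)) (((2 * a + 1 + 1 : ℕ) : ℝ) / 2 ^ (K + 1)) →
        x ∈ Icc (0 : ℝ) 1 := by rw [e0, e1]; exact fun x hx => h01 K hx
    rw [hsucc, cell, ← ha]
    by_cases hy : (y (K + 1) = true ↔ a % 2 = 0)
    · rw [if_pos hy]
      have hy' : y (K + 1) = decide (a % 2 = 0) := by
        rw [Bool.eq_iff_iff, hy]; simp
      rw [hy', ← Nat.cast_add_one]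
      constructor
      · intro x hx
        have hx' := hsub x ⟨hmid1.trans hx.1, hx.2.le⟩
        exact ⟨ih1 ⟨hmid1.trans hx.1, hx.2⟩, hright x hx' hx.1 hx.2.le⟩
      · rintro x ⟨hx, hg⟩
        have hx' := ih2 hx
        refine ⟨?_, hx'.2⟩
        by_contra hlt
        push Not at hlt
        rw [hleft x (hsub x hx') hx'.1 hlt, decide_eq_decide] at hg
        omega
    · rw [if_neg hy]
      have hy' : y (K + 1) = decide (a % 2 = 1) := by
        rw [Bool.eq_iff_iff, decide_eq_true_iff]
        rcases Nat.mod_two_eq_zero_or_one a with h | h <;> simp_all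
      rw [hy', ← Nat.cast_add_one, add_zero]
      constructor
      · intro x hx
        have hx' := hsub x ⟨hx.1, hx.2.le.trans hmid2⟩
        exact ⟨ih1 ⟨hx.1, hx.2.trans_le hmid2⟩, hleft x hx' hx.1 hx.2⟩
      · rintro x ⟨hx, hg⟩
        have hx' := ih2 hx
        refine ⟨hx'.1, ?_⟩
        by_contra hlt
        push Not at hlt
        rw [hright x (hsub x hx') hlt.le hx'.2, decide_eq_decide] at hg
        omega

/-! ### Normal observations -/

lemma normal_eq (θ σ : ℝ) : normal θ σ = gaussianReal θ (NNReal.mk (σ ^ 2) (sq_nonneg σ)) := rfl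

instance isProbabilityMeasure_normal (θ σ : ℝ) : IsProbabilityMeasure (normal θ σ) := by
  rw [normal_eq]; infer_instance

lemma normal_eq_map (θ σ : ℝ) :
    normal θ σ = (gaussianReal 0 1).map (fun u => θ + σ * u) := by
  have h1 : (gaussianReal 0 1).map (fun u => σ * u) = gaussianReal 0 (NNReal.mk (σ ^ 2) (sq_nonneg σ)) := by
    have := gaussianReal_map_const_mul (μ := 0) (v := 1) σ
    simpa using this
  have h2 : (fun u : ℝ => θ + σ * u) = (fun u => θ + u) ∘ (fun u => σ * u) := rfl
  rw [h2, ← Measure.map_map (by fun_prop) (by fun_prop), h1, gaussianReal_map_const_add, normal_eq]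
  simp

lemma hasSubgaussianMGF_gaussian : HasSubgaussianMGF (fun u : ℝ => u) 1 (gaussianReal 0 1) := by
  refine ⟨fun t => integrable_exp_mul_gaussianReal t, fun t => ?_⟩
  rw [mgf_fun_id_gaussianReal]
  simp

/-- A polynomial tail bound is enough: the exponent `8` is what a fourth moment of the crude error needs,
since the weights in `lintegral_slip_pow_le` are `σ² / gap`. -/
lemma gaussian_abs_ge_le {u : ℝ} (hu : 0 < u) :
    (gaussianReal 0 1).real {z | u ≤ |z|} ≤ 768 / u ^ 8 := by
  have h1 := hasSubgaussianMGF_gaussian.measure_ge_le hu.le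
  have h2 := hasSubgaussianMGF_gaussian.neg.measure_ge_le hu.le
  have hsub : {z : ℝ | u ≤ |z|} ⊆ {z | u ≤ z} ∪ {z | u ≤ (-(fun z : ℝ => z)) z} := by
    intro z hz
    simpa [le_abs] using hz
  have h3 : Real.exp (-u ^ 2 / (2 * (1 : ℝ≥0))) ≤ 384 / u ^ 8 := by
    have := Real.pow_div_factorial_le_exp (u ^ 2 / 2) (by positivity) 4
    have e : -u ^ 2 / (2 * ((1 : ℝ≥0) : ℝ)) = -(u ^ 2 / 2) := by simp; ring
    rw [e, Real.exp_neg, inv_le_comm₀ (Real.exp_pos _) (by positivity)]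
    refine le_trans (le_of_eq ?_) this
    simp [Nat.factorial]; field_simp; norm_num
  calc _ ≤ _ := measureReal_mono hsub
    _ ≤ _ := measureReal_union_le _ _
    _ ≤ 384 / u ^ 8 + 384 / u ^ 8 := add_le_add (h1.trans h3) (h2.trans h3)
    _ = _ := by ring

lemma normal_abs_sub_ge_le (θ : ℝ) {σ d : ℝ} (hσ : 0 < σ) (hd : 0 < d) :
    normal θ σ {x | d ≤ |x - θ|} ≤ ENNReal.ofReal (768 * (σ / d) ^ 8) := by
  have hm : MeasurableSet {x : ℝ | d ≤ |x - θ|} :=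
    measurableSet_le measurable_const (by fun_prop)
  rw [normal_eq_map, Measure.map_apply (by fun_prop) hm]
  have e : (fun u => θ + σ * u) ⁻¹' {x : ℝ | d ≤ |x - θ|} = {z | d / σ ≤ |z|} := by
    ext z
    simp [abs_mul, abs_of_pos hσ, div_le_iff₀ hσ, mul_comm]
  have := gaussian_abs_ge_le (div_pos hd hσ)
  rw [e, ← ofReal_measureReal]
  refine ENNReal.ofReal_le_ofReal (this.trans (le_of_eq ?_))
  field_simp

/-! ### Measurability of the encoding functions -/

lemma measurable_trunc (l r : ℝ) : Measurable (trunc l r) := by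
  unfold trunc
  refine Measurable.ite measurableSet_Iic measurable_const ?_
  exact Measurable.ite measurableSet_Iio measurable_id measurable_const

lemma measurable_gray (k : ℤ) : Measurable (gray k) := by
  have h : gray k = (fun n : ℤ => decide (0 ≤ k ∧ (n % 4 = 1 ∨ n % 4 = 2))) ∘
      (fun x => ⌊(2 : ℝ) ^ k * trunc 0 1 x⌋) := rfl
  rw [h]
  exact (measurable_of_countable _).comp
    (Int.measurable_floor.comp ((measurable_trunc 0 1).const_mul _))

lemma measurable_conjGray (k : ℤ) : Measurable (conjGray k) := by
  have h : conjGray k = (fun n : ℤ => decide (0 ≤ k ∧ (n % 4 = 2 ∨ n % 4 = 3))) ∘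
      (fun x => ⌊(2 : ℝ) ^ k * trunc 0 1 x⌋) := rfl
  rw [h]
  exact (measurable_of_countable _).comp
    (Int.measurable_floor.comp ((measurable_trunc 0 1).const_mul _))

lemma measurable_refine (σ : ℝ) : Measurable (refine σ) := by
  have h : refine σ = (fun n : ℤ => decide (n % 2 = 1)) ∘
      (fun x => ⌊(2 : ℝ) ^ (lev σ - 7) * x⌋) := rfl
  rw [h]
  exact (measurable_of_countable _).comp (Int.measurable_floor.comp (by fun_prop))

lemma measurable_conjRefine (σ : ℝ) : Measurable (conjRefine σ) := by
  have h : conjRefine σ = (fun n : ℤ => decide (n % 2 = 1)) ∘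
      (fun x => ⌊(2 : ℝ) ^ (lev σ - 7) * x - 1 / 2⌋) := rfl
  rw [h]
  exact (measurable_of_countable _).comp (Int.measurable_floor.comp (by fun_prop))

lemma measurable_finer (σ : ℝ) (l k : ℕ) : Measurable (finer σ l k) := by
  unfold finer
  split_ifs
  · exact measurable_gray _
  · exact measurable_conjGray _
  · exact measurable_gray _

lemma bit_mem (v : Bool) : bit v ∈ Icc (0 : ℝ) 1 := by
  unfold bit; split_ifs <;> simp

lemma measurable_bit : Measurable bit := measurable_of_countable _

/-! ### Expectations of crude errors, votes and means -/

lemma pi_eval_apply {m : ℕ} (μ : Measure ℝ) [IsProbabilityMeasure μ] (i : Fin m) {A : Set ℝ}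
    (hA : MeasurableSet A) : Measure.pi (fun _ : Fin m => μ) {x | x i ∈ A} = μ A :=
  (measurePreserving_eval (fun _ : Fin m => μ) i).measure_preimage hA.nullMeasurableSet

/-- Jensen's inequality for the fourth power, with weights `w i`. -/
lemma sum_pow_four_le {ι : Type*} (s : Finset ι) (a w : ι → ℝ) (hw : ∀ i ∈ s, 0 < w i)
    (ha : ∀ i ∈ s, 0 ≤ a i) :
    (∑ i ∈ s, a i) ^ 4 ≤ (∑ i ∈ s, w i) ^ 3 * ∑ i ∈ s, a i ^ 4 / w i ^ 3 := by
  rcases s.eq_empty_or_nonempty with rfl | hs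
  · simp
  have hW : 0 < ∑ i ∈ s, w i := Finset.sum_pos hw hs
  set W := ∑ i ∈ s, w i
  have h := Real.pow_arith_mean_le_arith_mean_pow s (fun i => w i / W) (fun i => a i * W / w i)
    (fun i hi => div_nonneg (hw i hi).le hW.le) (by rw [← Finset.sum_div, div_self hW.ne'])
    (fun i hi => div_nonneg (mul_nonneg (ha i hi) hW.le) (hw i hi).le) 4
  have e1 : ∑ i ∈ s, w i / W * (a i * W / w i) = ∑ i ∈ s, a i := by
    refine Finset.sum_congr rfl fun i hi => ?_
    have := (hw i hi).ne'
    field_simp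
  have e2 : ∑ i ∈ s, w i / W * (a i * W / w i) ^ 4 = W ^ 3 * ∑ i ∈ s, a i ^ 4 / w i ^ 3 := by
    rw [Finset.mul_sum]
    refine Finset.sum_congr rfl fun i hi => ?_
    have := (hw i hi).ne'
    field_simp
  rwa [e1, e2] at h

/-- The fourth moment of the error of crude localization. -/
lemma lintegral_slip_pow_le {m : ℕ} {σ θ : ℝ} (hσ : 0 < σ) (hθ : θ ∈ Icc (0 : ℝ) 1)
    (i : ℕ → Fin m) (K : ℕ) :
    ∫⁻ x, ENNReal.ofReal (slip θ (fun k => gray k (x (i k))) K ^ 4)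
      ∂(Measure.pi fun _ : Fin m => normal θ σ) ≤
    ENNReal.ofReal (12288 * (σ + 4 * σ ^ 2 * 2 ^ K) ^ 4) := by
  set w : ℕ → ℝ := fun k => σ ^ 2 / max σ (gap k θ) with hw
  have hmax : ∀ k, 0 < max σ (gap k θ) := fun k => hσ.trans_le (le_max_left _ _)
  have hwpos : ∀ k, 0 < w k := fun k => div_pos (by positivity) (hmax k)
  set W := ∑ k ∈ Finset.range K, w k with hW
  have hW0 : 0 ≤ W := Finset.sum_nonneg fun k _ => (hwpos k).le
  set F : ℕ → Set ℝ := fun k => {u | gray ((k + 1 : ℕ) : ℤ) u ≠ gray ((k + 1 : ℕ) : ℤ) θ} with hF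
  have hFm : ∀ k, MeasurableSet (F k) := fun k =>
    (measurable_gray _) (MeasurableSet.of_discrete (s := {b | b ≠ gray ((k + 1 : ℕ) : ℤ) θ}))
  have hprob : ∀ k, normal θ σ (F k) ≤ ENNReal.ofReal (768 * (w k / gap k θ) ^ 4) ∨ gap k θ = 0 := by
    intro k
    rcases (gap_nonneg k θ).eq_or_lt with h0 | hg
    · exact Or.inr h0.symm
    left
    rcases le_total (gap k θ) σ with h | h
    · refine prob_le_one.trans ?_
      rw [← ENNReal.ofReal_one]
      refine ENNReal.ofReal_le_ofReal ?_
      have : 1 ≤ w k / gap k θ := by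
        rw [one_le_div hg, hw]
        simp only [max_eq_left h]
        rw [sq, mul_div_assoc, div_self hσ.ne']; linarith
      nlinarith [one_le_pow₀ this (n := 4)]
    · refine (measure_mono fun u hu => gap_le_of_gray_ne hθ hu).trans
        ((normal_abs_sub_ge_le θ hσ hg).trans (le_of_eq ?_))
      congr 2
      simp only [hw, max_eq_right h]
      field_simp
  have hpt : ∀ x : Fin m → ℝ, ENNReal.ofReal (slip θ (fun k => gray k (x (i k))) K ^ 4) ≤
      ∑ k ∈ Finset.range K, ENNReal.ofReal (W ^ 3 * ((2 * gap k θ) ^ 4 / w k ^ 3)) *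
        {x : Fin m → ℝ | x (i (k + 1)) ∈ F k}.indicator 1 x := by
    intro x
    set a : ℕ → ℝ := fun k => if gray ((k + 1 : ℕ) : ℤ) (x (i (k + 1))) = gray ((k + 1 : ℕ) : ℤ) θ
      then 0 else 2 * gap k θ with ha
    have h1 : slip θ (fun k => gray k (x (i k))) K ^ 4 ≤ W ^ 3 * ∑ k ∈ Finset.range K, a k ^ 4 / w k ^ 3 :=
      sum_pow_four_le _ a w (fun k _ => hwpos k) fun k _ => by
        simp only [ha]; split_ifs
        · exact le_rfl
        · linarith [gap_nonneg k θ]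
    refine (ENNReal.ofReal_le_ofReal h1).trans ?_
    rw [Finset.mul_sum, ENNReal.ofReal_sum_of_nonneg]
    · refine Finset.sum_le_sum fun k _ => ?_
      by_cases h : gray ((k + 1 : ℕ) : ℤ) (x (i (k + 1))) = gray ((k + 1 : ℕ) : ℤ) θ
      · simp only [ha, if_pos h]; simp
      · have : x ∈ {x : Fin m → ℝ | x (i (k + 1)) ∈ F k} := h
        rw [indicator_of_mem this]
        simp only [ha, if_neg h, Pi.one_apply, mul_one]
        exact le_rfl
    · intro k _
      have := hwpos k
      positivity
  have hmeas : ∀ k, MeasurableSet {x : Fin m → ℝ | x (i (k + 1)) ∈ F k} := fun k =>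
    measurable_pi_apply _ (hFm k)
  calc _ ≤ _ := lintegral_mono hpt
    _ = ∑ k ∈ Finset.range K, ENNReal.ofReal (W ^ 3 * ((2 * gap k θ) ^ 4 / w k ^ 3)) *
          normal θ σ (F k) := by
        rw [lintegral_finsetSum]
        · refine Finset.sum_congr rfl fun k _ => ?_
          rw [lintegral_const_mul _ (measurable_one.indicator (hmeas k)),
            lintegral_indicator_one (hmeas k), pi_eval_apply _ _ (hFm k)]
        · intro k _
          exact (measurable_one.indicator (hmeas k)).const_mul _
    _ ≤ ∑ k ∈ Finset.range K, ENNReal.ofReal (12288 * W ^ 3 * w k) := by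
        refine Finset.sum_le_sum fun k _ => ?_
        have hwk := hwpos k
        rcases hprob k with h | h
        · calc _ ≤ ENNReal.ofReal (W ^ 3 * ((2 * gap k θ) ^ 4 / w k ^ 3)) *
                ENNReal.ofReal (768 * (w k / gap k θ) ^ 4) := by gcongr
            _ = ENNReal.ofReal (W ^ 3 * ((2 * gap k θ) ^ 4 / w k ^ 3) *
                (768 * (w k / gap k θ) ^ 4)) := (ENNReal.ofReal_mul (by positivity)).symm
            _ ≤ _ := by
                refine ENNReal.ofReal_le_ofReal ?_
                rcases (gap_nonneg k θ).eq_or_lt with h0 | hg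
                · rw [← h0]; simp; positivity
                · refine le_of_eq ?_
                  field_simp; ring
        · rw [h]; simp
    _ = ENNReal.ofReal (12288 * W ^ 4) := by
        rw [← ENNReal.ofReal_sum_of_nonneg, ← Finset.mul_sum, ← hW]
        · congr 1; ring
        · intro k _; have := hwpos k; positivity
    _ ≤ _ := by
        refine ENNReal.ofReal_le_ofReal ?_
        have := sum_sq_div_max_gap_le hσ θ K
        gcongr

/-- A majority among independent bits, each of which is false with probability at most `2⁻¹⁰`, is
false with exponentially small probability. -/
lemma measure_majority_le {m : ℕ} (μ : Measure ℝ) [IsProbabilityMeasure μ] {A : Set ℝ}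
    (hA : MeasurableSet A) (hp : μ A ≤ ENNReal.ofReal (1 / 1024)) (s : Finset (Fin m))
    (N : (Fin m → ℝ) → ℕ) (hN : ∀ x, N x = (∑ i ∈ s, A.indicator 1 (x i) : ℕ)) :
    Measure.pi (fun _ : Fin m => μ) {x | s.card ≤ 2 * N x} ≤
      ENNReal.ofReal ((1 / 16) ^ s.card) := by
  -- Markov's inequality for the product of the weights `1024` of the false bits
  set f : Fin m → ℝ → ℝ := fun i u => if i ∈ s then 1 + 1023 * A.indicator 1 u else 1 with hf
  have hind : Integrable (A.indicator (1 : ℝ → ℝ)) μ :=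
    (integrable_const (1 : ℝ)).indicator hA
  have hfi : ∀ i, Integrable (f i) μ := by
    intro i
    simp only [hf]
    split_ifs
    · exact (integrable_const _).add (hind.const_mul _)
    · exact integrable_const _
  have hf1 : ∀ i u, 1 ≤ f i u := by
    intro i u
    simp only [hf]
    split_ifs
    · have : 0 ≤ A.indicator (1 : ℝ → ℝ) u := indicator_nonneg (by simp) _
      linarith
    · exact le_rfl
  have hint : ∀ i, ∫ u, f i u ∂μ ≤ if i ∈ s then 2 else 1 := by
    intro i
    simp only [hf]
    split_ifs with hi
    · rw [integral_add (integrable_const _) (hind.const_mul _), integral_const_mul,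
        integral_indicator_one hA]
      have : μ.real A ≤ 1 / 1024 := ENNReal.toReal_le_of_le_ofReal (by norm_num) hp
      simp; linarith
    · simp
  have hprod : ∫ x, ∏ i, f i (x i) ∂(Measure.pi fun _ : Fin m => μ) ≤ 2 ^ s.card := by
    rw [integral_fintype_prod_eq_prod]
    calc _ ≤ ∏ i : Fin m, (if i ∈ s then (2 : ℝ) else 1) := by
          refine Finset.prod_le_prod (fun i _ => integral_nonneg fun u => zero_le_one.trans (hf1 i u))
            fun i _ => hint i
      _ = 2 ^ s.card := by rw [Finset.prod_ite_mem]; simp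
  have hpi : Integrable (fun x : Fin m → ℝ => ∏ i, f i (x i)) (Measure.pi fun _ : Fin m => μ) :=
    Integrable.fintype_prod_dep hfi
  have hval : ∀ x : Fin m → ℝ, ∏ i, f i (x i) = 1024 ^ N x := by
    intro x
    rw [hN, ← Finset.prod_pow_eq_pow_sum]
    have : ∀ i, f i (x i) = if i ∈ s then (1024 : ℝ) ^ (A.indicator 1 (x i) : ℕ) else 1 := by
      intro i
      simp only [hf]
      by_cases hi : i ∈ s <;> by_cases hx : x i ∈ A <;> simp [hi, hx]
      norm_num
    simp_rw [this]
    rw [Finset.prod_ite_mem]; simp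
  have hmk := mul_meas_ge_le_integral_of_nonneg (μ := Measure.pi fun _ : Fin m => μ)
    (f := fun x => ∏ i, f i (x i)) (Filter.Eventually.of_forall fun x =>
      Finset.prod_nonneg fun i _ => zero_le_one.trans (hf1 i (x i))) hpi (32 ^ s.card)
  have hsub : {x : Fin m → ℝ | s.card ≤ 2 * N x} ⊆ {x | (32 : ℝ) ^ s.card ≤ ∏ i, f i (x i)} := by
    intro x hx
    rw [mem_ofPred_eq, hval, show (1024 : ℝ) = 32 ^ 2 by norm_num, ← pow_mul]
    exact pow_le_pow_right₀ (by norm_num) hx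
  refine (measure_mono hsub).trans ?_
  rw [← ofReal_measureReal]
  refine ENNReal.ofReal_le_ofReal ?_
  have h32 : (0 : ℝ) < 32 ^ s.card := by positivity
  rw [show (1 / 16 : ℝ) = 2 / 32 by norm_num, div_pow, le_div_iff₀ h32, mul_comm]
  exact hmk.trans hprod

/-- The mean squared deviation of a mean of independent variables with values in `[0,1]`. -/
lemma lintegral_mean_sub_sq_le {m : ℕ} (μ : Measure ℝ) [IsProbabilityMeasure μ] {g : ℝ → ℝ}
    (hg : Measurable g) (hg01 : ∀ u, g u ∈ Icc (0 : ℝ) 1) (s : Finset (Fin m)) (hs : 0 < s.card) :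
    ∫⁻ x, ENNReal.ofReal ((1 / (s.card : ℝ) * ∑ i ∈ s, g (x i) - ∫ u, g u ∂μ) ^ 2)
      ∂(Measure.pi fun _ : Fin m => μ) ≤ ENNReal.ofReal (1 / s.card) := by
  set n : ℝ := (s.card : ℝ) with hn
  have hn0 : 0 < n := by rw [hn]; exact_mod_cast hs
  have hL : MemLp g 2 μ := MemLp.of_bound hg.aestronglyMeasurable 1
    (Filter.Eventually.of_forall fun u => by
      rw [Real.norm_eq_abs, abs_of_nonneg (hg01 u).1]; exact (hg01 u).2)
  set X : Fin m → ℝ → ℝ := fun i u => if i ∈ s then g u else 0 with hX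
  have hXL : ∀ i, MemLp (X i) 2 μ := by
    intro i
    simp only [hX]; split_ifs
    · exact hL
    · exact MemLp.zero'
  have hsum : ∀ x : Fin m → ℝ, ∑ i ∈ s, g (x i) = ∑ i, X i (x i) := by
    intro x; simp [hX]
  have hcomp : ∀ i, MemLp (fun x : Fin m → ℝ => X i (x i)) 2 (Measure.pi fun _ : Fin m => μ) :=
    fun i => (hXL i).comp_measurePreserving (measurePreserving_eval (fun _ : Fin m => μ) i)
  have hYL : MemLp (fun x : Fin m → ℝ => ∑ i, X i (x i)) 2 (Measure.pi fun _ : Fin m => μ) :=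
    memLp_finsetSum _ fun i _ => hcomp i
  have hE : ∫ x, ∑ i, X i (x i) ∂(Measure.pi fun _ : Fin m => μ) = n * ∫ u, g u ∂μ := by
    rw [integral_finsetSum _ fun i _ => (hcomp i).integrable one_le_two]
    have : ∀ i, ∫ x, X i (x i) ∂(Measure.pi fun _ : Fin m => μ) =
        if i ∈ s then ∫ u, g u ∂μ else 0 := by
      intro i
      rw [integral_comp_eval (μ := fun _ : Fin m => μ) (f := X i) (hXL i).aestronglyMeasurable]
      simp only [hX]; split_ifs <;> simp
    simp_rw [this]
    simp [hn]
  have hvar : Var[fun x : Fin m → ℝ => ∑ i, X i (x i); Measure.pi fun _ : Fin m => μ] ≤ n := by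
    have h := variance_sum_pi (μ := fun _ : Fin m => μ) (X := X) hXL
    have e : (∑ i, fun x : Fin m → ℝ => X i (x i)) = fun x => ∑ i, X i (x i) := by
      ext x; simp
    rw [e] at h
    rw [h]
    have h1 : ∀ i, Var[X i; μ] ≤ if i ∈ s then 1 else 0 := by
      intro i
      simp only [hX]; split_ifs
      · refine (variance_le_sq_of_bounded (a := 0) (b := 1)
          (Filter.Eventually.of_forall hg01) hg.aemeasurable).trans (by norm_num)
      · exact (variance_zero μ).le
    refine (Finset.sum_le_sum fun i _ => h1 i).trans ?_
    simp [hn]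
  rw [← ofReal_integral_eq_lintegral_ofReal]
  · refine ENNReal.ofReal_le_ofReal ?_
    rw [variance_eq_integral hYL.aestronglyMeasurable.aemeasurable, hE] at hvar
    have e : ∀ x : Fin m → ℝ, (1 / n * ∑ i ∈ s, g (x i) - ∫ u, g u ∂μ) ^ 2 =
        1 / n ^ 2 * (∑ i, X i (x i) - n * ∫ u, g u ∂μ) ^ 2 := by
      intro x; rw [hsum]; field_simp
    simp_rw [e]
    rw [integral_const_mul]
    calc _ ≤ 1 / n ^ 2 * n := by gcongr
      _ = 1 / n := by field_simp
  · have e : (fun x : Fin m → ℝ => (1 / n * ∑ i ∈ s, g (x i) - ∫ u, g u ∂μ) ^ 2) = fun x =>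
        (1 / n * ∑ i, X i (x i) - ∫ u, g u ∂μ) ^ 2 := by
      ext x; rw [hsum]
    rw [e]
    exact ((hYL.const_mul _).sub (memLp_const _)).integrable_sq
  · exact Filter.Eventually.of_forall fun x => sq_nonneg _

/-! ### Increments of the normal distribution function -/

lemma gaussianPDFReal_std (u : ℝ) :
    gaussianPDFReal 0 1 u = (√(2 * Real.pi))⁻¹ * Real.exp (-u ^ 2 / 2) := by
  simp [gaussianPDFReal]

lemma gaussianPDFReal_std_anti {u v : ℝ} (h : |u| ≤ |v|) :
    gaussianPDFReal 0 1 v ≤ gaussianPDFReal 0 1 u := by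
  rw [gaussianPDFReal_std, gaussianPDFReal_std]
  have := sq_le_sq.2 h
  gcongr

lemma cdf_std_sub_eq {a b : ℝ} (h : a ≤ b) :
    cdf (gaussianReal 0 1) b - cdf (gaussianReal 0 1) a =
      ∫ u in Ioc a b, gaussianPDFReal 0 1 u := by
  have h1 : (gaussianReal 0 1).real (Ioc a b) = ∫ u in Ioc a b, gaussianPDFReal 0 1 u := by
    rw [measureReal_def, gaussianReal_apply_eq_integral _ one_ne_zero, ENNReal.toReal_ofReal]
    exact integral_nonneg fun u => gaussianPDFReal_nonneg _ _ _
  rw [← h1, cdf_eq_real, cdf_eq_real, ← Iic_sdiff_Iic, measureReal_sdiff (Iic_subset_Iic.2 h)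
    measurableSet_Iic]

lemma le_cdf_std_sub {a b r : ℝ} (h : a ≤ b) (hr : ∀ u ∈ Ioc a b, |u| ≤ |r|) :
    (b - a) * gaussianPDFReal 0 1 r ≤ cdf (gaussianReal 0 1) b - cdf (gaussianReal 0 1) a := by
  rw [cdf_std_sub_eq h]
  have := setIntegral_mono_on (μ := volume) (s := Ioc a b) (f := fun _ => gaussianPDFReal 0 1 r)
    (by simp) (integrable_gaussianPDFReal 0 1).integrableOn measurableSet_Ioc
    fun u hu => gaussianPDFReal_std_anti (hr u hu)
  simpa [h] using this

lemma cdf_std_sub_le {a b r : ℝ} (h : a ≤ b) (hr : ∀ u ∈ Ioc a b, |r| ≤ |u|) :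
    cdf (gaussianReal 0 1) b - cdf (gaussianReal 0 1) a ≤ (b - a) * gaussianPDFReal 0 1 r := by
  rw [cdf_std_sub_eq h]
  have := setIntegral_mono_on (μ := volume) (s := Ioc a b) (g := fun _ => gaussianPDFReal 0 1 r)
    (integrable_gaussianPDFReal 0 1).integrableOn (by simp) measurableSet_Ioc
    fun u hu => gaussianPDFReal_std_anti (hr u hu)
  simpa [h] using this

lemma continuous_cdf_std : Continuous (cdf (gaussianReal 0 1)) := by
  refine (LipschitzWith.of_dist_le_mul (K := (gaussianPDFReal 0 1 0).toNNReal) ?_).continuous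
  have key : ∀ a b : ℝ, a ≤ b → |cdf (gaussianReal 0 1) b - cdf (gaussianReal 0 1) a| ≤
      gaussianPDFReal 0 1 0 * |b - a| := by
    intro a b h
    rw [abs_of_nonneg (sub_nonneg.2 (monotone_cdf _ h)), abs_of_nonneg (sub_nonneg.2 h), mul_comm]
    exact cdf_std_sub_le h fun u _ => by simp
  intro a b
  rw [Real.dist_eq, Real.dist_eq, Real.coe_toNNReal _ (gaussianPDFReal_nonneg _ _ _)]
  rcases le_total a b with h | h
  · rw [abs_sub_comm, abs_sub_comm a]; exact key a b h
  · exact key b a h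

lemma normal_real_Iic (x t : ℝ) {σ : ℝ} (hσ : 0 < σ) :
    (normal x σ).real (Iic t) = cdf (gaussianReal 0 1) ((t - x) / σ) := by
  rw [cdf_eq_real, normal_eq_map, map_measureReal_apply (by fun_prop) measurableSet_Iic]
  congr 1
  ext u
  simp only [mem_preimage, mem_Iic]
  rw [le_div_iff₀ hσ]
  constructor <;> intro h <;> linarith

lemma variance_ne_zero {σ : ℝ} (hσ : 0 < σ) : NNReal.mk (σ ^ 2) (sq_nonneg σ) ≠ 0 := by
  intro h
  have := congrArg NNReal.toReal h
  simp at this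
  exact hσ.ne' this

lemma normal_real_Ici (x t : ℝ) {σ : ℝ} (hσ : 0 < σ) :
    (normal x σ).real (Ici t) = 1 - cdf (gaussianReal 0 1) ((t - x) / σ) := by
  have := nullSingletonClass_gaussianReal (μ := x) (variance_ne_zero hσ)
  rw [← normal_real_Iic x t hσ, ← probReal_compl_eq_one_sub measurableSet_Iic, compl_Iic,
    normal_eq]
  exact (measureReal_congr Ioi_ae_eq_Ici).symm

/-! ### Gaussian convolutions of step functions -/

/-- `f` is constant on both sides of `p` up to the distance `r`, with different values. -/
def IsStep (f : ℝ → Bool) (p r : ℝ) : Prop :=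
  ∃ b : Bool, (∀ u ∈ Ioo (p - r) p, f u = !b) ∧ ∀ u ∈ Ico p (p + r), f u = b

lemma integrable_bit {f : ℝ → Bool} (hf : Measurable f) (μ : Measure ℝ) [IsProbabilityMeasure μ] :
    Integrable (fun u => bit (f u)) μ :=
  Integrable.of_bound (measurable_bit.comp hf).aestronglyMeasurable 1
    (Filter.Eventually.of_forall fun u => by
      rw [Real.norm_eq_abs, abs_of_nonneg (bit_mem _).1]; exact (bit_mem _).2)

lemma conv_not {f : ℝ → Bool} (hf : Measurable f) (σ x : ℝ) :
    conv σ (fun u => !f u) x = 1 - conv σ f x := by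
  unfold conv
  have : ∀ u, bit (!f u) = 1 - bit (f u) := by intro u; cases f u <;> simp [bit]
  simp_rw [this]
  rw [integral_sub (integrable_const _) (integrable_bit hf _)]
  simp

/-- If `f` steps from `0` to `1` at `p`, the increments of its Gaussian convolution near `p` are
comparable with those of the argument. The difference of two normal densities changes sign only
halfway between the means; so the part of `f` beyond the distance `r` from `p` can be replaced, at
each end, by the worst constant. -/
lemma conv_sub_bounds {f : ℝ → Bool} (hf : Measurable f) {σ p r x y : ℝ} (hσ : 0 < σ)
    (hl : ∀ u ∈ Ioo (p - r) p, f u = false) (hr : ∀ u ∈ Ico p (p + r), f u = true)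
    (hxy : x ≤ y) (hx : p - r < x) (hy : y < p + r) :
    (cdf (gaussianReal 0 1) ((p - x) / σ) - cdf (gaussianReal 0 1) ((p - y) / σ)) -
      (cdf (gaussianReal 0 1) ((p + r - x) / σ) - cdf (gaussianReal 0 1) ((p + r - y) / σ)) -
      (cdf (gaussianReal 0 1) ((p - r - x) / σ) - cdf (gaussianReal 0 1) ((p - r - y) / σ)) ≤
      conv σ f y - conv σ f x ∧
    conv σ f y - conv σ f x ≤ cdf (gaussianReal 0 1) (((x + y) / 2 - x) / σ) -
      cdf (gaussianReal 0 1) (((x + y) / 2 - y) / σ) := by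
  set v := NNReal.mk (σ ^ 2) (sq_nonneg σ) with hv
  have hv0 : v ≠ 0 := variance_ne_zero hσ
  set P : ℝ → ℝ → ℝ := fun a u => gaussianPDFReal a v u with hP
  set D : ℝ → ℝ := fun u => P y u - P x u with hD
  have hPle : ∀ a b u : ℝ, (u - b) ^ 2 ≤ (u - a) ^ 2 → P a u ≤ P b u := by
    intro a b u h
    simp only [hP, gaussianPDFReal]
    gcongr
  have hDpos : ∀ u, (x + y) / 2 ≤ u → 0 ≤ D u := fun u hu =>
    sub_nonneg.2 (hPle _ _ _ (by nlinarith))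
  have hDneg : ∀ u, u ≤ (x + y) / 2 → D u ≤ 0 := fun u hu =>
    sub_nonpos.2 (hPle _ _ _ (by nlinarith))
  have hDi : Integrable D := (integrable_gaussianPDFReal y v).sub (integrable_gaussianPDFReal x v)
  have hset : ∀ A : Set ℝ, MeasurableSet A →
      ∫ u, A.indicator D u = (normal y σ).real A - (normal x σ).real A := by
    intro A hA
    have h1 : ∀ a : ℝ, (normal a σ).real A = ∫ u in A, P a u := by
      intro a
      rw [normal_eq, measureReal_def, gaussianReal_apply_eq_integral _ hv0, ENNReal.toReal_ofReal]
      exact integral_nonneg fun u => gaussianPDFReal_nonneg _ _ _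
    rw [integral_indicator hA, h1, h1, ← integral_sub]
    · exact (integrable_gaussianPDFReal y v).integrableOn
    · exact (integrable_gaussianPDFReal x v).integrableOn
  have hFi : ∀ a, Integrable (fun u => P a u * bit (f u)) := by
    intro a
    refine (integrable_gaussianPDFReal a v).mul_bdd (c := 1)
      (measurable_bit.comp hf).aestronglyMeasurable (Filter.Eventually.of_forall fun u => ?_)
    rw [Real.norm_eq_abs, abs_of_nonneg (bit_mem _).1]; exact (bit_mem _).2
  have hconv : conv σ f y - conv σ f x = ∫ u, D u * bit (f u) := by
    unfold conv
    rw [normal_eq, normal_eq, integral_gaussianReal_eq_integral_smul hv0,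
      integral_gaussianReal_eq_integral_smul hv0]
    simp only [smul_eq_mul]
    rw [← integral_sub (hFi y) (hFi x)]
    refine integral_congr_ae (Filter.Eventually.of_forall fun u => ?_)
    simp only [hD]; ring
  have hDFi : Integrable (fun u => D u * bit (f u)) := by
    have := (hFi y).sub (hFi x)
    refine this.congr (Filter.Eventually.of_forall fun u => ?_)
    simp only [hD, Pi.sub_apply]; ring
  have hIi : ∀ A : Set ℝ, MeasurableSet A → Integrable (A.indicator D) := fun A hA =>
    hDi.indicator hA
  constructor
  · have hlow : ∀ u, (Ici p).indicator D u - (Ici (p + r)).indicator D u +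
        (Iic (p - r)).indicator D u ≤ D u * bit (f u) := by
      intro u
      have hb := bit_mem (f u)
      rcases le_or_gt u (p - r) with h1 | h1
      · have : D u ≤ 0 := hDneg u (by linarith)
        rw [indicator_of_notMem (by simp; linarith), indicator_of_notMem (by simp; linarith),
          indicator_of_mem (by simpa using h1)]
        nlinarith [hb.1, hb.2]
      rw [indicator_of_notMem (s := Iic (p - r)) (by simpa using h1)]
      rcases lt_or_ge u p with h2 | h2
      · rw [indicator_of_notMem (by simpa using h2), indicator_of_notMem (by simp; linarith),
          hl u ⟨h1, h2⟩]
        simp [bit]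
      rw [indicator_of_mem (s := Ici p) (by simpa using h2)]
      rcases lt_or_ge u (p + r) with h3 | h3
      · rw [indicator_of_notMem (by simpa using h3), hr u ⟨h2, h3⟩]
        simp [bit]
      · have : 0 ≤ D u := hDpos u (by linarith)
        rw [indicator_of_mem (by simpa using h3)]
        nlinarith [hb.1, hb.2]
    have h := integral_mono (((hIi _ measurableSet_Ici).sub (hIi _ measurableSet_Ici)).add
      (hIi _ measurableSet_Iic)) hDFi hlow
    rw [← hconv, integral_add' ((hIi _ measurableSet_Ici).sub (hIi _ measurableSet_Ici))
      (hIi _ measurableSet_Iic), integral_sub' (hIi _ measurableSet_Ici) (hIi _ measurableSet_Ici),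
      hset _ measurableSet_Ici, hset _ measurableSet_Ici, hset _ measurableSet_Iic] at h
    simp only [normal_real_Ici _ _ hσ, normal_real_Iic _ _ hσ] at h
    linarith
  · have hup : ∀ u, D u * bit (f u) ≤ (Ici ((x + y) / 2)).indicator D u := by
      intro u
      have hb := bit_mem (f u)
      rcases lt_or_ge u ((x + y) / 2) with h1 | h1
      · have : D u ≤ 0 := hDneg u h1.le
        rw [indicator_of_notMem (by simpa using h1)]
        nlinarith [hb.1, hb.2]
      · have : 0 ≤ D u := hDpos u h1
        rw [indicator_of_mem (by simpa using h1)]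
        nlinarith [hb.1, hb.2]
    have h := integral_mono hDFi (hIi _ measurableSet_Ici) hup
    rw [← hconv, hset _ measurableSet_Ici] at h
    simp only [normal_real_Ici _ _ hσ] at h
    linarith

/-- A universal lower bound for the slope of the normalized convolutions inside a window. -/
noncomputable def slope : ℝ := gaussianPDFReal 0 1 96 / 2

lemma slope_pos : 0 < slope := half_pos (gaussianPDFReal_pos 0 1 96 one_ne_zero)

/-- In a window around a step, the convolution is bi-Lipschitz in units of `σ`, and in particular
injective. -/
lemma conv_sub_bounds_of_isStep {f : ℝ → Bool} (hf : Measurable f) {σ p w : ℝ} (hσ : 0 < σ)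
    (hw1 : 64 * σ ≤ w) (hw2 : w ≤ 128 * σ) (hstep : IsStep f p (2 * w)) {x y : ℝ}
    (hx : x ∈ Icc (p - 3 / 4 * w) (p + 3 / 4 * w)) (hy : y ∈ Icc (p - 3 / 4 * w) (p + 3 / 4 * w)) :
    slope * |y - x| ≤ σ * |conv σ f y - conv σ f x| ∧
      σ * |conv σ f y - conv σ f x| ≤ gaussianPDFReal 0 1 0 * |y - x| := by
  wlog hxy : x ≤ y generalizing x y
  · have := this hy hx (not_le.1 hxy).le
    rwa [abs_sub_comm x, abs_sub_comm (conv σ f x)] at this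
  wlog hb : (∀ u ∈ Ioo (p - 2 * w) p, f u = false) ∧ ∀ u ∈ Ico p (p + 2 * w), f u = true
    generalizing f
  · obtain ⟨b, h1, h2⟩ := hstep
    cases b
    · have := this (f := fun u => !f u) ((measurable_of_countable (fun v : Bool => !v)).comp hf)
        ⟨true, fun u hu => by simp [h1 u hu], fun u hu => by simp [h2 u hu]⟩
        ⟨fun u hu => by simp [h1 u hu], fun u hu => by simp [h2 u hu]⟩
      rw [conv_not hf, conv_not hf, sub_sub_sub_cancel_left, abs_sub_comm (conv σ f x)] at this
      exact this
    · exact absurd ⟨fun u hu => by simp [h1 u hu], h2⟩ hb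
  have hw : 0 < w := by linarith
  obtain ⟨h1, h2⟩ := conv_sub_bounds hf hσ hb.1 hb.2 hxy (by linarith [hx.1]) (by linarith [hy.2])
  set R := 3 / 4 * w / σ with hR
  set R' := 5 / 4 * w / σ with hR'
  have hR0 : 0 < R := by positivity
  have hR0' : 0 < R' := by positivity
  have div_mono : ∀ {a b : ℝ}, a ≤ b → a / σ ≤ b / σ := fun h => by gcongr
  have hneg : ∀ a : ℝ, -(a / σ) = -a / σ := fun a => by ring
  have e0 : ((p - x) / σ - (p - y) / σ) = (y - x) / σ := by ring
  have e1 : ((p + 2 * w - x) / σ - (p + 2 * w - y) / σ) = (y - x) / σ := by ring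
  have e2 : ((p - 2 * w - x) / σ - (p - 2 * w - y) / σ) = (y - x) / σ := by ring
  have e3 : (((x + y) / 2 - x) / σ - ((x + y) / 2 - y) / σ) = (y - x) / σ := by ring
  have b0 := le_cdf_std_sub (r := R) (div_mono (by linarith : p - y ≤ p - x)) fun u hu => by
    rw [abs_of_pos hR0, abs_le]
    constructor
    · rw [hR, hneg]; exact (div_mono (by linarith [hy.2])).trans hu.1.le
    · exact hu.2.trans (div_mono (by linarith [hx.1]))
  have b1 := cdf_std_sub_le (r := R') (div_mono (by linarith : p + 2 * w - y ≤ p + 2 * w - x))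
    fun u hu => by
      rw [abs_of_pos hR0']
      exact le_trans ((div_mono (by linarith [hy.2])).trans hu.1.le) (le_abs_self _)
  have b2 := cdf_std_sub_le (r := R') (div_mono (by linarith : p - 2 * w - y ≤ p - 2 * w - x))
    fun u hu => by
      rw [abs_of_pos hR0']
      refine le_trans ?_ (neg_le_abs _)
      rw [le_neg, hR', hneg]
      exact hu.2.trans (div_mono (by linarith [hx.1]))
  have b3 := cdf_std_sub_le (r := 0) (div_mono (by linarith : (x + y) / 2 - y ≤ (x + y) / 2 - x))
    fun u _ => by simp
  rw [e0] at b0; rw [e1] at b1; rw [e2] at b2; rw [e3] at b3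
  have hq : gaussianPDFReal 0 1 R' ≤ gaussianPDFReal 0 1 R / 4 := by
    rw [gaussianPDFReal_std, gaussianPDFReal_std, mul_div_assoc]
    refine mul_le_mul_of_nonneg_left ?_ (by positivity)
    have hW : 64 ≤ w / σ := by rw [le_div_iff₀ hσ]; exact hw1
    have e : -R' ^ 2 / 2 = -R ^ 2 / 2 + -((w / σ) ^ 2 / 2) := by
      rw [hR, hR']; ring
    rw [e, Real.exp_add, div_eq_mul_inv]
    refine mul_le_mul_of_nonneg_left ?_ (Real.exp_pos _).le
    rw [Real.exp_neg]
    refine inv_anti₀ (by norm_num) ?_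
    have := Real.add_one_le_exp ((w / σ) ^ 2 / 2)
    nlinarith
  have hR96 : gaussianPDFReal 0 1 96 ≤ gaussianPDFReal 0 1 R := by
    apply gaussianPDFReal_std_anti
    rw [abs_of_pos hR0, abs_of_pos (by norm_num), hR, div_le_iff₀ hσ]
    linarith
  have hs : 0 ≤ (y - x) / σ := div_nonneg (sub_nonneg.2 hxy) hσ.le
  have hlow : (y - x) / σ * slope ≤ conv σ f y - conv σ f x := by
    unfold slope
    nlinarith
  have hnn : 0 ≤ conv σ f y - conv σ f x := le_trans (mul_nonneg hs slope_pos.le) hlow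
  rw [abs_of_nonneg hnn, abs_of_nonneg (sub_nonneg.2 hxy)]
  have e : σ * ((y - x) / σ) = y - x := by field_simp
  constructor
  · calc slope * (y - x) = σ * ((y - x) / σ * slope) := by rw [← mul_assoc, e, mul_comm]
      _ ≤ _ := by gcongr
  · calc _ ≤ σ * ((y - x) / σ * gaussianPDFReal 0 1 0) := by gcongr; linarith
      _ = _ := by rw [← mul_assoc, e, mul_comm]

/-! ### Scales -/

lemma lev_nonneg {σ : ℝ} (hσ : 0 < σ) (hσ1 : σ < 1) : 0 ≤ lev σ := by
  unfold lev
  exact Int.floor_nonneg.2 (Real.logb_nonneg one_lt_two (by rw [le_div_iff₀ hσ]; linarith))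

/-- `σ ≤ 2 ^ (-λ) < 2 σ`. -/
lemma zpow_lev_bounds {σ : ℝ} (hσ : 0 < σ) :
    σ ≤ (2 : ℝ) ^ (-lev σ) ∧ (2 : ℝ) ^ (-lev σ) < 2 * σ := by
  have h1 : (2 : ℝ) ^ (lev σ) ≤ 1 / σ := by
    rw [← Real.rpow_intCast, ← Real.le_logb_iff_rpow_le one_lt_two (by positivity)]
    exact Int.floor_le _
  have h2 : 1 / σ < (2 : ℝ) ^ (lev σ + 1) := by
    rw [← Real.rpow_intCast, ← Real.logb_lt_iff_lt_rpow one_lt_two (by positivity)]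
    push_cast
    exact Int.lt_floor_add_one _
  have hp : (0 : ℝ) < 2 ^ (lev σ) := by positivity
  rw [zpow_add_one₀ two_ne_zero] at h2
  rw [zpow_neg]
  constructor
  · rw [le_inv_comm₀ hσ hp]; simpa using h1
  · rw [inv_lt_iff_one_lt_mul₀ hp]
    rw [div_lt_iff₀ hσ] at h2
    linarith

/-- The half width of the cells of the finer localization, `2 ^ (-(λ - 3))`. -/
noncomputable def fine (σ : ℝ) : ℝ := (2 : ℝ) ^ (-(lev σ - 3))

lemma fine_pos (σ : ℝ) : 0 < fine σ := by unfold fine; positivity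

lemma fine_bounds {σ : ℝ} (hσ : 0 < σ) : 8 * σ ≤ fine σ ∧ fine σ ≤ 16 * σ := by
  obtain ⟨h1, h2⟩ := zpow_lev_bounds hσ
  have : fine σ = 8 * (2 : ℝ) ^ (-lev σ) := by
    rw [fine, neg_sub, sub_eq_add_neg, zpow_add₀ two_ne_zero]; norm_num
  constructor <;> linarith

lemma window_eq (σ : ℝ) : (2 : ℝ) ^ (-(lev σ - 6)) = 8 * fine σ := by
  rw [fine, show -(lev σ - 6) = 3 + -(lev σ - 3) by ring, zpow_add₀ two_ne_zero]; norm_num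

lemma zpow_mul_window (σ : ℝ) : (2 : ℝ) ^ (lev σ - 7) * (16 * fine σ) = 1 := by
  rw [fine, show (16 : ℝ) = 2 ^ (4 : ℤ) by norm_num, ← zpow_add₀ two_ne_zero,
    ← zpow_add₀ two_ne_zero, show lev σ - 7 + (4 + -(lev σ - 3)) = 0 by ring, zpow_zero]

lemma isStep_floor {f : ℝ → Bool} {a t r p : ℝ} (hr : a * r = 1) (ha : 0 < a)
    (hf : ∀ u, f u = decide (⌊a * u - t⌋ % 2 = 1)) {j : ℤ} (hp : a * p = j + t) :
    IsStep f p r := by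
  refine ⟨decide (j % 2 = 1), ?_, ?_⟩
  · intro u hu
    have : ⌊a * u - t⌋ = j - 1 := by
      rw [Int.floor_eq_iff]
      have h1 := mul_lt_mul_of_pos_left hu.1 ha
      have h2 := mul_lt_mul_of_pos_left hu.2 ha
      rw [mul_sub] at h1
      push_cast
      constructor <;> linarith
    rw [hf, this, ← decide_not, decide_eq_decide]
    omega
  · intro u hu
    have : ⌊a * u - t⌋ = j := by
      rw [Int.floor_eq_iff]
      have h1 := mul_le_mul_of_nonneg_left hu.1 ha.le
      have h2 := mul_lt_mul_of_pos_left hu.2 ha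
      rw [mul_add] at h2
      constructor <;> linarith
    rw [hf, this]

lemma isStep_refine (σ : ℝ) (j : ℤ) : IsStep (refine σ) (2 * j * (8 * fine σ)) (2 * (8 * fine σ)) := by
  have h := zpow_mul_window σ
  refine isStep_floor (a := (2 : ℝ) ^ (lev σ - 7)) (t := 0) (j := j) (by rw [← h]; ring)
    (by positivity) (fun u => by simp [refine]) ?_
  linear_combination (j : ℝ) * h

lemma isStep_conjRefine (σ : ℝ) (j : ℤ) :
    IsStep (conjRefine σ) ((2 * j + 1) * (8 * fine σ)) (2 * (8 * fine σ)) := by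
  have h := zpow_mul_window σ
  refine isStep_floor (a := (2 : ℝ) ^ (lev σ - 7)) (t := 1 / 2) (j := j) (by rw [← h]; ring)
    (by positivity) (fun u => by simp [conjRefine]) ?_
  linear_combination ((j : ℝ) + 1 / 2) * h

/-! ### Protocols and their risk -/

lemma Protocol.pad_apply {m : ℕ} {b b' : Fin m → ℕ} (P : Protocol b') (h : ∀ i, b' i ≤ b i)
    (x : Fin m → ℝ) : (P.pad h).apply x = P.apply x := by
  unfold Protocol.apply Protocol.pad
  simp

lemma Protocol.maxRisk_pad {m : ℕ} {b b' : Fin m → ℕ} (P : Protocol b') (h : ∀ i, b' i ≤ b i)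
    (σ : ℝ) : (P.pad h).maxRisk σ = P.maxRisk σ := by
  unfold Protocol.maxRisk
  simp only [Protocol.pad_apply]

lemma Protocol.maxRisk_le {m : ℕ} {b : Fin m → ℕ} {P : Protocol b} {σ : ℝ} {r : ℝ≥0∞}
    (h : ∀ θ ∈ Icc (0 : ℝ) 1, ∫⁻ x, ENNReal.ofReal ((P.apply x - θ) ^ 2)
      ∂(Measure.pi (fun _ : Fin m => normal θ σ)) ≤ r) : P.maxRisk σ ≤ r :=
  iSup₂_le h

/-! ### One bit per machine -/

lemma one_sub_cdf_std_neg (t : ℝ) :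
    1 - cdf (gaussianReal 0 1) (-t) = cdf (gaussianReal 0 1) t := by
  have h : (gaussianReal 0 1).real (Iic t) = (gaussianReal 0 1).real (Ici (-t)) := by
    have e : (gaussianReal 0 1).map (fun x => -x) = gaussianReal 0 1 := by
      rw [gaussianReal_map_neg]; simp
    conv_rhs => rw [← e, map_measureReal_apply (by fun_prop) measurableSet_Ici]
    congr 1
    ext u; simp
  have e : normal 0 1 = gaussianReal 0 1 := by
    rw [normal_eq]; congr 1; apply NNReal.eq; simp
  have h2 := normal_real_Ici 0 (-t) one_pos
  rw [e, ← h, ← cdf_eq_real] at h2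
  rw [h2]; simp

lemma probit_mem (σ p : ℝ) : probit σ p ∈ Icc (0 : ℝ) 1 := by
  unfold probit
  split_ifs
  · simp
  · simp
  · exact trunc_mem zero_le_one _

/-- The probit estimate inverts `θ ↦ Φ (θ / σ)` in a Lipschitz way on the parameter space. -/
lemma abs_probit_sub_le {σ θ p : ℝ} (hσ : 1 ≤ σ) (hθ : θ ∈ Icc (0 : ℝ) 1) :
    gaussianPDFReal 0 1 1 * |probit σ p - θ| ≤ σ * |p - cdf (gaussianReal 0 1) (θ / σ)| := by
  have hσ0 : 0 < σ := by linarith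
  set φ := gaussianPDFReal 0 1 1
  set G := cdf (gaussianReal 0 1)
  have hφ : 0 < φ := gaussianPDFReal_pos 0 1 1 one_ne_zero
  have hmem : ∀ t ∈ Icc (0 : ℝ) 1, t / σ ∈ Icc (0 : ℝ) 1 := fun t ht =>
    ⟨div_nonneg ht.1 hσ0.le, by rw [div_le_one hσ0]; linarith [ht.2]⟩
  -- the expansion bound for two points of the parameter space
  have key : ∀ s ∈ Icc (0 : ℝ) 1, ∀ t ∈ Icc (0 : ℝ) 1, s ≤ t →
      φ * (t - s) ≤ σ * (G (t / σ) - G (s / σ)) := by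
    intro s hs t ht hst
    have h := le_cdf_std_sub (r := 1) (div_le_div_of_nonneg_right hst hσ0.le) fun u hu => by
      rw [abs_one, abs_le]
      constructor
      · linarith [hu.1, (hmem s hs).1]
      · exact hu.2.trans (hmem t ht).2
    have h2 := mul_le_mul_of_nonneg_left h hσ0.le
    have e : σ * ((t / σ - s / σ) * φ) = φ * (t - s) := by field_simp
    exact e ▸ h2
  -- frequencies `p` beyond the values that the distribution function takes on the parameter space
  have upper : G (1 / σ) ≤ p → φ * |1 - θ| ≤ σ * |p - G (θ / σ)| := by
    intro h
    have h1 := key θ hθ 1 (by simp) hθ.2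
    rw [abs_of_nonneg (by linarith [hθ.2])]
    refine h1.trans (mul_le_mul_of_nonneg_left ?_ hσ0.le)
    linarith [le_abs_self (p - G (θ / σ))]
  have lower : p ≤ G (0 / σ) → φ * |0 - θ| ≤ σ * |p - G (θ / σ)| := by
    intro h
    have h1 := key 0 (by simp) θ hθ hθ.1
    rw [abs_of_nonpos (by linarith [hθ.1]), neg_sub]
    refine h1.trans (mul_le_mul_of_nonneg_left ?_ hσ0.le)
    linarith [neg_abs_le (p - G (θ / σ))]
  unfold probit
  split_ifs with h0 h1
  · exact lower (h0.trans (cdf_nonneg _ _))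
  · exact upper ((cdf_le_one _ _).trans h1)
  · have hex : ∃ t, G t = p := by
      have h2 := (tendsto_cdf_atBot (gaussianReal 0 1)).eventually_lt_const (not_le.1 h0)
      have h3 := (tendsto_cdf_atTop (gaussianReal 0 1)).eventually_const_lt (not_le.1 h1)
      obtain ⟨u, hu⟩ := h2.exists
      obtain ⟨v, hv⟩ := h3.exists
      exact mem_range_of_exists_le_of_exists_ge continuous_cdf_std ⟨u, hu.le⟩ ⟨v, hv.le⟩
    have ht := Function.invFun_eq hex
    set t := Function.invFun (fun x => G x) p
    change G t = p at ht
    rcases le_or_gt (σ * t) 0 with c0 | c0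
    · have : trunc 0 1 (σ * t) = 0 := by unfold trunc; rw [if_pos c0]
      rw [this]
      refine lower ?_
      rw [← ht]
      refine monotone_cdf _ ?_
      rw [zero_div]; nlinarith
    rcases le_or_gt 1 (σ * t) with c1 | c1
    · have : trunc 0 1 (σ * t) = 1 := by
        unfold trunc; rw [if_neg (not_le.2 c0), if_neg (not_lt.2 c1)]
      rw [this]
      refine upper ?_
      rw [← ht]
      refine monotone_cdf _ ?_
      rw [div_le_iff₀ hσ0]; linarith
    · have hm : σ * t ∈ Icc (0 : ℝ) 1 := ⟨c0.le, c1.le⟩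
      rw [trunc_of_mem hm, ← ht]
      have e : t = σ * t / σ := by field_simp
      rcases le_total (σ * t) θ with h | h
      · have h2 := key _ hm θ hθ h
        rw [← e] at h2
        rw [abs_of_nonpos (by linarith), abs_sub_comm, neg_sub]
        exact h2.trans (mul_le_mul_of_nonneg_left (le_abs_self _) hσ0.le)
      · have h2 := key θ hθ _ hm h
        rw [← e] at h2
        rw [abs_of_nonneg (by linarith)]
        exact h2.trans (mul_le_mul_of_nonneg_left (le_abs_self _) hσ0.le)

lemma maxRisk_oneBit_le {m : ℕ} (hm : 1 ≤ m) {σ : ℝ} (hσ : 1 ≤ σ) :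
    (oneBit m σ).maxRisk σ ≤
      ENNReal.ofReal (max 1 (1 / gaussianPDFReal 0 1 1 ^ 2) * min (σ ^ 2 / m) 1) := by
  have hσ0 : 0 < σ := by linarith
  set φ := gaussianPDFReal 0 1 1
  have hφ : 0 < φ := gaussianPDFReal_pos 0 1 1 one_ne_zero
  have hm0 : (0 : ℝ) < m := by exact_mod_cast hm
  refine Protocol.maxRisk_le fun θ hθ => ?_
  set p : (Fin m → ℝ) → ℝ := fun x => 1 / (m : ℝ) * ∑ i, bit (decide (0 ≤ x i)) with hp
  have happ : ∀ x, (oneBit m σ).apply x = probit σ (p x) := fun x => rfl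
  rw [mul_min_of_nonneg _ _ (le_max_of_le_left zero_le_one), ENNReal.ofReal_min]
  refine le_min ?_ ?_
  · have hmeas : Measurable fun u : ℝ => bit (decide (0 ≤ u)) := by
      have : (fun u : ℝ => bit (decide (0 ≤ u))) = (Ici (0 : ℝ)).indicator 1 := by
        ext u; by_cases h : 0 ≤ u <;> simp [bit, indicator, h]
      rw [this]; exact measurable_one.indicator measurableSet_Ici
    have hint : ∫ u, bit (decide (0 ≤ u)) ∂(normal θ σ) = cdf (gaussianReal 0 1) (θ / σ) := by
      have : (fun u : ℝ => bit (decide (0 ≤ u))) = (Ici (0 : ℝ)).indicator 1 := by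
        ext u; by_cases h : 0 ≤ u <;> simp [bit, indicator, h]
      rw [this, integral_indicator_one measurableSet_Ici, normal_real_Ici _ _ hσ0,
        show (0 - θ) / σ = -(θ / σ) by ring, one_sub_cdf_std_neg]
    have hmean := lintegral_mean_sub_sq_le (normal θ σ) hmeas (fun u => bit_mem _)
      (Finset.univ : Finset (Fin m)) (by simp; omega)
    rw [hint] at hmean
    simp only [Finset.card_univ, Fintype.card_fin] at hmean
    calc _ ≤ ∫⁻ x, ENNReal.ofReal (σ ^ 2 / φ ^ 2) *
          ENNReal.ofReal ((p x - cdf (gaussianReal 0 1) (θ / σ)) ^ 2)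
            ∂(Measure.pi fun _ : Fin m => normal θ σ) := by
          refine lintegral_mono fun x => ?_
          rw [← ENNReal.ofReal_mul (by positivity), happ]
          refine ENNReal.ofReal_le_ofReal ?_
          have h := abs_probit_sub_le (p := p x) hσ hθ
          have h2 : |probit σ (p x) - θ| ≤ σ / φ * |p x - cdf (gaussianReal 0 1) (θ / σ)| := by
            rw [div_mul_eq_mul_div, le_div_iff₀ hφ, mul_comm]; exact h
          have h3 := pow_le_pow_left₀ (abs_nonneg _) h2 2
          rw [mul_pow, sq_abs, sq_abs, div_pow] at h3
          exact h3
      _ = ENNReal.ofReal (σ ^ 2 / φ ^ 2) * ∫⁻ x,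
          ENNReal.ofReal ((p x - cdf (gaussianReal 0 1) (θ / σ)) ^ 2)
            ∂(Measure.pi fun _ : Fin m => normal θ σ) := lintegral_const_mul' _ _ ENNReal.ofReal_ne_top
      _ ≤ ENNReal.ofReal (σ ^ 2 / φ ^ 2) * ENNReal.ofReal (1 / m) := by gcongr
      _ = ENNReal.ofReal (1 / φ ^ 2 * (σ ^ 2 / m)) := by
          rw [← ENNReal.ofReal_mul (by positivity)]; congr 1; field_simp
      _ ≤ _ := by
          refine ENNReal.ofReal_le_ofReal ?_
          gcongr
          exact le_max_right _ _
  · calc _ ≤ ∫⁻ _, 1 ∂(Measure.pi fun _ : Fin m => normal θ σ) := by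
          refine lintegral_mono fun x => ?_
          rw [happ, ← ENNReal.ofReal_one]
          refine ENNReal.ofReal_le_ofReal ?_
          have := probit_mem σ (p x)
          rw [sq_le_one_iff_abs_le_one, abs_le]
          constructor <;> linarith [this.1, this.2, hθ.1, hθ.2]
      _ = 1 := by simp
      _ ≤ _ := by
          rw [← ENNReal.ofReal_one]
          refine ENNReal.ofReal_le_ofReal ?_
          rw [mul_one]; exact le_max_left _ _

/-! ### The layout of the transcripts -/

lemma sum_le_sum_crudeCount_add {m : ℕ} (b : Fin m → ℕ) (q : ℕ) :
    ∑ i, b i ≤ ∑ i, crudeCount b q i + q := by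
  have h1 : ∑ i, b i ≤ ∑ i, (crudeCount b q i + if (i : ℕ) < q then 1 else 0) :=
    Finset.sum_le_sum fun i _ => by unfold crudeCount; omega
  rw [Finset.sum_add_distrib] at h1
  refine h1.trans (Nat.add_le_add_left ?_ _)
  rw [Finset.sum_boole]
  have h2 : ((Finset.univ.filter fun i : Fin m => (i : ℕ) < q).image Fin.val).card ≤ q := by
    refine (Finset.card_le_card (t := Finset.range q) ?_).trans (by simp)
    intro j hj
    simp only [Finset.mem_image, Finset.mem_filter] at hj
    obtain ⟨i, hi, rfl⟩ := hj
    simpa using hi.2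
  rw [Finset.card_image_of_injective _ Fin.val_injective] at h2
  simpa using h2

lemma offset_add_le {m : ℕ} (b : Fin m → ℕ) (q : ℕ) {i j : Fin m} (h : i < j) :
    offset b q i + crudeCount b q i ≤ offset b q j := by
  unfold offset
  have hsub : insert i (Finset.univ.filter fun k : Fin m => k < i) ⊆
      Finset.univ.filter fun k : Fin m => k < j := by
    intro k hk
    simp only [Finset.mem_insert, Finset.mem_filter, Finset.mem_univ, true_and] at hk ⊢
    rcases hk with rfl | hk
    · exact h
    · exact hk.trans h
  have := Finset.sum_le_sum_of_subset (f := fun k => crudeCount b q k) hsub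
  rw [Finset.sum_insert (by simp)] at this
  omega

lemma exists_offset {m : ℕ} (b : Fin m → ℕ) (q k : ℕ) (hk1 : 1 ≤ k)
    (hk : k ≤ ∑ i, crudeCount b q i) :
    ∃ i : Fin m, ∃ t < crudeCount b q i, offset b q i + t + 1 = k := by
  classical
  set S : ℕ → ℕ := fun N => ∑ j ∈ Finset.univ.filter (fun j : Fin m => (j : ℕ) < N), crudeCount b q j
    with hS
  have hSm : k ≤ S m := by
    simpa [hS] using hk
  have hex : ∃ N, k ≤ S N := ⟨m, hSm⟩
  have hfind := Nat.find_spec hex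
  have hle : Nat.find hex ≤ m := Nat.find_min' hex hSm
  have h0 : Nat.find hex ≠ 0 := by
    intro h
    rw [h] at hfind
    simp [hS] at hfind
    omega
  obtain ⟨N, hN⟩ := Nat.exists_eq_succ_of_ne_zero h0
  have hlt : S N < k := not_le.1 (Nat.find_min hex (by omega))
  rw [hN] at hfind hle
  have hstep : S (N + 1) = S N + crudeCount b q ⟨N, by omega⟩ := by
    have : (Finset.univ.filter fun j : Fin m => (j : ℕ) < N + 1) =
        insert ⟨N, by omega⟩ (Finset.univ.filter fun j : Fin m => (j : ℕ) < N) := by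
      ext j
      simp only [Finset.mem_filter, Finset.mem_univ, true_and, Finset.mem_insert, Fin.ext_iff]
      omega
    simp only [hS]
    rw [this, Finset.sum_insert (by simp)]
    omega
  have hoff : offset b q ⟨N, by omega⟩ = S N := by
    unfold offset
    simp only [hS, Fin.lt_def]
  rw [Nat.succ_eq_add_one, hstep] at hfind
  exact ⟨⟨N, by omega⟩, k - 1 - S N, by omega, by rw [hoff]; omega⟩

/-- Every crude localization bit is a Gray function of the observation of one machine. -/
lemma exists_crudeBit_eq {m : ℕ} (b : Fin m → ℕ) (q k : ℕ) (hk1 : 1 ≤ k)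
    (hk : k ≤ ∑ i, crudeCount b q i) :
    ∃ i : Fin m, ∀ (z : Transcripts b) (x : Fin m → ℝ),
      (∀ (i : Fin m) (t : Fin (b i)), (t : ℕ) < crudeCount b q i →
        z i t = gray ((offset b q i + t + 1 : ℕ) : ℤ) (x i)) →
      crudeBit b q z k = gray k (x i) := by
  obtain ⟨i, t, ht, hit⟩ := exists_offset b q k hk1 hk
  refine ⟨i, fun z x hz => ?_⟩
  have htb : t < b i := ht.trans_le (Nat.sub_le _ _)
  rw [Bool.eq_iff_iff, crudeBit, decide_eq_true_iff]
  constructor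
  · rintro ⟨j, s, hs, hjs, hzj⟩
    have hij : i = j := by
      rcases lt_trichotomy i j with h | h | h
      · have := offset_add_le b q h; omega
      · exact h
      · have := offset_add_le b q h; omega
    subst hij
    rw [hz i s hs, hjs] at hzj
    exact hzj
  · intro h
    refine ⟨i, ⟨t, htb⟩, ht, hit, ?_⟩
    rw [hz i ⟨t, htb⟩ ht]
    simpa only [hit] using h

lemma lastBit_eq {m : ℕ} {b : Fin m → ℕ} (hb : ∀ i, 1 ≤ b i) (z : Transcripts b) (i : Fin m) :
    lastBit b z i = z i ⟨b i - 1, by have := hb i; omega⟩ := by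
  rw [Bool.eq_iff_iff, lastBit, decide_eq_true_iff]
  constructor
  · rintro ⟨j, t, hj, ht, h⟩
    obtain rfl : j = i := Fin.ext hj
    have : t = ⟨b j - 1, by have := hb j; omega⟩ := Fin.ext (by simp; omega)
    rwa [← this]
  · intro h
    exact ⟨i, _, rfl, by have := hb i; simp; omega, h⟩

/-! ### Pure localization -/

lemma dec_congr {K : ℕ} {y y' : ℕ → Bool} (h : ∀ k, 1 ≤ k → k ≤ K → y k = y' k) :
    dec K y = dec K y' := by
  ext x
  unfold dec
  simp only [mem_ofPred_eq]
  exact and_congr_right fun _ => forall_congr' fun k => forall_congr' fun h1 =>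
    forall_congr' fun h2 => by rw [h k h1 h2]

lemma dec_nonempty (y : ℕ → Bool) (K : ℕ) : (dec K y).Nonempty := by
  refine Set.Nonempty.mono (dec_subset y K).1 (nonempty_Ico.2 ?_)
  gcongr; linarith

lemma sInf_dec_mem (y : ℕ → Bool) (K : ℕ) :
    sInf (dec K y) ∈ Icc ((cell y K : ℝ) / 2 ^ K) ((cell y K + 1) / 2 ^ K) := by
  have hs := (dec_subset y K).2
  obtain ⟨x, hx⟩ := dec_nonempty y K
  exact ⟨le_csInf ⟨x, hx⟩ fun u hu => (hs hu).1,
    (csInf_le ⟨_, fun u hu => (hs hu).1⟩ hx).trans (hs hx).2⟩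

lemma abs_sInf_dec_sub_le {θ : ℝ} (hθ : θ ∈ Icc (0 : ℝ) 1) (y : ℕ → Bool) (K : ℕ) :
    |sInf (dec K y) - θ| ≤ (2 ^ K)⁻¹ + slip θ y K := by
  have h1 := abs_place_cell_sub_le hθ y K
  have h2 := sInf_dec_mem y K
  have h3 := place_mem_Icc K (cell y K) (tent_iterate_mem hθ K)
  have h4 := abs_sub_le (sInf (dec K y)) (place K (cell y K) (tent^[K] θ)) θ
  have h5 : |sInf (dec K y) - place K (cell y K) (tent^[K] θ)| ≤ (2 ^ K)⁻¹ := by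
    have e : ((cell y K : ℝ) + 1) / 2 ^ K = cell y K / 2 ^ K + (2 ^ K)⁻¹ := by ring
    rw [e] at h2 h3
    rw [abs_le]
    constructor <;> linarith [h2.1, h2.2, h3.1, h3.2]
  linarith

/-- The machines that send the crude localization bits. -/
lemma exists_crude_machines {m : ℕ} (hm : 1 ≤ m) (b : Fin m → ℕ) (q K : ℕ)
    (hK : K + q ≤ ∑ i, b i) :
    ∃ i : ℕ → Fin m, ∀ (z : Transcripts b) (x : Fin m → ℝ),
      (∀ (i : Fin m) (t : Fin (b i)), (t : ℕ) < crudeCount b q i →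
        z i t = gray ((offset b q i + t + 1 : ℕ) : ℤ) (x i)) →
      ∀ k, 1 ≤ k → k ≤ K → crudeBit b q z k = gray k (x (i k)) := by
  have hsum := sum_le_sum_crudeCount_add b q
  have h : ∀ k : ℕ, ∃ i : Fin m, 1 ≤ k → k ≤ K → ∀ (z : Transcripts b) (x : Fin m → ℝ),
      (∀ (i : Fin m) (t : Fin (b i)), (t : ℕ) < crudeCount b q i →
        z i t = gray ((offset b q i + t + 1 : ℕ) : ℤ) (x i)) →
      crudeBit b q z k = gray k (x i) := by
    intro k
    by_cases hk : 1 ≤ k ∧ k ≤ K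
    · obtain ⟨i, hi⟩ := exists_crudeBit_eq b q k hk.1 (by omega)
      exact ⟨i, fun _ _ => hi⟩
    · exact ⟨⟨0, hm⟩, fun h1 h2 => absurd ⟨h1, h2⟩ hk⟩
  choose i hi using h
  exact ⟨i, fun z x hz k h1 h2 => hi k h1 h2 z x hz⟩

/-- If the budget does not exceed `log (1/σ)` by more than `2`, all bits are reliable enough for the error
to be of the order of one cell. -/
lemma maxRisk_localization_le {m : ℕ} (hm : 1 ≤ m) (b : Fin m → ℕ) {σ : ℝ} (hσ : 0 < σ)
    (hK : σ * 2 ^ (∑ i, b i) ≤ 4) :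
    (localization b).maxRisk σ ≤
      ENNReal.ofReal ((3 + 12288 * 68 ^ 4) * (2 : ℝ) ^ (-2 * ((∑ i, b i : ℕ) : ℤ))) := by
  set K := ∑ i, b i with hKdef
  refine Protocol.maxRisk_le fun θ hθ => ?_
  obtain ⟨i, hi⟩ := exists_crude_machines hm b 0 K (by omega)
  set d : ℝ := (2 ^ K)⁻¹ with hd
  have hd0 : 0 < d := by positivity
  set S : (Fin m → ℝ) → ℝ := fun x => slip θ (fun k => gray k (x (i k))) K with hS
  have hpt : ∀ x, |(localization b).apply x - θ| ≤ d + S x := by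
    intro x
    have hdec := dec_congr (K := K) (hi (fun i => (localization b).encode i (x i)) x
      fun i t _ => rfl)
    have e : (localization b).apply x =
        sInf (dec K (crudeBit b 0 (fun i => (localization b).encode i (x i)))) := rfl
    rw [e, hdec]
    exact abs_sInf_dec_sub_le hθ _ K
  have hexp : (2 : ℝ) ^ (-2 * (K : ℤ)) = d ^ 2 := by
    rw [hd, inv_pow, ← pow_mul, neg_mul, zpow_neg, mul_comm K]
    congr 1
  have hσd : σ ≤ 4 * d := by rw [hd, ← div_eq_mul_inv, le_div_iff₀ (by positivity)]; exact hK
  calc _ ≤ ∫⁻ x, (ENNReal.ofReal (3 * d ^ 2) + ENNReal.ofReal ((d ^ 2)⁻¹) *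
        ENNReal.ofReal (S x ^ 4)) ∂(Measure.pi fun _ : Fin m => normal θ σ) := by
        refine lintegral_mono fun x => ?_
        rw [← ENNReal.ofReal_mul (by positivity), ← ENNReal.ofReal_add (by positivity) (by positivity)]
        refine ENNReal.ofReal_le_ofReal ?_
        have h1 := pow_le_pow_left₀ (abs_nonneg _) (hpt x) 2
        rw [sq_abs] at h1
        refine h1.trans ?_
        have h2 : (d ^ 2)⁻¹ * S x ^ 4 + d ^ 2 - 2 * S x ^ 2 = (d ^ 2)⁻¹ * (S x ^ 2 - d ^ 2) ^ 2 := by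
          field_simp; ring
        have h3 : 0 ≤ (d ^ 2)⁻¹ * (S x ^ 2 - d ^ 2) ^ 2 := by positivity
        nlinarith [sq_nonneg (d - S x)]
    _ = ENNReal.ofReal (3 * d ^ 2) + ENNReal.ofReal ((d ^ 2)⁻¹) *
        ∫⁻ x, ENNReal.ofReal (S x ^ 4) ∂(Measure.pi fun _ : Fin m => normal θ σ) := by
        rw [lintegral_add_left measurable_const, lintegral_const_mul' _ _ ENNReal.ofReal_ne_top]
        simp
    _ ≤ ENNReal.ofReal (3 * d ^ 2) + ENNReal.ofReal ((d ^ 2)⁻¹) *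
        ENNReal.ofReal (12288 * (σ + 4 * σ ^ 2 * 2 ^ K) ^ 4) := by
        gcongr
        exact lintegral_slip_pow_le hσ hθ i K
    _ = ENNReal.ofReal (3 * d ^ 2 + (d ^ 2)⁻¹ * (12288 * (σ + 4 * σ ^ 2 * 2 ^ K) ^ 4)) := by
        rw [← ENNReal.ofReal_mul (by positivity), ← ENNReal.ofReal_add (by positivity) (by positivity)]
    _ ≤ _ := by
        refine ENNReal.ofReal_le_ofReal ?_
        rw [hexp]
        have h1 : σ + 4 * σ ^ 2 * 2 ^ K ≤ 68 * d := by nlinarith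
        calc _ ≤ 3 * d ^ 2 + (d ^ 2)⁻¹ * (12288 * (68 * d) ^ 4) := by gcongr
          _ = _ := by field_simp

/-! ### Switches of the localization functions -/

lemma floor_two_mul (y : ℝ) : ⌊2 * y⌋ = 2 * ⌊y⌋ ∨ ⌊2 * y⌋ = 2 * ⌊y⌋ + 1 := by
  have h1 := Int.floor_le y
  have h2 := Int.lt_floor_add_one y
  rcases lt_or_ge (2 * y) (2 * ⌊y⌋ + 1) with h | h
  · left; rw [Int.floor_eq_iff]; push_cast; constructor <;> linarith
  · right; rw [Int.floor_eq_iff]; push_cast; constructor <;> linarith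

lemma floor_pow_sub_mul (x : ℝ) (Q k : ℕ) (h : k ≤ Q) :
    ⌊(2 : ℝ) ^ k * x⌋ = ⌊(2 : ℝ) ^ Q * x⌋ / 2 ^ (Q - k) := by
  have e : (2 : ℝ) ^ k * x = (2 : ℝ) ^ Q * x / ((2 ^ (Q - k) : ℕ) : ℝ) := by
    obtain ⟨r, rfl⟩ := Nat.exists_eq_add_of_le h
    rw [Nat.add_sub_cancel_left, pow_add]
    push_cast
    field_simp
  rw [e, Int.floor_div_natCast]
  push_cast
  rfl

/-- The Gray function number `k` as a function of the number `a` of the cell of level `Q`. -/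
def grayCell (Q k : ℕ) (a : ℤ) : Bool := decide (a / 2 ^ (Q - k) % 4 = 1 ∨ a / 2 ^ (Q - k) % 4 = 2)

/-- The conjugate Gray function as a function of the number `a` of the cell of level `Q`. -/
def conjGrayCell (Q k : ℕ) (a : ℤ) : Bool :=
  decide (a / 2 ^ (Q - k) % 4 = 2 ∨ a / 2 ^ (Q - k) % 4 = 3)

lemma gray_eq_grayCell {x : ℝ} (hx : x ∈ Icc (0 : ℝ) 1) {Q k : ℕ} (h : k ≤ Q) :
    gray k x = grayCell Q k ⌊(2 : ℝ) ^ Q * x⌋ := by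
  rw [gray_eq hx, floor_pow_sub_mul x Q k h, grayCell]

lemma conjGray_eq {x : ℝ} (hx : x ∈ Icc (0 : ℝ) 1) (k : ℕ) :
    conjGray k x = decide (⌊(2 : ℝ) ^ k * x⌋ % 4 = 2 ∨ ⌊(2 : ℝ) ^ k * x⌋ % 4 = 3) := by
  simp [conjGray, trunc_of_mem hx]

lemma conjGray_eq_conjGrayCell {x : ℝ} (hx : x ∈ Icc (0 : ℝ) 1) {Q k : ℕ} (h : k ≤ Q) :
    conjGray k x = conjGrayCell Q k ⌊(2 : ℝ) ^ Q * x⌋ := by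
  rw [conjGray_eq hx, floor_pow_sub_mul x Q k h, conjGrayCell]

lemma ediv_sub_one (a : ℤ) (r : ℕ) :
    (2 ^ r ∣ a ∧ (a - 1) / 2 ^ r = a / 2 ^ r - 1) ∨ (¬ (2 : ℤ) ^ r ∣ a ∧ (a - 1) / 2 ^ r = a / 2 ^ r) := by
  have hp : (0 : ℤ) < 2 ^ r := by positivity
  generalize (2 : ℤ) ^ r = p at *
  have h1 := Int.emod_add_mul_ediv a p
  have h2 := Int.emod_nonneg a hp.ne'
  have h3 := Int.emod_lt_of_pos a hp
  by_cases h : a % p = 0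
  · left
    refine ⟨Int.dvd_of_emod_eq_zero h, ?_⟩
    rw [Int.ediv_eq_iff_of_pos hp]
    constructor <;> nlinarith
  · right
    refine ⟨fun hd => h (Int.emod_eq_zero_of_dvd hd), ?_⟩
    have : 0 < a % p := lt_of_le_of_ne h2 (Ne.symm h)
    rw [Int.ediv_eq_iff_of_pos hp]
    constructor <;> nlinarith

/-- The Gray function number `k` switches only at odd multiples of `2 ^ (-k)`. -/
lemma grayCell_switch {Q k : ℕ} {a : ℤ} (h : grayCell Q k (a - 1) ≠ grayCell Q k a) :
    (2 : ℤ) ^ (Q - k) ∣ a ∧ ¬ (2 : ℤ) ^ (Q - k + 1) ∣ a := by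
  unfold grayCell at h
  rcases ediv_sub_one a (Q - k) with ⟨hd, e⟩ | ⟨_, e⟩
  · refine ⟨hd, ?_⟩
    rintro ⟨c, hc⟩
    apply h
    have : a / 2 ^ (Q - k) = 2 * c := by
      rw [hc, pow_succ, mul_assoc, Int.mul_ediv_cancel_left _ (by positivity)]
    rw [e, this, decide_eq_decide]
    omega
  · rw [e] at h; exact absurd rfl h

/-- The conjugate Gray function number `k` switches only at even multiples of `2 ^ (-k)`. -/
lemma conjGrayCell_switch {Q k : ℕ} {a : ℤ} (h : conjGrayCell Q k (a - 1) ≠ conjGrayCell Q k a) :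
    (2 : ℤ) ^ (Q - k + 1) ∣ a := by
  unfold conjGrayCell at h
  rcases ediv_sub_one a (Q - k) with ⟨⟨c, hc⟩, e⟩ | ⟨_, e⟩
  · by_contra hnd
    apply h
    have h2 : c % 2 = 1 := by
      by_contra h2
      apply hnd
      obtain ⟨c', hc'⟩ : ∃ c', c = 2 * c' := ⟨c / 2, by omega⟩
      exact ⟨c', by rw [hc, hc', pow_succ]; ring⟩
    have : a / 2 ^ (Q - k) = c := by
      rw [hc, Int.mul_ediv_cancel_left _ (by positivity)]
    rw [e, this, decide_eq_decide]
    omega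
  · rw [e] at h; exact absurd rfl h

/-- If a finite family of functions of the cell number has at most one switch at each grid point, and
if all votes at which `θ` is far from a switch are correct, then the votes are consistent with a
point at a distance of at most half a cell from `θ`. -/
lemma exists_consistent {ι : Type*} {Q : ℕ} {f : ι → ℝ → Bool} {F : ι → ℤ → Bool}
    (hf : ∀ k, ∀ x ∈ Icc (0 : ℝ) 1, f k x = F k ⌊(2 : ℝ) ^ Q * x⌋)
    (hft : ∀ k x, f k (trunc 0 1 x) = f k x)
    (hF : ∀ a k k', F k (a - 1) ≠ F k a → F k' (a - 1) ≠ F k' a → k = k')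
    {θ d : ℝ} (hθ : θ ∈ Icc (0 : ℝ) 1) (hd : 2 ^ Q * d = 1 / 2) (W : ι → Bool)
    (hW : ∀ k, (∀ X, |X - θ| < d → f k X = f k θ) → W k = f k θ) :
    ∃ x ∈ Icc (0 : ℝ) 1, |x - θ| ≤ d ∧ ∀ k, f k x = W k := by
  have hp : (0 : ℝ) < 2 ^ Q := by positivity
  set a := ⌊(2 : ℝ) ^ Q * θ⌋ with ha
  have ha1 := Int.floor_le ((2 : ℝ) ^ Q * θ)
  have ha2 := Int.lt_floor_add_one ((2 : ℝ) ^ Q * θ)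
  rw [← ha] at ha1 ha2
  have ha0 : 0 ≤ a := Int.floor_nonneg.2 (mul_nonneg hp.le hθ.1)
  have haQ : a ≤ 2 ^ Q := by
    have : (a : ℝ) ≤ ((2 ^ Q : ℤ) : ℝ) := by push_cast; nlinarith [hθ.2]
    exact_mod_cast this
  -- the cells near `θ`
  have hnear : ∀ X, |X - θ| < d → (2 : ℝ) ^ Q * θ - 1 / 2 < 2 ^ Q * trunc 0 1 X ∧
      2 ^ Q * trunc 0 1 X < 2 ^ Q * θ + 1 / 2 := by
    intro X hX
    have h1 := (abs_trunc_sub_le hθ X).trans_lt hX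
    rw [abs_lt] at h1
    constructor <;> nlinarith [h1.1, h1.2]
  have hfX : ∀ k X, f k X = F k ⌊(2 : ℝ) ^ Q * trunc 0 1 X⌋ := fun k X => by
    rw [← hft, hf k _ (trunc_mem zero_le_one X)]
  have hfθ : ∀ k, f k θ = F k a := fun k => hf k θ hθ
  have hbool : ∀ u v w : Bool, u ≠ v → v ≠ w → u = w := by decide
  by_cases hgood : ∀ k, W k = f k θ
  · refine ⟨θ, hθ, ?_, fun k => (hgood k).symm⟩
    rw [sub_self, abs_zero]
    nlinarith
  push Not at hgood
  obtain ⟨k₀, hk₀⟩ := hgood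
  rcases lt_or_ge ((2 : ℝ) ^ Q * θ) (a + 1 / 2) with hφ | hφ
  · -- `θ` is in the left half of its cell, and the switch is at the left end of the cell
    have hloc : ∀ X, |X - θ| < d → ⌊(2 : ℝ) ^ Q * trunc 0 1 X⌋ = a ∨
        (⌊(2 : ℝ) ^ Q * trunc 0 1 X⌋ = a - 1 ∧ 1 ≤ a) := by
      intro X hX
      obtain ⟨h1, h2⟩ := hnear X hX
      have h0 : 0 ≤ ⌊(2 : ℝ) ^ Q * trunc 0 1 X⌋ :=
        Int.floor_nonneg.2 (mul_nonneg hp.le (trunc_mem zero_le_one X).1)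
      rcases lt_or_ge ((2 : ℝ) ^ Q * trunc 0 1 X) a with h3 | h3
      · right
        have : ⌊(2 : ℝ) ^ Q * trunc 0 1 X⌋ = a - 1 := by
          rw [Int.floor_eq_iff]; push_cast; constructor <;> linarith
        exact ⟨this, by omega⟩
      · left; rw [Int.floor_eq_iff]; constructor <;> linarith
    have hrel : ∀ k, (F k (a - 1) = F k a ∨ a < 1) → W k = F k a := by
      intro k hk
      rw [← hfθ]
      refine hW k fun X hX => ?_
      rw [hfX, hfθ]
      rcases hloc X hX with h | ⟨h, h'⟩
      · rw [h]
      · rw [h]; exact hk.resolve_right (by omega)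
    have hsw : F k₀ (a - 1) ≠ F k₀ a ∧ 1 ≤ a := by
      by_contra hcon
      refine hk₀ ?_
      rw [hfθ]
      refine hrel k₀ ?_
      by_contra h
      push Not at h
      exact hcon h
    have hone : (1 : ℝ) ≤ a := by exact_mod_cast hsw.2
    have hall : ∀ k, F k (a - 1) = W k := by
      intro k
      by_cases hk : F k (a - 1) = F k a
      · rw [hk, hrel k (Or.inl hk)]
      · obtain rfl := hF a k k₀ hk hsw.1
        rw [hfθ] at hk₀
        exact hbool _ _ _ hk hk₀.symm
    -- a point of the cell to the left
    set x := max (θ - d) ((a - 1 : ℝ) / 2 ^ Q) with hx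
    have hx1 : (2 : ℝ) ^ Q * x < a := by
      rw [hx, mul_max_of_nonneg _ _ hp.le]
      refine max_lt (by nlinarith) ?_
      rw [mul_div_cancel₀ _ hp.ne']; linarith
    have hx2 : (a : ℝ) - 1 ≤ 2 ^ Q * x := by
      have := mul_le_mul_of_nonneg_left (le_max_right (θ - d) ((a - 1 : ℝ) / 2 ^ Q)) hp.le
      rwa [mul_div_cancel₀ _ hp.ne'] at this
    have hxθ : x < θ := by
      by_contra h
      push Not at h
      nlinarith [mul_le_mul_of_nonneg_left h hp.le]
    have hx01 : x ∈ Icc (0 : ℝ) 1 := by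
      refine ⟨le_trans ?_ (le_max_right _ _), hxθ.le.trans hθ.2⟩
      exact div_nonneg (by linarith) hp.le
    refine ⟨x, hx01, ?_, fun k => ?_⟩
    · rw [abs_of_neg (by linarith)]
      linarith [le_max_left (θ - d) ((a - 1 : ℝ) / 2 ^ Q)]
    · rw [hf k x hx01, ← hall]
      congr 1
      rw [Int.floor_eq_iff]; push_cast; constructor <;> linarith
  · -- `θ` is in the right half of its cell, and the switch is at the right end of the cell
    have hloc : ∀ X, |X - θ| < d → ⌊(2 : ℝ) ^ Q * trunc 0 1 X⌋ = a ∨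
        ⌊(2 : ℝ) ^ Q * trunc 0 1 X⌋ = a + 1 := by
      intro X hX
      obtain ⟨h1, h2⟩ := hnear X hX
      rcases lt_or_ge ((2 : ℝ) ^ Q * trunc 0 1 X) (a + 1) with h3 | h3
      · left; rw [Int.floor_eq_iff]; constructor <;> linarith
      · right; rw [Int.floor_eq_iff]; push_cast; constructor <;> linarith
    have hrel : ∀ k, F k a = F k (a + 1) → W k = F k a := by
      intro k hk
      rw [← hfθ]
      refine hW k fun X hX => ?_
      rw [hfX, hfθ]
      rcases hloc X hX with h | h
      · rw [h]
      · rw [h, hk]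
    have hsw : F k₀ a ≠ F k₀ (a + 1) := fun h => hk₀ (by rw [hfθ]; exact hrel k₀ h)
    have hall : ∀ k, F k (a + 1) = W k := by
      intro k
      by_cases hk : F k a = F k (a + 1)
      · rw [← hk, hrel k hk]
      · obtain rfl := hF (a + 1) k k₀ (by simpa using hk) (by simpa using hsw)
        rw [hfθ] at hk₀
        exact hbool _ _ _ (Ne.symm hk) hk₀.symm
    have haQ' : a + 1 ≤ 2 ^ Q := by
      have : (a : ℝ) < ((2 ^ Q : ℤ) : ℝ) := by push_cast; nlinarith [hθ.2]
      have : a < 2 ^ Q := by exact_mod_cast this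
      omega
    have haQr : (a : ℝ) + 1 ≤ 2 ^ Q := by exact_mod_cast haQ'
    have har : (0 : ℝ) ≤ a := by exact_mod_cast ha0
    have hx01 : ((a : ℝ) + 1) / 2 ^ Q ∈ Icc (0 : ℝ) 1 :=
      ⟨by positivity, by rw [div_le_one hp]; exact haQr⟩
    have hxθ : θ ≤ ((a : ℝ) + 1) / 2 ^ Q := by rw [le_div_iff₀ hp]; linarith
    refine ⟨_, hx01, ?_, fun k => ?_⟩
    · rw [abs_of_nonneg (by linarith), sub_le_iff_le_add, div_le_iff₀ hp]
      nlinarith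
    · rw [hf k _ hx01, ← hall]
      congr 1
      rw [mul_div_cancel₀ _ hp.ne', Int.floor_eq_iff]; push_cast; constructor <;> linarith

/-! ### Thickenings of subsets of the line -/

lemma cthickening_of_Ico_subset {S : Set ℝ} {u v d : ℝ} (huv : u < v) (hd : 0 ≤ d)
    (h1 : Ico u v ⊆ S) (h2 : S ⊆ Icc u v) : Metric.cthickening d S = Icc (u - d) (v + d) := by
  have hcl : closure S = Icc u v := by
    refine Subset.antisymm (closure_minimal h2 isClosed_Icc) ?_
    rw [← closure_Ico huv.ne]
    exact closure_mono h1
  rw [← Metric.cthickening_closure, hcl, isCompact_Icc.cthickening_eq_biUnion_closedBall hd]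
  ext x
  simp only [mem_iUnion, Metric.mem_closedBall, mem_Icc, Real.dist_eq, exists_prop, abs_le]
  constructor
  · rintro ⟨y, ⟨h3, h4⟩, h5, h6⟩
    constructor <;> linarith
  · rintro ⟨h3, h4⟩
    refine ⟨max u (min v x), ⟨le_max_left _ _, max_le huv.le (min_le_left _ _)⟩, ?_⟩
    rcases le_total v x with h | h
    · rw [min_eq_left h, max_eq_right huv.le]; constructor <;> linarith
    · rw [min_eq_right h]
      rcases le_total u x with h' | h'
      · rw [max_eq_right h']; constructor <;> linarith
      · rw [max_eq_left h']; constructor <;> linarith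

/-- A closed thickening of a subset of the line is an interval if it bridges the gaps of the set. -/
lemma ordConnected_cthickening {S : Set ℝ} {d : ℝ}
    (h : ∀ x ∈ S, ∀ y ∈ S, ∀ p, x ≤ p → p ≤ y → p ∈ Metric.cthickening d S) :
    OrdConnected (Metric.cthickening d S) := by
  refine ⟨fun u hu v hv p hp => ?_⟩
  by_contra hcon
  rw [Metric.mem_cthickening_iff] at hu hv hcon
  push Not at hcon
  obtain ⟨x, hx, hux⟩ := Metric.infEDist_lt_iff.1 (hu.trans_lt hcon)
  obtain ⟨y, hy, hvy⟩ := Metric.infEDist_lt_iff.1 (hv.trans_lt hcon)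
  have hle : ∀ s q : ℝ, s ∈ S → edist q s < Metric.infEDist p S → |q - s| < |p - s| := by
    intro s q hs hq
    have := hq.trans_le (Metric.infEDist_le_edist_of_mem hs)
    rw [edist_dist, edist_dist, Real.dist_eq, Real.dist_eq] at this
    exact (ENNReal.ofReal_lt_ofReal_iff_of_nonneg (abs_nonneg _)).1 this
  have hxp : x ≤ p := by
    by_contra hlt
    push Not at hlt
    have := hle x u hx hux
    rw [abs_of_neg (by linarith [hp.1]), abs_of_neg (by linarith)] at this
    linarith [hp.1]
  have hyp : p ≤ y := by
    by_contra hlt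
    push Not at hlt
    have := hle y v hy hvy
    rw [abs_of_pos (by linarith [hp.2]), abs_of_pos (by linarith)] at this
    linarith [hp.2]
  have := h x hx y hy p hxp hyp
  rw [Metric.mem_cthickening_iff] at this
  exact not_lt.2 this hcon

lemma ordConnected_cthickening_of_close {S : Set ℝ} {d : ℝ}
    (h : ∀ x ∈ S, ∀ y ∈ S, |x - y| ≤ 2 * d) : OrdConnected (Metric.cthickening d S) := by
  refine ordConnected_cthickening fun x hx y hy p hxp hpy => ?_
  have hxy := h x hx y hy
  rw [abs_of_nonpos (by linarith)] at hxy
  rcases le_total (p - x) d with h1 | h1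
  · refine Metric.mem_cthickening_of_dist_le p x d S hx ?_
    rw [Real.dist_eq, abs_of_nonneg (by linarith)]; exact h1
  · refine Metric.mem_cthickening_of_dist_le p y d S hy ?_
    rw [Real.dist_eq, abs_of_nonpos (by linarith)]; linarith

lemma exists_abs_sub_lt_of_mem_cthickening {S : Set ℝ} {d u ε : ℝ} (hd : 0 ≤ d) (hε : 0 < ε)
    (hu : u ∈ Metric.cthickening d S) : ∃ x ∈ S, |u - x| < d + ε := by
  have := Metric.cthickening_subset_thickening' (δ₁ := d) (δ₂ := d + ε) (by linarith) (by linarith) S hu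
  simpa [Metric.mem_thickening_iff, Real.dist_eq] using this

lemma abs_sub_le_of_mem_cthickening {S : Set ℝ} {d r : ℝ} (hd : 0 ≤ d)
    (h : ∀ x ∈ S, ∀ y ∈ S, |x - y| ≤ r) {u v : ℝ} (hu : u ∈ Metric.cthickening d S)
    (hv : v ∈ Metric.cthickening d S) : |u - v| ≤ r + 2 * d := by
  refine le_of_forall_pos_le_add fun ε hε => ?_
  obtain ⟨x, hx, h1⟩ := exists_abs_sub_lt_of_mem_cthickening hd (half_pos hε) hu
  obtain ⟨y, hy, h2⟩ := exists_abs_sub_lt_of_mem_cthickening hd (half_pos hε) hv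
  have h3 := h x hx y hy
  rw [abs_lt] at h1 h2
  rw [abs_le] at h3 ⊢
  constructor <;> linarith

/-- The two kinds of windows overlap so much that a set of half the unit length is in one of them. -/
lemma exists_window {I : Set ℝ} {w : ℝ} (hw : 0 < w) (hne : I.Nonempty)
    (h : ∀ u ∈ I, ∀ v ∈ I, |u - v| ≤ w / 2) :
    (∃ j : ℤ, I ⊆ Icc ((2 * j - 3 / 4) * w) ((2 * j + 3 / 4) * w)) ∨
      ∃ j : ℤ, I ⊆ Icc ((2 * j + 1 / 4) * w) ((2 * j + 7 / 4) * w) := by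
  obtain ⟨u₀, hu₀⟩ := hne
  have hbdd : BddBelow I := ⟨u₀ - w / 2, fun v hv => by
    have := h u₀ hu₀ v hv; rw [abs_le] at this; linarith⟩
  set s := sInf I
  have h1 : ∀ v ∈ I, s ≤ v := fun v hv => csInf_le hbdd hv
  have h2 : ∀ v ∈ I, v ≤ s + w / 2 := by
    intro v hv
    have : v - w / 2 ≤ s := le_csInf ⟨u₀, hu₀⟩ fun u hu => by
      have := h u hu v hv; rw [abs_le] at this; linarith
    linarith
  set j := ⌊(s / w + 3 / 4) / 2⌋ with hj
  have j1 := Int.floor_le ((s / w + 3 / 4) / 2)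
  have j2 := Int.lt_floor_add_one ((s / w + 3 / 4) / 2)
  rw [← hj] at j1 j2
  have hsw : s / w * w = s := div_mul_cancel₀ _ hw.ne'
  have k1 : (2 * j - 3 / 4) * w ≤ s := by rw [← hsw]; gcongr; linarith
  have k2 : s ≤ (2 * j + 5 / 4) * w := by rw [← hsw]; gcongr; linarith
  rcases le_total s ((2 * j + 1 / 4) * w) with hc | hc
  · exact Or.inl ⟨j, fun v hv => ⟨k1.trans (h1 v hv), (h2 v hv).trans (by linarith)⟩⟩
  · exact Or.inr ⟨j, fun v hv => ⟨hc.trans (h1 v hv), (h2 v hv).trans (by linarith)⟩⟩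

/-! ### Inverting a convolution on an interval -/

/-- On a compact interval, the truncated value `y` is attained by a continuous `Φ`, so that
`Function.invFunOn` returns a genuine preimage. -/
lemma invert_spec {Φ : ℝ → ℝ} {I : Set ℝ} (hne : I.Nonempty) (hc : IsCompact I)
    (ho : OrdConnected I) (hΦ : ContinuousOn Φ I) (y : ℝ) :
    invert Φ I y ∈ I ∧ ∀ θ ∈ I, |Φ (invert Φ I y) - Φ θ| ≤ |y - Φ θ| := by
  have hci : IsCompact (Φ '' I) := hc.image_of_continuousOn hΦ
  have hni : (Φ '' I).Nonempty := hne.image Φ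
  have hoi : OrdConnected (Φ '' I) := (ho.isPreconnected.image Φ hΦ).ordConnected
  have hle : sInf (Φ '' I) ≤ sSup (Φ '' I) := by
    obtain ⟨u, hu⟩ := hni
    exact (csInf_le hci.bddBelow hu).trans (le_csSup hci.bddAbove hu)
  have hmem : ∃ x ∈ I, Φ x = trunc (sInf (Φ '' I)) (sSup (Φ '' I)) y :=
    hoi.out (hci.sInf_mem hni) (hci.sSup_mem hni) (trunc_mem hle y)
  have e : Φ (invert Φ I y) = trunc (sInf (Φ '' I)) (sSup (Φ '' I)) y := Function.invFunOn_eq hmem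
  refine ⟨Function.invFunOn_mem hmem, fun θ hθ => ?_⟩
  rw [e]
  exact abs_trunc_sub_le ⟨csInf_le hci.bddBelow (mem_image_of_mem Φ hθ),
    le_csSup hci.bddAbove (mem_image_of_mem Φ hθ)⟩ y

lemma invert_window {σ : ℝ} (hσ : 0 < σ) {f : ℝ → Bool} (hf : Measurable f) {p : ℝ}
    (hstep : IsStep f p (2 * (8 * fine σ))) {I : Set ℝ} (hne : I.Nonempty) (hc : IsClosed I)
    (ho : OrdConnected I)
    (hI : I ⊆ Icc (p - 3 / 4 * (8 * fine σ)) (p + 3 / 4 * (8 * fine σ))) (y : ℝ) :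
    invert (conv σ f) I y ∈ I ∧
      ∀ θ ∈ I, slope * |invert (conv σ f) I y - θ| ≤ σ * |y - conv σ f θ| := by
  obtain ⟨h1, h2⟩ := fine_bounds hσ
  have hb : ∀ x ∈ I, ∀ y ∈ I, slope * |y - x| ≤ σ * |conv σ f y - conv σ f x| ∧
      σ * |conv σ f y - conv σ f x| ≤ gaussianPDFReal 0 1 0 * |y - x| := fun x hx y hy =>
    conv_sub_bounds_of_isStep hf hσ (by linarith) (by linarith) hstep (hI hx) (hI hy)
  have hcomp : IsCompact I := isCompact_Icc.of_isClosed_subset hc hI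
  have hcont : ContinuousOn (conv σ f) I := by
    refine (LipschitzOnWith.of_dist_le_mul
      (K := (gaussianPDFReal 0 1 0 / σ).toNNReal) fun x hx y hy => ?_).continuousOn
    have h0 : 0 ≤ gaussianPDFReal 0 1 0 / σ := div_nonneg (gaussianPDFReal_nonneg _ _ _) hσ.le
    rw [Real.dist_eq, Real.dist_eq, Real.coe_toNNReal _ h0, div_mul_eq_mul_div, le_div_iff₀ hσ,
      mul_comm]
    exact (hb y hy x hx).2
  obtain ⟨hmem, hinv⟩ := invert_spec hne hcomp ho hcont y
  refine ⟨hmem, fun θ hθ => ((hb θ hθ _ hmem).1).trans ?_⟩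
  exact mul_le_mul_of_nonneg_left (hinv θ hθ) hσ.le

/-! ### The crude and the finer interval -/

section Intervals

variable {m : ℕ} {σ : ℝ} {b : Fin m → ℕ} {z : Transcripts b}

lemma two_pow_mul_fine {N : ℕ} {k : ℤ} (h : lev σ = N + k) :
    (2 : ℝ) ^ N * fine σ = (2 : ℝ) ^ (3 - k) := by
  rw [fine, ← zpow_natCast, ← zpow_add₀ two_ne_zero, h]
  congr 1; ring

/-- The number of the cell decoded from the crude localization bits, of level `κ - 1`. -/
noncomputable def crudeCell (σ : ℝ) (b : Fin m → ℕ) (z : Transcripts b) (κ : ℕ) : ℕ :=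
  cell (crudeBit b (special σ b) z) (κ - 1)

/-- `I_1` is the decoded cell with half a cell added on each side, as far as that is in `[0,1]`. -/
lemma mem_I1_iff {κ : ℕ} (hκ : lev σ = ll σ b + κ + 2) (hκ2 : 2 ≤ κ) (x : ℝ) :
    x ∈ I1 σ b z ↔ x ∈ Icc (0 : ℝ) 1 ∧ 2 * (crudeCell σ b z κ : ℝ) - 1 ≤ 2 ^ κ * x ∧
      2 ^ κ * x ≤ 2 * crudeCell σ b z κ + 3 := by
  have h3 : ¬ lev σ - ll σ b ≤ 3 := by omega
  have hK : (lev σ - ll σ b - 3).toNat = κ - 1 := by omega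
  have hexp : (2 : ℝ) ^ (-(lev σ - ll σ b - 2)) = (2 ^ κ)⁻¹ := by
    rw [zpow_neg, show lev σ - ll σ b - 2 = (κ : ℤ) by omega, zpow_natCast]
  have hpow : (2 : ℝ) ^ κ = 2 ^ (κ - 1) * 2 := by rw [← pow_succ]; congr 1; omega
  have hp : (0 : ℝ) < 2 ^ κ := by positivity
  have hp' : (0 : ℝ) < 2 ^ (κ - 1) := by positivity
  obtain ⟨h1, h2⟩ := dec_subset (crudeBit b (special σ b) z) (κ - 1)
  rw [I1, if_neg h3, I1', if_neg h3, hK, hexp, cthickening_of_Ico_subset (by gcongr; linarith)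
    (by positivity) h1 h2, mem_inter_iff, and_comm]
  change _ ∧ x ∈ Icc ((crudeCell σ b z κ : ℝ) / 2 ^ (κ - 1) - (2 ^ κ)⁻¹)
    (((crudeCell σ b z κ : ℝ) + 1) / 2 ^ (κ - 1) + (2 ^ κ)⁻¹) ↔ _
  have e1 : (crudeCell σ b z κ : ℝ) / 2 ^ (κ - 1) - (2 ^ κ)⁻¹ =
      (2 * (crudeCell σ b z κ : ℝ) - 1) / 2 ^ κ := by rw [hpow]; field_simp
  have e2 : ((crudeCell σ b z κ : ℝ) + 1) / 2 ^ (κ - 1) + (2 ^ κ)⁻¹ =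
      (2 * (crudeCell σ b z κ : ℝ) + 3) / 2 ^ κ := by rw [hpow]; field_simp; ring
  refine and_congr_right fun _ => ?_
  rw [e1, e2, mem_Icc, div_le_iff₀ hp, le_div_iff₀ hp, mul_comm x]

lemma I2_eq_cthickening (h : ¬ (lev σ - ll σ b ≤ 3 ∧ lev σ ≤ 4)) :
    I2 σ b z = Metric.cthickening (fine σ) (I2' σ b z) := by
  rw [I2, if_neg h]; rfl

lemma isClosed_I2 : IsClosed (I2 σ b z) := by
  unfold I2
  split_ifs
  · exact isClosed_Icc
  · exact Metric.isClosed_cthickening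

lemma mem_I2'_iff (h : ¬ lev σ - ll σ b ≤ 3) (x : ℝ) :
    x ∈ I2' σ b z ↔ x ∈ I1 σ b z ∧
      ∀ k : ℕ, 1 ≤ k → k ≤ ll σ b → finer σ (ll σ b) k x = vote σ b z k := by
  rw [I2', if_neg h]; rfl

/-- The finer localization function number `k`, as a function of the cell of level `Q`. -/
def finerCell (Q κ k : ℕ) (a : ℤ) : Bool :=
  if k = 1 then grayCell Q κ a else if k = 2 then conjGrayCell Q κ a else grayCell Q (κ + k - 2) a

lemma finer_eq {l κ k : ℕ} (hκ : lev σ = l + κ + 2) :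
    finer σ l k = if k = 1 then gray κ else if k = 2 then conjGray κ
      else gray ((κ + k : ℕ) - 2 : ℤ) := by
  unfold finer
  rw [hκ]
  have e : (l : ℤ) + κ + 2 - l - 2 = κ := by ring
  have e2 : (l : ℤ) + κ + 2 - l - 4 + k = ((κ + k : ℕ) : ℤ) - 2 := by push_cast; ring
  rw [e, e2]

lemma finer_eq_finerCell {l κ k Q : ℕ} (hκ : lev σ = l + κ + 2) (hk1 : 1 ≤ k) (hkl : k ≤ l)
    (hl : 2 ≤ l) (hQ : Q = κ + l - 2) {x : ℝ} (hx : x ∈ Icc (0 : ℝ) 1) :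
    finer σ l k x = finerCell Q κ k ⌊(2 : ℝ) ^ Q * x⌋ := by
  rw [finer_eq hκ, finerCell]
  split_ifs with h1 h2
  · exact gray_eq_grayCell hx (by omega)
  · exact conjGray_eq_conjGrayCell hx (by omega)
  · rw [show ((κ + k : ℕ) : ℤ) - 2 = ((κ + k - 2 : ℕ) : ℤ) by omega]
    exact gray_eq_grayCell hx (by omega)

lemma finer_trunc (l k : ℕ) (x : ℝ) : finer σ l k (trunc 0 1 x) = finer σ l k x := by
  unfold finer
  split_ifs
  · exact gray_trunc _ _
  · exact conjGray_trunc _ _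
  · exact gray_trunc _ _

/-- The finer localization functions have their switches at different points. -/
lemma finerCell_switch_unique {Q κ l : ℕ} (hQ : Q = κ + l - 2) {a : ℤ} {k k' : ℕ} (hk1 : 1 ≤ k)
    (hkl : k ≤ l) (hk1' : 1 ≤ k') (hkl' : k' ≤ l) (hl : 2 ≤ l)
    (h : finerCell Q κ k (a - 1) ≠ finerCell Q κ k a)
    (h' : finerCell Q κ k' (a - 1) ≠ finerCell Q κ k' a) : k = k' := by
  -- the exponent of `2` in `a` is `l - k` for `k ≥ 3`, it is `l - 2` for `k = 1`, and larger for `k = 2`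
  have key : ∀ k : ℕ, 1 ≤ k → k ≤ l → finerCell Q κ k (a - 1) ≠ finerCell Q κ k a →
      (k = 2 ∧ (2 : ℤ) ^ (l - 1) ∣ a) ∨
      (k = 1 ∧ (2 : ℤ) ^ (l - 2) ∣ a ∧ ¬ (2 : ℤ) ^ (l - 1) ∣ a) ∨
      (3 ≤ k ∧ (2 : ℤ) ^ (l - k) ∣ a ∧ ¬ (2 : ℤ) ^ (l - k + 1) ∣ a) := by
    intro k hk1 hkl h
    unfold finerCell at h
    split_ifs at h with h1 h2
    · right; left
      have := grayCell_switch h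
      rw [show Q - κ = l - 2 by omega, show l - 2 + 1 = l - 1 by omega] at this
      exact ⟨h1, this⟩
    · left
      have := conjGrayCell_switch h
      rw [show Q - κ + 1 = l - 1 by omega] at this
      exact ⟨h2, this⟩
    · right; right
      have := grayCell_switch h
      rw [show Q - (κ + k - 2) = l - k by omega] at this
      exact ⟨by omega, this⟩
  have mono : ∀ r s : ℕ, r ≤ s → (2 : ℤ) ^ s ∣ a → (2 : ℤ) ^ r ∣ a := fun r s hrs hd =>
    (pow_dvd_pow 2 hrs).trans hd
  rcases key k hk1 hkl h with ⟨e, d⟩ | ⟨e, d, n⟩ | ⟨e, d, n⟩ <;>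
    rcases key k' hk1' hkl' h' with ⟨e', d'⟩ | ⟨e', d', n'⟩ | ⟨e', d', n'⟩
  · omega
  · exact absurd d n'
  · exact absurd (mono _ _ (by omega) d) n'
  · exact absurd d' n
  · omega
  · exact absurd (mono _ _ (by omega) d) n'
  · exact absurd (mono _ _ (by omega) d') n
  · exact absurd (mono _ _ (by omega) d') n
  · rcases lt_trichotomy k k' with hlt | heq | hgt
    · exact absurd (mono _ _ (by omega) d) n'
    · exact heq
    · exact absurd (mono _ _ (by omega) d') n

/-- The finer localization functions determine the number of the fine cell modulo `2 ^ l`. -/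
lemma floor_sub_eq_of_finer_eq {l κ : ℕ} (hκ : lev σ = l + κ + 2) {x y : ℝ}
    (hx : x ∈ Icc (0 : ℝ) 1) (hy : y ∈ Icc (0 : ℝ) 1)
    (h : ∀ k, 1 ≤ k → k ≤ l → finer σ l k x = finer σ l k y) {j : ℕ} (hj : j + 2 ≤ l) :
    ∃ t : ℤ, ⌊(2 : ℝ) ^ (κ + j) * x⌋ - ⌊(2 : ℝ) ^ (κ + j) * y⌋ = 2 ^ (j + 2) * t := by
  induction j with
  | zero =>
    have h1 := h 1 le_rfl (by omega)
    have h2 := h 2 (by omega) (by omega)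
    simp only [finer_eq hκ] at h1 h2
    simp only [if_true] at h1
    norm_num at h2
    rw [gray_eq hx, gray_eq hy, decide_eq_decide] at h1
    rw [conjGray_eq hx, conjGray_eq hy, decide_eq_decide] at h2
    refine ⟨(⌊(2 : ℝ) ^ (κ + 0) * x⌋ - ⌊(2 : ℝ) ^ (κ + 0) * y⌋) / 4, ?_⟩
    simp only [add_zero, zero_add]
    omega
  | succ j ih =>
    obtain ⟨t, ht⟩ := ih (by omega)
    have hk := h (j + 3) (by omega) (by omega)
    simp only [finer_eq hκ] at hk
    rw [if_neg (by omega), if_neg (by omega),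
      show ((κ + (j + 3) : ℕ) : ℤ) - 2 = ((κ + (j + 1) : ℕ) : ℤ) by push_cast; ring,
      gray_eq hx, gray_eq hy, decide_eq_decide] at hk
    have e : ∀ u : ℝ, (2 : ℝ) ^ (κ + (j + 1)) * u = 2 * ((2 : ℝ) ^ (κ + j) * u) := fun u => by
      rw [← add_assoc, pow_succ]; ring
    rw [e, e] at hk ⊢
    have hx2 := floor_two_mul ((2 : ℝ) ^ (κ + j) * x)
    have hy2 := floor_two_mul ((2 : ℝ) ^ (κ + j) * y)
    have hpar : ⌊(2 : ℝ) ^ (κ + j) * x⌋ % 2 = ⌊(2 : ℝ) ^ (κ + j) * y⌋ % 2 := by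
      have : (2 : ℤ) ^ (j + 2) * t = 2 * (2 ^ (j + 1) * t) := by ring
      omega
    refine ⟨t, ?_⟩
    have : (2 : ℤ) ^ (j + 1 + 2) * t = 2 * (2 ^ (j + 2) * t) := by ring
    rw [this, ← ht]
    omega

/-- Two points of `I_2'` in different cells are in the first cell and at the last point of `I_1`. -/
lemma I2'_far {κ Q : ℕ} (hκ : lev σ = ll σ b + κ + 2) (hκ2 : 2 ≤ κ) (hl : 2 ≤ ll σ b)
    (hQ : Q = κ + ll σ b - 2) {x y : ℝ} (hx : x ∈ I2' σ b z) (hy : y ∈ I2' σ b z)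
    (hxy : 2 * fine σ < y - x) :
    (⌊(2 : ℝ) ^ Q * x⌋ = 2 ^ (ll σ b - 2) * (2 * (crudeCell σ b z κ : ℤ) - 1)) ∧
      (2 : ℝ) ^ Q * y = 2 ^ (ll σ b - 2) * (2 * (crudeCell σ b z κ : ℝ) + 3) := by
  have hn : ¬ lev σ - ll σ b ≤ 3 := by omega
  rw [mem_I2'_iff hn, mem_I1_iff hκ hκ2] at hx hy
  obtain ⟨⟨hx01, hx1, hx2⟩, hxv⟩ := hx
  obtain ⟨⟨hy01, hy1, hy2⟩, hyv⟩ := hy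
  obtain ⟨t, ht⟩ := floor_sub_eq_of_finer_eq hκ hy01 hx01
    (fun k h1 h2 => (hyv k h1 h2).trans (hxv k h1 h2).symm) (j := ll σ b - 2) (by omega)
  rw [show κ + (ll σ b - 2) = Q by omega, show ll σ b - 2 + 2 = ll σ b by omega] at ht
  have hfine : (2 : ℝ) ^ Q * fine σ = 1 / 2 := by
    rw [two_pow_mul_fine (k := 4) (by omega)]; norm_num
  set L := ll σ b - 2 with hL
  have hpQ : (2 : ℝ) ^ Q = 2 ^ L * 2 ^ κ := by rw [← pow_add]; congr 1; omega
  have hpl : (2 : ℤ) ^ (ll σ b) = 2 ^ L * 4 := by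
    rw [show (4 : ℤ) = 2 ^ 2 by norm_num, ← pow_add]; congr 1; omega
  have hpL : (0 : ℝ) < 2 ^ L := by positivity
  have hpLz : (0 : ℤ) < 2 ^ L := by positivity
  have hp : (0 : ℝ) < 2 ^ Q := by positivity
  have bx : 2 ^ L * (2 * (crudeCell σ b z κ : ℝ) - 1) ≤ 2 ^ Q * x := by
    rw [hpQ, mul_assoc]; gcongr
  have bY : (2 : ℝ) ^ Q * y ≤ 2 ^ L * (2 * (crudeCell σ b z κ : ℝ) + 3) := by
    rw [hpQ, mul_assoc]; gcongr
  have fx1 : 2 ^ L * (2 * (crudeCell σ b z κ : ℤ) - 1) ≤ ⌊(2 : ℝ) ^ Q * x⌋ := by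
    rw [Int.le_floor]; push_cast; exact bx
  have fy1 := Int.floor_le ((2 : ℝ) ^ Q * y)
  have fx2 := Int.lt_floor_add_one ((2 : ℝ) ^ Q * x)
  have fy2 : ⌊(2 : ℝ) ^ Q * y⌋ ≤ 2 ^ L * (2 * (crudeCell σ b z κ : ℤ) + 3) := by
    have : ((⌊(2 : ℝ) ^ Q * y⌋ : ℤ) : ℝ) ≤ ((2 ^ L * (2 * (crudeCell σ b z κ : ℤ) + 3) : ℤ) : ℝ) := by
      push_cast; linarith
    exact_mod_cast this
  have hgt : ⌊(2 : ℝ) ^ Q * x⌋ < ⌊(2 : ℝ) ^ Q * y⌋ := by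
    have h1 : (2 : ℝ) ^ Q * x + 1 < 2 ^ Q * y := by nlinarith
    have h2 : ⌊(2 : ℝ) ^ Q * x + 1⌋ ≤ ⌊(2 : ℝ) ^ Q * y⌋ := Int.floor_le_floor h1.le
    rw [Int.floor_add_one] at h2
    omega
  have ht1 : 1 ≤ t := by
    rw [hpl] at ht
    by_contra hcon
    have : (2 : ℤ) ^ L * 4 * t ≤ 0 := mul_nonpos_of_nonneg_of_nonpos (by positivity) (by omega)
    omega
  rw [hpl] at ht
  have hge : (2 : ℤ) ^ L * 4 ≤ 2 ^ L * 4 * t := le_mul_of_one_le_right (by positivity) ht1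
  have e : (2 : ℤ) ^ L * (2 * (crudeCell σ b z κ : ℤ) + 3) =
      2 ^ L * (2 * (crudeCell σ b z κ : ℤ) - 1) + 2 ^ L * 4 := by ring
  have hfx : ⌊(2 : ℝ) ^ Q * x⌋ = 2 ^ L * (2 * (crudeCell σ b z κ : ℤ) - 1) := by omega
  have hfy : ⌊(2 : ℝ) ^ Q * y⌋ = 2 ^ L * (2 * (crudeCell σ b z κ : ℤ) + 3) := by omega
  refine ⟨hfx, le_antisymm bY ?_⟩
  have : ((⌊(2 : ℝ) ^ Q * y⌋ : ℤ) : ℝ) = 2 ^ L * (2 * (crudeCell σ b z κ : ℝ) + 3) := by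
    rw [hfy]; push_cast; ring
  linarith

end Intervals

/-! ### The error of the estimate -/

section Estimate

variable {m : ℕ} {σ : ℝ} {b : Fin m → ℕ} {z : Transcripts b}

/-- The level `λ - l - 2` of the first two finer localization functions, if `λ - l ≥ 4`. -/
lemma exists_level (h : ¬ lev σ - ll σ b ≤ 3) :
    ∃ κ : ℕ, lev σ = ll σ b + κ + 2 ∧ 2 ≤ κ :=
  ⟨(lev σ - ll σ b - 2).toNat, by omega, by omega⟩

/-- If `λ - l ≤ 3` and `λ ≥ 5`, then `I_2'` is a cell of level `λ - 4`. -/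
lemma I2'_close_of_le (h : lev σ - ll σ b ≤ 3) (h5 : ¬ lev σ ≤ 4) :
    ∀ x ∈ I2' σ b z, ∀ y ∈ I2' σ b z, |x - y| ≤ 2 * fine σ := by
  intro x hx y hy
  rw [I2', if_pos h, if_neg h5] at hx hy
  have hQ : lev σ = (lev σ - 4).toNat + 4 := by omega
  have h1 := two_pow_mul_fine hQ
  set Q := (lev σ - 4).toNat
  have hx := (dec_subset _ _).2 hx
  have hy := (dec_subset _ _).2 hy
  have hp : (0 : ℝ) < 2 ^ Q := by positivity
  rw [mem_Icc, div_le_iff₀ hp, le_div_iff₀ hp] at hx hy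
  have h1 : (2 : ℝ) ^ Q * fine σ = 1 / 2 := by rw [h1]; norm_num
  rw [abs_le]
  constructor <;> refine le_of_mul_le_mul_right ?_ hp <;> nlinarith [hx.1, hx.2, hy.1, hy.2]

/-- If `I_2` is in a window, then it is an interval, so that the convolution can be inverted on it:
the gaps in `I_2'` are either closed by the thickening, or too wide for a window. -/
lemma ordConnected_I2 (hw : WindowA σ b z ∨ WindowB σ b z) : OrdConnected (I2 σ b z) := by
  have hδ := fine_pos σ
  by_cases h3 : lev σ - ll σ b ≤ 3
  · by_cases h4 : lev σ ≤ 4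
    · rw [I2, if_pos ⟨h3, h4⟩]; exact ordConnected_Icc
    · rw [I2_eq_cthickening (fun h => h4 h.2)]
      exact ordConnected_cthickening_of_close (I2'_close_of_le h3 h4)
  have hI2 : I2 σ b z = Metric.cthickening (fine σ) (I2' σ b z) :=
    I2_eq_cthickening (fun h => h3 h.1)
  obtain ⟨κ, hκ, hκ2⟩ := exists_level h3
  have hpκ : (0 : ℝ) < 2 ^ κ := by positivity
  rcases Nat.lt_or_ge (ll σ b) 2 with hl | hl
  · rcases Nat.lt_or_ge (ll σ b) 1 with hl0 | hl1
    · -- no finer localization: `I_2'` is `I_1`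
      have hf : (2 : ℝ) ^ κ * fine σ = 2 := by
        rw [two_pow_mul_fine (k := 2) (by omega)]; norm_num
      rw [hI2]
      refine ordConnected_cthickening_of_close fun x hx y hy => ?_
      obtain ⟨-, hx1, hx2⟩ := (mem_I1_iff hκ hκ2 x).1 ((mem_I2'_iff h3 x).1 hx).1
      obtain ⟨-, hy1, hy2⟩ := (mem_I1_iff hκ hκ2 y).1 ((mem_I2'_iff h3 y).1 hy).1
      rw [abs_le]
      constructor <;> refine le_of_mul_le_mul_left ?_ hpκ <;> nlinarith
    · -- one vote: the Gray function switches at one of the points `p - δ` and `p + δ`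
      have hl' : ll σ b = 1 := by omega
      have hf : (2 : ℝ) ^ κ * fine σ = 1 := by
        rw [two_pow_mul_fine (k := 3) (by omega)]; norm_num
      rw [hI2]
      refine ordConnected_cthickening fun x hx y hy p hxp hpy => ?_
      have hmem : ∀ q, q ∈ I2' σ b z ↔ q ∈ I1 σ b z ∧ gray κ q = vote σ b z 1 := by
        intro q
        rw [mem_I2'_iff h3]
        refine and_congr_right fun _ => ⟨fun h => ?_, fun h k h1 h2 => ?_⟩
        · have := h 1 le_rfl hl1
          rwa [finer_eq hκ, if_pos rfl] at this
        · obtain rfl : k = 1 := by omega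
          rwa [finer_eq hκ, if_pos rfl]
      have hconv : ∀ q, x ≤ q → q ≤ y → q ∈ I1 σ b z := by
        intro q h1 h2
        obtain ⟨hx0, hx1, -⟩ := (mem_I1_iff hκ hκ2 x).1 ((hmem x).1 hx).1
        obtain ⟨hy0, -, hy2⟩ := (mem_I1_iff hκ hκ2 y).1 ((hmem y).1 hy).1
        refine (mem_I1_iff hκ hκ2 q).2 ⟨⟨hx0.1.trans h1, h2.trans hy0.2⟩, ?_, ?_⟩
        · exact hx1.trans (by gcongr)
        · exact le_trans (by gcongr) hy2
      have hself : ∀ q ∈ I2' σ b z, |p - q| ≤ fine σ → p ∈ Metric.cthickening (fine σ) (I2' σ b z) :=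
        fun q hq h => Metric.mem_cthickening_of_dist_le p q _ _ hq (by rwa [Real.dist_eq])
      by_cases hg : gray κ p = vote σ b z 1
      · exact hself p ((hmem p).2 ⟨hconv p hxp hpy, hg⟩) (by simp [hδ.le])
      have hp01 := ((mem_I1_iff hκ hκ2 p).1 (hconv p hxp hpy)).1
      have hbool : ∀ u v w : Bool, u ≠ v → u ≠ w → w = v := by decide
      by_cases hpar : ⌊(2 : ℝ) ^ κ * p⌋ % 2 = 0
      · rcases le_or_gt (p + fine σ) y with hy' | hy'
        · have hq := hconv (p + fine σ) (by linarith) hy'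
          have hq01 := ((mem_I1_iff hκ hκ2 _).1 hq).1
          refine hself (p + fine σ) ((hmem _).2 ⟨hq, hbool _ _ _ hg ?_⟩) (by
            rw [sub_add_cancel_left, abs_neg, abs_of_pos hδ])
          rw [gray_eq hp01, gray_eq hq01, mul_add, hf, Int.floor_add_one, Ne, decide_eq_decide]
          omega
        · exact hself y hy (by rw [abs_le]; constructor <;> linarith)
      · rcases le_or_gt x (p - fine σ) with hx' | hx'
        · have hq := hconv (p - fine σ) hx' (by linarith)
          have hq01 := ((mem_I1_iff hκ hκ2 _).1 hq).1
          refine hself (p - fine σ) ((hmem _).2 ⟨hq, hbool _ _ _ hg ?_⟩) (by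
            rw [sub_sub_cancel, abs_of_pos hδ])
          rw [gray_eq hp01, gray_eq hq01, mul_sub, hf, Int.floor_sub_one, Ne, decide_eq_decide]
          omega
        · exact hself x hx (by rw [abs_le]; constructor <;> linarith)
  · -- two points of `I_2'` in different cells would make `I_2` too long
    rw [hI2]
    obtain ⟨Q, hQ⟩ : ∃ Q, Q = κ + ll σ b - 2 := ⟨_, rfl⟩
    have hf : (2 : ℝ) ^ Q * fine σ = 1 / 2 := by
      rw [two_pow_mul_fine (k := 4) (by omega)]; norm_num
    have hp : (0 : ℝ) < 2 ^ Q := by positivity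
    have key : ∀ x ∈ I2' σ b z, ∀ y ∈ I2' σ b z, y - x ≤ 2 * fine σ := by
      intro x hx y hy
      by_contra hcon
      push Not at hcon
      obtain ⟨hfx, hqy⟩ := I2'_far hκ hκ2 hl hQ hx hy hcon
      set L := ll σ b - 2 with hL
      set a := crudeCell σ b z κ with ha
      -- the left end of the first cell is in `I_2'` too
      set x₀ : ℝ := 2 ^ L * (2 * (a : ℝ) - 1) / 2 ^ Q with hx₀
      have hqx₀ : (2 : ℝ) ^ Q * x₀ = 2 ^ L * (2 * (a : ℝ) - 1) := mul_div_cancel₀ _ hp.ne'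
      have hxI := (mem_I2'_iff h3 x).1 hx
      obtain ⟨hx01, hx1, hx2⟩ := (mem_I1_iff hκ hκ2 x).1 hxI.1
      have hfloor : ⌊(2 : ℝ) ^ Q * x₀⌋ = ⌊(2 : ℝ) ^ Q * x⌋ := by
        rw [hqx₀, hfx, Int.floor_eq_iff]; push_cast; constructor <;> linarith
      have hle : x₀ ≤ x := by
        have h := Int.floor_le ((2 : ℝ) ^ Q * x)
        rw [hfx] at h
        refine le_of_mul_le_mul_left ?_ hp
        rw [hqx₀]; push_cast at h; exact h
      have hA0 : (0 : ℤ) ≤ 2 ^ L * (2 * (a : ℤ) - 1) := by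
        rw [← hfx]; exact Int.floor_nonneg.2 (mul_nonneg hp.le hx01.1)
      have hA0' : (0 : ℝ) ≤ 2 ^ L * (2 * (a : ℝ) - 1) := by exact_mod_cast hA0
      have hx₀01 : x₀ ∈ Icc (0 : ℝ) 1 := ⟨div_nonneg hA0' hp.le, hle.trans hx01.2⟩
      have hpQ : (2 : ℝ) ^ Q = 2 ^ L * 2 ^ κ := by rw [← pow_add]; congr 1; omega
      have hx₀I : x₀ ∈ I2' σ b z := by
        refine (mem_I2'_iff h3 x₀).2 ⟨(mem_I1_iff hκ hκ2 x₀).2 ⟨hx₀01, ?_, ?_⟩, fun k h1 h2 => ?_⟩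
        · rw [hpQ, mul_assoc] at hqx₀
          exact (mul_left_cancel₀ (by positivity) hqx₀).ge
        · exact le_trans (by gcongr) hx2
        · rw [← hxI.2 k h1 h2, finer_eq_finerCell hκ h1 h2 hl hQ hx₀01,
            finer_eq_finerCell hκ h1 h2 hl hQ hx01, hfloor]
      have hm1 : x₀ - fine σ ∈ I2 σ b z := by
        rw [hI2]
        exact Metric.mem_cthickening_of_dist_le _ x₀ _ _ hx₀I (by simp [abs_of_pos hδ])
      have hm2 : y + fine σ ∈ I2 σ b z := by
        rw [hI2]
        exact Metric.mem_cthickening_of_dist_le _ y _ _ hy (by simp [abs_of_pos hδ])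
      have hend : ∃ s : ℤ, (s % 8 = 5 ∨ s % 8 = 1) ∧
          (s : ℝ) ≤ 2 ^ L * (2 * (a : ℝ) - 1) - 1 / 2 ∧
          2 ^ L * (2 * (a : ℝ) + 3) + 1 / 2 ≤ s + 6 := by
        rcases hw with ⟨-, j, hj⟩ | ⟨-, j, hj⟩
        · refine ⟨8 * j - 3, by omega, ?_⟩
          have h1 := mul_le_mul_of_nonneg_left (hj hm1).1 hp.le
          have h2 := mul_le_mul_of_nonneg_left (hj hm2).2 hp.le
          rw [window_eq] at h1 h2
          rw [mul_sub] at h1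
          rw [mul_add] at h2
          push_cast
          constructor <;> nlinarith
        · refine ⟨8 * j + 1, by omega, ?_⟩
          have h1 := mul_le_mul_of_nonneg_left (hj hm1).1 hp.le
          have h2 := mul_le_mul_of_nonneg_left (hj hm2).2 hp.le
          rw [window_eq] at h1 h2
          rw [mul_sub] at h1
          rw [mul_add] at h2
          push_cast
          constructor <;> nlinarith
      obtain ⟨s, hs, hs1, hs2⟩ := hend
      rcases Nat.eq_zero_or_pos L with hL0 | hL0
      · -- for `l = 2`, the parity of the end points decides
        rw [hL0] at hs1 hs2
        have h1 : s < 2 * (a : ℤ) - 1 := by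
          have : (s : ℝ) < ((2 * (a : ℤ) - 1 : ℤ) : ℝ) := by push_cast; linarith
          exact_mod_cast this
        have h2 : 2 * (a : ℤ) + 3 < s + 6 := by
          have : ((2 * (a : ℤ) + 3 : ℤ) : ℝ) < ((s + 6 : ℤ) : ℝ) := by push_cast; linarith
          exact_mod_cast this
        omega
      · have : (2 : ℝ) ≤ 2 ^ L := by
          calc (2 : ℝ) = 2 ^ 1 := by norm_num
            _ ≤ 2 ^ L := pow_le_pow_right₀ (by norm_num) hL0
        nlinarith
    refine ordConnected_cthickening_of_close fun x hx y hy => ?_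
    rw [abs_le]
    constructor <;> linarith [key x hx y hy, key y hy x hx]

/-- The inversion never returns a junk value: it takes place on a closed interval, on which the convolution
is injective. -/
lemma refEstimate_mem (hσ : 0 < σ) (e : Transcripts b → ℝ) :
    refEstimate σ b z e ∈ I2 σ b z ∨ refEstimate σ b z e = e z := by
  unfold refEstimate
  split_ifs with hA hB
  · left
    obtain ⟨hne, j, hj⟩ := id hA
    rw [window_eq] at hj
    refine (invert_window hσ (measurable_refine σ) (isStep_refine σ j) hne isClosed_I2
      (ordConnected_I2 (Or.inl hA)) (hj.trans (Icc_subset_Icc (le_of_eq ?_) (le_of_eq ?_))) _).1 <;>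
      ring
  · left
    obtain ⟨hne, j, hj⟩ := id hB
    rw [window_eq] at hj
    refine (invert_window hσ (measurable_conjRefine σ) (isStep_conjRefine σ j) hne isClosed_I2
      (ordConnected_I2 (Or.inr hB)) (hj.trans (Icc_subset_Icc (le_of_eq ?_) (le_of_eq ?_))) _).1 <;>
      ring
  · exact Or.inr rfl

/-- If `I_2` contains `θ` and is short, then the error is controlled by the refinement bits. -/
lemma refEstimate_error_of_mem (hσ : 0 < σ) (e : Transcripts b → ℝ) {θ : ℝ} (hθ : θ ∈ I2 σ b z)
    (hI : ∀ u ∈ I2 σ b z, ∀ v ∈ I2 σ b z, |u - v| ≤ 4 * fine σ) :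
    slope * |refEstimate σ b z e - θ| ≤ σ * (|meanV σ b z - conv σ (refine σ) θ| +
      |meanVbar σ b z - conv σ (conjRefine σ) θ|) := by
  have hδ := fine_pos σ
  have h0 := abs_nonneg (meanV σ b z - conv σ (refine σ) θ)
  have h0' := abs_nonneg (meanVbar σ b z - conv σ (conjRefine σ) θ)
  unfold refEstimate
  split_ifs with hA hB
  · obtain ⟨hne, j, hj⟩ := id hA
    rw [window_eq] at hj
    have h := (invert_window hσ (measurable_refine σ) (isStep_refine σ j) hne isClosed_I2
      (ordConnected_I2 (Or.inl hA))
      (hj.trans (Icc_subset_Icc (le_of_eq (by ring)) (le_of_eq (by ring)))) (meanV σ b z)).2 θ hθ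
    exact h.trans (mul_le_mul_of_nonneg_left (by linarith) hσ.le)
  · obtain ⟨hne, j, hj⟩ := id hB
    rw [window_eq] at hj
    have h := (invert_window hσ (measurable_conjRefine σ) (isStep_conjRefine σ j) hne isClosed_I2
      (ordConnected_I2 (Or.inr hB))
      (hj.trans (Icc_subset_Icc (le_of_eq (by ring)) (le_of_eq (by ring)))) (meanVbar σ b z)).2 θ hθ
    exact h.trans (mul_le_mul_of_nonneg_left (by linarith) hσ.le)
  · exfalso
    have hne : (I2 σ b z).Nonempty := ⟨θ, hθ⟩
    have h := exists_window (w := 8 * fine σ) (by linarith) hne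
      (fun u hu v hv => (hI u hu v hv).trans (by linarith))
    rw [← window_eq] at h
    exact h.elim (fun h => hA ⟨hne, h⟩) (fun h => hB ⟨hne, h⟩)

/-- All votes at which `θ` is far from a switch are correct. -/
def VotesGood (σ : ℝ) (b : Fin m → ℕ) (z : Transcripts b) (θ : ℝ) : Prop :=
  ∀ k, 1 ≤ k → k ≤ ll σ b →
    (∀ X, |X - θ| < fine σ → finer σ (ll σ b) k X = finer σ (ll σ b) k θ) →
    vote σ b z k = finer σ (ll σ b) k θ

lemma abs_refEstimate_sub_le_two (hσ : 0 < σ) {e : Transcripts b → ℝ} (he : e z ∈ I1 σ b z) {θ : ℝ}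
    (hθ : θ ∈ Icc (0 : ℝ) 1) (h3 : lev σ - ll σ b ≤ 3) : |refEstimate σ b z e - θ| ≤ 2 := by
  have hmem : refEstimate σ b z e ∈ Icc (-1 : ℝ) 2 := by
    rcases refEstimate_mem (z := z) hσ e with h | h
    · by_cases h4 : lev σ ≤ 4
      · rw [I2, if_pos ⟨h3, h4⟩] at h
        exact Icc_subset_Icc (by norm_num) (by norm_num) h
      · rw [I2_eq_cthickening (fun h => h4 h.2)] at h
        have hfine : fine σ ≤ 1 / 4 := by
          calc fine σ ≤ (2 : ℝ) ^ (-2 : ℤ) := zpow_le_zpow_right₀ one_le_two (by omega)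
            _ = 1 / 4 := by norm_num
        obtain ⟨x, hx, hux⟩ := exists_abs_sub_lt_of_mem_cthickening (fine_pos σ).le one_half_pos h
        rw [I2', if_pos h3, if_neg h4] at hx
        have hx01 := hx.1
        rw [abs_lt] at hux
        constructor <;> linarith [hx01.1, hx01.2]
    · rw [I1, if_pos h3] at he
      rw [h]
      exact Icc_subset_Icc (by norm_num) (by norm_num) he
  rw [abs_le]
  constructor <;> linarith [hmem.1, hmem.2, hθ.1, hθ.2]

/-- The cell of crude localization contains a point `q` whose distance from `θ` is at most the slip. -/
lemma crude_place_bounds (z : Transcripts b) {θ : ℝ} (hθ : θ ∈ Icc (0 : ℝ) 1) {κ : ℕ} (hκ2 : 2 ≤ κ) :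
    ∃ q : ℝ, |q - θ| ≤ slip θ (crudeBit b (special σ b) z) (κ - 1) ∧
      2 * (crudeCell σ b z κ : ℝ) ≤ 2 ^ κ * q ∧ 2 ^ κ * q ≤ 2 * crudeCell σ b z κ + 2 := by
  refine ⟨_, abs_place_cell_sub_le hθ _ _, ?_⟩
  have h := place_mem_Icc (κ - 1) (crudeCell σ b z κ) (tent_iterate_mem hθ (κ - 1))
  have hp : (0 : ℝ) < 2 ^ (κ - 1) := by positivity
  have hpow : (2 : ℝ) ^ κ = 2 * 2 ^ (κ - 1) := by rw [← pow_succ']; congr 1; omega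
  rw [mem_Icc, div_le_iff₀ hp, le_div_iff₀ hp] at h
  change 2 * (crudeCell σ b z κ : ℝ) ≤ 2 ^ κ * place (κ - 1) (crudeCell σ b z κ) _ ∧
    2 ^ κ * place (κ - 1) (crudeCell σ b z κ) _ ≤ _
  rw [hpow]
  constructor <;> linarith [h.1, h.2]

/-- A bound that holds for all votes, since the estimate never leaves a neighbourhood of `I_1`. -/
lemma abs_refEstimate_sub_le (hσ : 0 < σ) {e : Transcripts b → ℝ} (he : e z ∈ I1 σ b z) {θ : ℝ}
    (hθ : θ ∈ Icc (0 : ℝ) 1) {κ : ℕ} (hκ : lev σ = ll σ b + κ + 2) (hκ2 : 2 ≤ κ) :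
    |refEstimate σ b z e - θ| ≤ 5 * (2 ^ κ)⁻¹ + slip θ (crudeBit b (special σ b) z) (κ - 1) := by
  have h3 : ¬ lev σ - ll σ b ≤ 3 := by omega
  obtain ⟨q, hq, hq1, hq2⟩ := crude_place_bounds (σ := σ) z hθ hκ2
  set a := crudeCell σ b z κ
  have hp : (0 : ℝ) < 2 ^ κ := by positivity
  have hfine : (2 : ℝ) ^ κ * fine σ ≤ 2 := by
    rw [two_pow_mul_fine (k := ll σ b + 2) (by omega)]
    calc (2 : ℝ) ^ (3 - ((ll σ b : ℤ) + 2)) ≤ 2 ^ (1 : ℤ) :=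
          zpow_le_zpow_right₀ one_le_two (by omega)
      _ = 2 := by norm_num
  have hmem : 2 * (a : ℝ) - 3 ≤ 2 ^ κ * refEstimate σ b z e ∧
      2 ^ κ * refEstimate σ b z e ≤ 2 * a + 5 := by
    rcases refEstimate_mem (z := z) hσ e with h | h
    · rw [I2_eq_cthickening (fun h => h3 h.1)] at h
      have hlt : ∀ ε > 0, 2 * (a : ℝ) - 3 - ε ≤ 2 ^ κ * refEstimate σ b z e ∧
          2 ^ κ * refEstimate σ b z e ≤ 2 * a + 5 + ε := by
        intro ε hε
        obtain ⟨x, hx, hux⟩ := exists_abs_sub_lt_of_mem_cthickening (fine_pos σ).le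
          (div_pos hε hp) h
        obtain ⟨-, hx1, hx2⟩ := (mem_I1_iff hκ hκ2 x).1 ((mem_I2'_iff h3 x).1 hx).1
        have hux' := mul_lt_mul_of_pos_left hux hp
        rw [mul_add, mul_div_cancel₀ _ hp.ne', ← abs_of_pos hp, ← abs_mul, abs_of_pos hp,
          abs_lt, mul_sub] at hux'
        constructor <;> linarith [hux'.1, hux'.2]
      constructor
      · refine le_of_forall_pos_le_add fun ε hε => ?_
        linarith [(hlt ε hε).1]
      · exact le_of_forall_pos_le_add fun ε hε => (hlt ε hε).2
    · rw [h]
      obtain ⟨-, h1, h2⟩ := (mem_I1_iff hκ hκ2 _).1 he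
      constructor <;> linarith
  have htri := abs_sub_le (refEstimate σ b z e) q θ
  have h5 : |refEstimate σ b z e - q| ≤ 5 * (2 ^ κ)⁻¹ := by
    rw [← div_eq_mul_inv, le_div_iff₀ hp, ← abs_of_pos hp, ← abs_mul, sub_mul, abs_le]
    constructor <;> linarith [hmem.1, hmem.2]
  linarith

/-- The index of the vote for the Gray function number `r`. -/
lemma finer_voteIndex (h3 : lev σ - ll σ b ≤ 3) {r : ℕ} (hr1 : 1 ≤ r) (hr : (r : ℤ) ≤ lev σ - 4) :
    1 ≤ voteIndex σ b r ∧ voteIndex σ b r ≤ ll σ b ∧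
      finer σ (ll σ b) (voteIndex σ b r) = gray r := by
  unfold voteIndex
  split_ifs with h
  · refine ⟨le_rfl, by omega, ?_⟩
    rw [finer, if_pos rfl]
    congr 1; omega
  · refine ⟨by omega, by omega, ?_⟩
    rw [finer, if_neg (by omega), if_neg (by omega)]
    congr 1; omega

/-- Correct votes, for a noise level that makes the crude bits unnecessary. -/
lemma refEstimate_error_of_votes_of_le (hσ : 0 < σ) (e : Transcripts b → ℝ) {θ : ℝ}
    (hθ : θ ∈ Icc (0 : ℝ) 1) (h3 : lev σ - ll σ b ≤ 3) (hgood : VotesGood σ b z θ) :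
    slope * |refEstimate σ b z e - θ| ≤ σ * (|meanV σ b z - conv σ (refine σ) θ| +
      |meanVbar σ b z - conv σ (conjRefine σ) θ|) := by
  have hδ := fine_pos σ
  by_cases h4 : lev σ ≤ 4
  · have hI2 : I2 σ b z = Icc 0 1 := by rw [I2, if_pos ⟨h3, h4⟩]
    refine refEstimate_error_of_mem hσ e (by rw [hI2]; exact hθ) ?_
    rw [hI2]
    intro u hu v hv
    have hfine : 1 / 2 ≤ fine σ := by
      calc (1 / 2 : ℝ) = (2 : ℝ) ^ (-1 : ℤ) := by norm_num
        _ ≤ fine σ := zpow_le_zpow_right₀ one_le_two (by omega)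
    rw [abs_le]
    constructor <;> linarith [hu.1, hu.2, hv.1, hv.2]
  · have hI2 : I2 σ b z = Metric.cthickening (fine σ) (I2' σ b z) :=
      I2_eq_cthickening (fun h => h4 h.2)
    have hclose := I2'_close_of_le (z := z) h3 h4
    have hQ : lev σ = (lev σ - 4).toNat + 4 := by omega
    have hf := two_pow_mul_fine hQ
    have hI2' : I2' σ b z = dec (lev σ - 4).toNat (fun r => vote σ b z (voteIndex σ b r)) := by
      rw [I2', if_pos h3, if_neg h4]
    set Q := (lev σ - 4).toNat with hQdef
    obtain ⟨x, hx01, hxθ, hx⟩ := exists_consistent (ι := {r : ℕ // 1 ≤ r ∧ r ≤ Q}) (Q := Q)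
      (f := fun r => gray (r : ℕ)) (F := fun r => grayCell Q r)
      (fun r x hx => gray_eq_grayCell hx r.2.2) (fun r x => gray_trunc _ x)
      (by
        rintro a ⟨k, hk1, hk⟩ ⟨k', hk1', hk'⟩ h h'
        obtain ⟨d, n⟩ := grayCell_switch h
        obtain ⟨d', n'⟩ := grayCell_switch h'
        dsimp only at d n d' n'
        rcases lt_trichotomy k k' with hlt | heq | hgt
        · exact absurd ((pow_dvd_pow 2 (by omega)).trans d) n'
        · exact Subtype.ext heq
        · exact absurd ((pow_dvd_pow 2 (by omega)).trans d') n)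
      hθ (d := fine σ) (by rw [hf]; norm_num) (fun r => vote σ b z (voteIndex σ b r))
      (by
        rintro ⟨r, hr1, hr⟩ hrel
        obtain ⟨i1, i2, i3⟩ := finer_voteIndex (b := b) h3 hr1 (by omega : (r : ℤ) ≤ lev σ - 4)
        have := hgood _ i1 i2 (by rw [i3]; exact hrel)
        rw [i3] at this
        exact this)
    have hxI : x ∈ I2' σ b z := by
      rw [hI2']
      exact ⟨hx01, fun r h1 h2 => hx ⟨r, h1, h2⟩⟩
    refine refEstimate_error_of_mem hσ e ?_ ?_
    · rw [hI2]
      exact Metric.mem_cthickening_of_dist_le θ x _ _ hxI (by rwa [Real.dist_eq, abs_sub_comm])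
    · rw [hI2]
      intro u hu v hv
      have := abs_sub_le_of_mem_cthickening hδ.le hclose hu hv
      linarith

/-- Correct votes, after a successful crude localization. -/
lemma refEstimate_error_of_votes (hσ : 0 < σ) (e : Transcripts b → ℝ) {θ : ℝ}
    (hθ : θ ∈ Icc (0 : ℝ) 1) {κ : ℕ} (hκ : lev σ = ll σ b + κ + 2) (hκ2 : 2 ≤ κ) (hl : 3 ≤ ll σ b)
    (hslip : slip θ (crudeBit b (special σ b) z) (κ - 1) ≤ 1 / 8 * (2 ^ κ)⁻¹)
    (hgood : VotesGood σ b z θ) :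
    slope * |refEstimate σ b z e - θ| ≤ σ * (|meanV σ b z - conv σ (refine σ) θ| +
      |meanVbar σ b z - conv σ (conjRefine σ) θ|) := by
  have hδ := fine_pos σ
  have h3 : ¬ lev σ - ll σ b ≤ 3 := by omega
  have hI2 : I2 σ b z = Metric.cthickening (fine σ) (I2' σ b z) :=
    I2_eq_cthickening (fun h => h3 h.1)
  obtain ⟨Q, hQ⟩ : ∃ Q, Q = κ + ll σ b - 2 := ⟨_, rfl⟩
  have hf : (2 : ℝ) ^ Q * fine σ = 1 / 2 := by
    rw [two_pow_mul_fine (k := 4) (by omega)]; norm_num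
  have hfκ : (2 : ℝ) ^ κ * fine σ ≤ 1 / 4 := by
    rw [two_pow_mul_fine (k := ll σ b + 2) (by omega)]
    calc (2 : ℝ) ^ (3 - ((ll σ b : ℤ) + 2)) ≤ 2 ^ (-2 : ℤ) :=
          zpow_le_zpow_right₀ one_le_two (by omega)
      _ = 1 / 4 := by norm_num
  have hp : (0 : ℝ) < 2 ^ Q := by positivity
  have hpκ : (0 : ℝ) < 2 ^ κ := by positivity
  obtain ⟨x, hx01, hxθ, hx⟩ := exists_consistent (ι := {k : ℕ // 1 ≤ k ∧ k ≤ ll σ b}) (Q := Q)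
    (f := fun k => finer σ (ll σ b) k) (F := fun k => finerCell Q κ k)
    (fun k x hx => finer_eq_finerCell hκ k.2.1 k.2.2 (by omega) hQ hx)
    (fun k x => finer_trunc _ _ x)
    (fun a k k' h h' => Subtype.ext (finerCell_switch_unique hQ k.2.1 k.2.2 k'.2.1 k'.2.2
      (by omega) h h'))
    hθ hf (fun k => vote σ b z k) (fun k hrel => hgood k k.2.1 k.2.2 hrel)
  obtain ⟨q, hq, hq1, hq2⟩ := crude_place_bounds (σ := σ) z hθ hκ2
  set a := crudeCell σ b z κ with ha
  -- the consistent point is far from both ends of `I_1`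
  have hxa : 2 * (a : ℝ) - 3 / 8 ≤ 2 ^ κ * x ∧ 2 ^ κ * x ≤ 2 * a + 2 + 3 / 8 := by
    have h1 : |q - θ| ≤ 1 / 8 * (2 ^ κ)⁻¹ := hq.trans hslip
    rw [← div_eq_mul_inv, le_div_iff₀ hpκ, ← abs_of_pos hpκ, ← abs_mul, abs_le] at h1
    have h2 := mul_le_mul_of_nonneg_left hxθ hpκ.le
    rw [← abs_of_pos hpκ, ← abs_mul, abs_of_pos hpκ, abs_le] at h2
    constructor <;> nlinarith [h1.1, h1.2, h2.1, h2.2]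
  have hxI : x ∈ I2' σ b z := by
    rw [mem_I2'_iff h3, mem_I1_iff hκ hκ2]
    exact ⟨⟨hx01, by linarith [hxa.1], by linarith [hxa.2]⟩, fun k h1 h2 => hx ⟨k, h1, h2⟩⟩
  have hL : (2 : ℝ) ≤ 2 ^ (ll σ b - 2) := by
    calc (2 : ℝ) = 2 ^ 1 := by norm_num
      _ ≤ 2 ^ (ll σ b - 2) := pow_le_pow_right₀ (by norm_num) (by omega)
  have hpQ : (2 : ℝ) ^ Q = 2 ^ (ll σ b - 2) * 2 ^ κ := by rw [← pow_add]; congr 1; omega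
  have hnear : ∀ u ∈ I2' σ b z, |u - x| ≤ 2 * fine σ := by
    intro u hu
    by_contra hcon
    push Not at hcon
    rcases le_total x u with h | h
    · rw [abs_of_nonneg (by linarith)] at hcon
      obtain ⟨h1, -⟩ := I2'_far hκ hκ2 (by omega) hQ hxI hu hcon
      have h2 := Int.lt_floor_add_one ((2 : ℝ) ^ Q * x)
      rw [h1] at h2
      push_cast at h2
      rw [hpQ, mul_assoc] at h2
      nlinarith [hxa.1]
    · rw [abs_of_nonpos (by linarith), neg_sub] at hcon
      obtain ⟨-, h1⟩ := I2'_far hκ hκ2 (by omega) hQ hu hxI hcon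
      rw [hpQ, mul_assoc] at h1
      have := mul_left_cancel₀ (by positivity) h1
      linarith [hxa.2]
  have hclose' : ∀ u ∈ I2' σ b z, ∀ v ∈ I2' σ b z, v - u ≤ 2 * fine σ := by
    intro u hu v hv
    by_contra hcon
    push Not at hcon
    obtain ⟨h1, h2⟩ := I2'_far hκ hκ2 (by omega) hQ hu hv hcon
    have h3 := Int.lt_floor_add_one ((2 : ℝ) ^ Q * u)
    rw [h1] at h3
    push_cast at h3
    have h4 : 7 ≤ (2 : ℝ) ^ Q * (v - u) := by nlinarith
    have h5 : v - u ≤ 4 * fine σ := by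
      have := hnear u hu; have := hnear v hv
      rw [abs_le] at *
      linarith
    nlinarith
  have hclose : ∀ u ∈ I2' σ b z, ∀ v ∈ I2' σ b z, |u - v| ≤ 2 * fine σ := by
    intro u hu v hv
    rw [abs_le]
    constructor <;> linarith [hclose' u hu v hv, hclose' v hv u hu]
  refine refEstimate_error_of_mem hσ e ?_ ?_
  · rw [hI2]
    exact Metric.mem_cthickening_of_dist_le θ x _ _ hxI (by rwa [Real.dist_eq, abs_sub_comm])
  · rw [hI2]
    intro u hu v hv
    have := abs_sub_le_of_mem_cthickening hδ.le hclose hu hv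
    linarith

end Estimate

/-! ### The number of refinement bits -/

lemma sq_le_two_mul_two_pow (l : ℕ) : l ^ 2 ≤ 2 * 2 ^ l := by
  induction l with
  | zero => norm_num
  | succ l ih => have := Nat.lt_two_pow_self (n := l); rw [pow_succ 2]; nlinarith

lemma numRef_spec {σ : ℝ} {B : ℕ} (h : 2 ≤ (B : ℤ) - lev σ) :
    1 ≤ numRef σ B ∧
      ((Nat.log 2 (numRef σ B) ^ 2 + 2 * numRef σ B : ℕ) : ℤ) ≤ (B : ℤ) - lev σ ∧
      (B : ℤ) - lev σ ≤ 8 * numRef σ B := by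
  set S := {s : ℕ | (((Nat.log 2 s) ^ 2 + 2 * s : ℕ) : ℤ) ≤ (B : ℤ) - lev σ} with hS
  have hbdd : BddAbove S := by
    refine ⟨((B : ℤ) - lev σ).toNat, fun s hs => ?_⟩
    have hs : ((Nat.log 2 s ^ 2 + 2 * s : ℕ) : ℤ) ≤ (B : ℤ) - lev σ := hs
    omega
  have h1 : 1 ∈ S := by
    change ((Nat.log 2 1 ^ 2 + 2 * 1 : ℕ) : ℤ) ≤ (B : ℤ) - lev σ
    simpa using h
  have hmem : numRef σ B ∈ S := Nat.sSup_mem ⟨1, h1⟩ hbdd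
  refine ⟨le_csSup hbdd h1, hmem, ?_⟩
  have hnot : numRef σ B + 1 ∉ S := fun hs => by
    have : numRef σ B + 1 ≤ numRef σ B := le_csSup hbdd hs
    omega
  have hlt : (B : ℤ) - lev σ <
      ((Nat.log 2 (numRef σ B + 1) ^ 2 + 2 * (numRef σ B + 1) : ℕ) : ℤ) := not_le.1 hnot
  have h2 := sq_le_two_mul_two_pow (Nat.log 2 (numRef σ B + 1))
  have h3 : 2 ^ Nat.log 2 (numRef σ B + 1) ≤ numRef σ B + 1 := Nat.pow_log_le_self 2 (by omega)
  have h4 : 1 ≤ numRef σ B := le_csSup hbdd h1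
  omega

/-! ### The transcripts of the refinement protocol -/

/-- The machines number `a, …, a + n - 1`. -/
def block (m a n : ℕ) (h : a + n ≤ m) : Finset (Fin m) :=
  Finset.univ.map ⟨fun j : Fin n => ⟨a + j, by omega⟩, fun i j hij => by
    simpa [Fin.ext_iff] using hij⟩

lemma card_block {m a n : ℕ} (h : a + n ≤ m) : (block m a n h).card = n := by simp [block]

lemma sum_block {M : Type*} [AddCommMonoid M] {m a n : ℕ} (h : a + n ≤ m) {f : Fin m → M} {g : ℕ → M}
    (hfg : ∀ (i : Fin m), a ≤ i → (i : ℕ) < a + n → g i = f i) :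
    ∑ j ∈ Finset.range n, g (a + j) = ∑ i ∈ block m a n h, f i := by
  rw [block, Finset.sum_map, Finset.sum_range]
  refine Finset.sum_congr rfl fun j _ => ?_
  exact hfg ⟨a + j, by omega⟩ (Nat.le_add_right a j) (Nat.add_lt_add_left j.2 a)

section Transcript

variable {m : ℕ} {σ : ℝ} {b : Fin m → ℕ}

lemma refEncode_crude (x : Fin m → ℝ) (i : Fin m) (t : Fin (b i))
    (ht : (t : ℕ) < crudeCount b (special σ b) i) :
    refEncode σ b i (x i) t = gray ((offset b (special σ b) i + t + 1 : ℕ) : ℤ) (x i) := by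
  rw [refEncode, if_neg]
  rintro ⟨h1, h2⟩
  rw [crudeCount, if_pos h1] at ht
  omega

lemma lastBit_refEncode (hb : ∀ i, 1 ≤ b i) (x : Fin m → ℝ) (i : Fin m)
    (hi : (i : ℕ) < special σ b) :
    lastBit b (fun i => refEncode σ b i (x i)) i =
      if (i : ℕ) < ll σ b ^ 2 then finer σ (ll σ b) ((i : ℕ) / ll σ b + 1) (x i)
      else if (i : ℕ) < ll σ b ^ 2 + nn σ b then refine σ (x i)
      else conjRefine σ (x i) := by
  rw [lastBit_eq hb, refEncode, if_pos ⟨hi, by have := hb i; simp; omega⟩]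

lemma meanV_refEncode (hb : ∀ i, 1 ≤ b i)
    (h : ll σ b ^ 2 + nn σ b ≤ m) (x : Fin m → ℝ) :
    meanV σ b (fun i => refEncode σ b i (x i)) = 1 / (nn σ b : ℝ) *
      ∑ i ∈ block m (ll σ b ^ 2) (nn σ b) h, bit (refine σ (x i)) := by
  rw [meanV, sum_block h (f := fun i => bit (refine σ (x i)))
    (g := fun p => bit (lastBit b (fun i => refEncode σ b i (x i)) p))]
  intro i h1 h2
  rw [lastBit_refEncode hb x i (by unfold special; omega), if_neg (by omega), if_pos h2]

lemma meanVbar_refEncode (hb : ∀ i, 1 ≤ b i)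
    (h : ll σ b ^ 2 + nn σ b + nn σ b ≤ m) (x : Fin m → ℝ) :
    meanVbar σ b (fun i => refEncode σ b i (x i)) = 1 / (nn σ b : ℝ) *
      ∑ i ∈ block m (ll σ b ^ 2 + nn σ b) (nn σ b) h, bit (conjRefine σ (x i)) := by
  rw [meanVbar, sum_block h (f := fun i => bit (conjRefine σ (x i)))
    (g := fun p => bit (lastBit b (fun i => refEncode σ b i (x i)) p))]
  intro i h1 h2
  rw [lastBit_refEncode hb x i (by unfold special; omega), if_neg (by omega), if_neg (by omega)]

lemma mul_add_le_sq {k l : ℕ} (h1 : 1 ≤ k) (hk : k ≤ l) : (k - 1) * l + l ≤ l ^ 2 := by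
  obtain ⟨k, rfl⟩ := Nat.exists_eq_add_of_le' h1
  rw [Nat.add_sub_cancel]
  nlinarith

/-- If a vote is wrong, then so are at least half of its bits. -/
lemma card_le_of_vote_ne (hb : ∀ i, 1 ≤ b i) {k : ℕ} (h1 : 1 ≤ k)
    (hk : k ≤ ll σ b) (h : (k - 1) * ll σ b + ll σ b ≤ m) (x : Fin m → ℝ) {θ : ℝ}
    (hne : vote σ b (fun i => refEncode σ b i (x i)) k ≠ finer σ (ll σ b) k θ) :
    ll σ b ≤ 2 * ∑ i ∈ block m ((k - 1) * ll σ b) (ll σ b) h,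
      {X | finer σ (ll σ b) k X ≠ finer σ (ll σ b) k θ}.indicator (1 : ℝ → ℕ) (x i) := by
  set l := ll σ b with hl
  have hsp : special σ b = l ^ 2 + 2 * nn σ b := rfl
  have hl2 := mul_add_le_sq h1 hk
  have hsum : ∑ j ∈ Finset.range l, bit (lastBit b (fun i => refEncode σ b i (x i))
      ((k - 1) * l + j)) = ∑ i ∈ block m ((k - 1) * l) l h, bit (finer σ l k (x i)) := by
    rw [sum_block h (f := fun i => bit (finer σ l k (x i)))
      (g := fun p => bit (lastBit b (fun i => refEncode σ b i (x i)) p))]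
    intro i hi1 hi2
    have hdiv : (i : ℕ) / l + 1 = k := by
      have : (i : ℕ) / l = k - 1 :=
        Nat.div_eq_of_lt_le hi1 (by rw [Nat.add_mul, one_mul]; exact hi2)
      omega
    rw [lastBit_refEncode hb x i (by omega), ← hl, if_pos (by omega), hdiv]
  rw [vote, ← hl, hsum] at hne
  set s := block m ((k - 1) * l) l h with hs
  have hcard : ∑ i ∈ s, (1 : ℝ) = l := by
    rw [Finset.sum_const, hs, card_block]; simp
  suffices hR : (l : ℝ) ≤ 2 * ∑ i ∈ s,
      {X | finer σ l k X ≠ finer σ l k θ}.indicator (1 : ℝ → ℝ) (x i) by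
    have hcast : (((2 * ∑ i ∈ s, {X | finer σ l k X ≠ finer σ l k θ}.indicator
        (1 : ℝ → ℕ) (x i) : ℕ)) : ℝ) = 2 * ∑ i ∈ s,
        {X | finer σ l k X ≠ finer σ l k θ}.indicator (1 : ℝ → ℝ) (x i) := by
      push_cast
      congr 1
      refine Finset.sum_congr rfl fun i _ => ?_
      simp only [indicator_apply]
      split_ifs <;> simp
    rw [← hcast] at hR
    exact_mod_cast hR
  cases hθ : finer σ l k θ
  · rw [hθ, Ne, decide_eq_false_iff_not, not_not] at hne
    have : ∀ i ∈ s, bit (finer σ l k (x i)) =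
        {X | finer σ l k X ≠ false}.indicator (1 : ℝ → ℝ) (x i) := by
      intro i _
      simp only [indicator_apply, mem_ofPred_eq, Pi.one_apply]
      cases finer σ l k (x i) <;> simp [bit]
    rw [Finset.sum_congr rfl this] at hne
    linarith
  · rw [hθ, Ne, decide_eq_true_iff, not_le] at hne
    have : ∀ i ∈ s, bit (finer σ l k (x i)) =
        1 - {X | finer σ l k X ≠ true}.indicator (1 : ℝ → ℝ) (x i) := by
      intro i _
      simp only [indicator_apply, mem_ofPred_eq, Pi.one_apply]
      cases finer σ l k (x i) <;> simp [bit]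
    rw [Finset.sum_congr rfl this, Finset.sum_sub_distrib, hcard] at hne
    linarith

/-- The votes are good, except with a probability that is exponentially small in `l`. -/
lemma measure_not_votesGood_le (hb : ∀ i, 1 ≤ b i) (hσ : 0 < σ) (hq : special σ b ≤ m) (θ : ℝ) :
    Measure.pi (fun _ : Fin m => normal θ σ)
      {x | ¬ VotesGood σ b (fun i => refEncode σ b i (x i)) θ} ≤
    ENNReal.ofReal (ll σ b * (1 / 16) ^ ll σ b) := by
  classical
  set l := ll σ b with hl
  set bad : ℕ → Set (Fin m → ℝ) := fun k => {x |
    (∀ X, |X - θ| < fine σ → finer σ l k X = finer σ l k θ) ∧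
      vote σ b (fun i => refEncode σ b i (x i)) k ≠ finer σ l k θ} with hbad
  have hsub : {x | ¬ VotesGood σ b (fun i => refEncode σ b i (x i)) θ} ⊆
      ⋃ k ∈ Finset.Icc 1 l, bad k := by
    intro x hx
    simp only [mem_ofPred_eq, VotesGood] at hx
    push Not at hx
    obtain ⟨k, h1, h2, h3, h4⟩ := hx
    simp only [mem_iUnion, Finset.mem_Icc]
    exact ⟨k, ⟨h1, h2⟩, h3, h4⟩
  have hone : ∀ k ∈ Finset.Icc 1 l, Measure.pi (fun _ : Fin m => normal θ σ) (bad k) ≤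
      ENNReal.ofReal ((1 / 16) ^ l) := by
    intro k hk
    obtain ⟨h1, h2⟩ := Finset.mem_Icc.1 hk
    by_cases hrel : ∀ X, |X - θ| < fine σ → finer σ l k X = finer σ l k θ
    · have hle : (k - 1) * l + l ≤ m := by
        have := mul_add_le_sq h1 h2
        have hsp : special σ b = l ^ 2 + 2 * nn σ b := rfl
        omega
      have hA : MeasurableSet {X | finer σ l k X ≠ finer σ l k θ} :=
        measurable_finer σ l k (MeasurableSet.of_discrete (s := {v | v ≠ finer σ l k θ}))
      have hp : normal θ σ {X | finer σ l k X ≠ finer σ l k θ} ≤ ENNReal.ofReal (1 / 1024) := by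
        refine (measure_mono fun X hX => ?_).trans
          ((normal_abs_sub_ge_le θ hσ (fine_pos σ)).trans (ENNReal.ofReal_le_ofReal ?_))
        · exact not_lt.1 fun h => hX (hrel X h)
        · have h8 : σ / fine σ ≤ 1 / 8 := by
            rw [div_le_iff₀ (fine_pos σ)]; linarith [(fine_bounds hσ).1]
          calc 768 * (σ / fine σ) ^ 8 ≤ 768 * (1 / 8) ^ 8 := by
                have := (div_pos hσ (fine_pos σ)).le
                gcongr
            _ ≤ _ := by norm_num
      have := measure_majority_le (normal θ σ) hA hp (block m ((k - 1) * l) l hle) _ (fun x => rfl)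
      rw [card_block] at this
      exact (measure_mono fun x hx => card_le_of_vote_ne hb h1 h2 hle x hx.2).trans this
    · have : bad k = ∅ := by
        ext x
        simp only [hbad, mem_ofPred_eq, mem_empty_iff_false, iff_false, not_and]
        exact fun h => absurd h hrel
      rw [this, measure_empty]
      exact zero_le
  calc _ ≤ _ := measure_mono hsub
    _ ≤ ∑ k ∈ Finset.Icc 1 l, Measure.pi (fun _ : Fin m => normal θ σ) (bad k) :=
        measure_biUnion_finset_le _ _
    _ ≤ ∑ k ∈ Finset.Icc 1 l, ENNReal.ofReal ((1 / 16) ^ l) := Finset.sum_le_sum hone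
    _ = _ := by
        rw [Finset.sum_const, Nat.card_Icc, Nat.add_sub_cancel, nsmul_eq_mul,
          ENNReal.ofReal_mul (by positivity), ENNReal.ofReal_natCast]

end Transcript

lemma measurable_slip {m : ℕ} (θ : ℝ) (i : ℕ → Fin m) (K : ℕ) :
    Measurable fun x : Fin m → ℝ => slip θ (fun k => gray k (x (i k))) K := by
  unfold slip
  refine Finset.measurable_sum _ fun k _ => ?_
  refine Measurable.ite ?_ measurable_const measurable_const
  exact ((measurable_gray _).comp (measurable_pi_apply _))
    (MeasurableSet.of_discrete (s := {v | v = gray ((k + 1 : ℕ) : ℤ) θ}))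

lemma slip_nonneg (θ : ℝ) (y : ℕ → Bool) (K : ℕ) : 0 ≤ slip θ y K :=
  Finset.sum_nonneg fun k _ => by
    split_ifs
    · exact le_rfl
    · linarith [gap_nonneg k θ]

/-- Termwise integration of a bound. The estimate and the event `bad` need not be measurable, since only
upper bounds are used. -/
lemma lintegral_le_of_le_sum {α : Type*} [MeasurableSpace α] {μ : Measure α} [IsProbabilityMeasure μ]
    {F : α → ℝ≥0∞} {f g h : α → ℝ} {bad : Set α} {a₀ a₁ a₂ a₃ v s p : ℝ}
    (hf : Measurable f) (hg : Measurable g) (hh : Measurable h)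
    (hf0 : ∀ x, 0 ≤ f x) (hg0 : ∀ x, 0 ≤ g x) (hh0 : ∀ x, 0 ≤ h x)
    (h0 : 0 ≤ a₀) (h1 : 0 ≤ a₁) (h2 : 0 ≤ a₂) (h3 : 0 ≤ a₃) (hv : 0 ≤ v) (hs : 0 ≤ s) (hp : 0 ≤ p)
    (hF : ∀ x, F x ≤ ENNReal.ofReal
      (a₀ + a₁ * f x + a₁ * g x + a₂ * h x + bad.indicator (fun _ => a₃) x))
    (hfv : ∫⁻ x, ENNReal.ofReal (f x) ∂μ ≤ ENNReal.ofReal v)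
    (hgv : ∫⁻ x, ENNReal.ofReal (g x) ∂μ ≤ ENNReal.ofReal v)
    (hhs : ∫⁻ x, ENNReal.ofReal (h x) ∂μ ≤ ENNReal.ofReal s)
    (hbad : μ bad ≤ ENNReal.ofReal p) :
    ∫⁻ x, F x ∂μ ≤ ENNReal.ofReal (a₀ + a₁ * v + a₁ * v + a₂ * s + a₃ * p) := by
  have hind : ∀ x, 0 ≤ bad.indicator (fun _ => a₃) x := fun x => indicator_nonneg (fun _ _ => h3) x
  have e : ∀ x, ENNReal.ofReal
      (a₀ + a₁ * f x + a₁ * g x + a₂ * h x + bad.indicator (fun _ => a₃) x) =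
      ENNReal.ofReal a₀ + ENNReal.ofReal a₁ * ENNReal.ofReal (f x) +
        ENNReal.ofReal a₁ * ENNReal.ofReal (g x) + ENNReal.ofReal a₂ * ENNReal.ofReal (h x) +
        bad.indicator (fun _ => ENNReal.ofReal a₃) x := by
    intro x
    have i1 := mul_nonneg h1 (hf0 x)
    have i2 := mul_nonneg h1 (hg0 x)
    have i3 := mul_nonneg h2 (hh0 x)
    have i4 := hind x
    rw [ENNReal.ofReal_add (by positivity) i4, ENNReal.ofReal_add (by positivity) i3,
      ENNReal.ofReal_add (by positivity) i2, ENNReal.ofReal_add h0 i1, ENNReal.ofReal_mul h1,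
      ENNReal.ofReal_mul h1, ENNReal.ofReal_mul h2]
    congr 1
    classical
    rw [indicator_apply, indicator_apply]
    split_ifs <;> simp
  calc _ ≤ _ := lintegral_mono hF
    _ ≤ ENNReal.ofReal a₀ + ENNReal.ofReal a₁ * ENNReal.ofReal v +
        ENNReal.ofReal a₁ * ENNReal.ofReal v + ENNReal.ofReal a₂ * ENNReal.ofReal s +
        ENNReal.ofReal a₃ * ENNReal.ofReal p := by
      simp only [e]
      rw [lintegral_add_left (by fun_prop), lintegral_add_left (by fun_prop),
        lintegral_add_left (by fun_prop), lintegral_add_left (by fun_prop),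
        lintegral_const_mul _ (by fun_prop), lintegral_const_mul _ (by fun_prop),
        lintegral_const_mul _ (by fun_prop), lintegral_const, measure_univ, mul_one]
      gcongr
      exact (lintegral_indicator_const_le _ _).trans (by gcongr)
    _ = _ := by
      rw [← ENNReal.ofReal_mul h1, ← ENNReal.ofReal_mul h2, ← ENNReal.ofReal_mul h3,
        ← ENNReal.ofReal_add h0 (by positivity), ← ENNReal.ofReal_add (by positivity) (by positivity),
        ← ENNReal.ofReal_add (by positivity) (by positivity),
        ← ENNReal.ofReal_add (by positivity) (by positivity)]

/-! ### The risk of localization and refinement -/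

lemma sq_le_of_mul_abs_le {s E σ v w : ℝ} (hs : 0 < s)
    (h : s * |E| ≤ σ * (|v| + |w|)) :
    E ^ 2 ≤ 2 * σ ^ 2 / s ^ 2 * v ^ 2 + 2 * σ ^ 2 / s ^ 2 * w ^ 2 := by
  have h1 : (s * |E|) ^ 2 ≤ (σ * (|v| + |w|)) ^ 2 := pow_le_pow_left₀ (by positivity) h 2
  have h2 : (|v| + |w|) ^ 2 ≤ 2 * v ^ 2 + 2 * w ^ 2 := by
    nlinarith [sq_nonneg (|v| - |w|), sq_abs v, sq_abs w]
  have h3 := mul_le_mul_of_nonneg_left h2 (sq_nonneg σ)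
  rw [mul_pow, mul_pow, sq_abs] at h1
  rw [← mul_add, div_mul_eq_mul_div, le_div_iff₀ (by positivity)]
  linarith

/-- The tail `l · 16⁻ˡ` of the votes compensates for an error of the order `2ˡ σ`. -/
lemma sq_mul_vote_tail_le {σ L n : ℝ} {l : ℕ} (hL : L = 2 ^ l) (hn : 0 < n) (hnL : n ≤ 2 * L) :
    (L * σ) ^ 2 * (l * (1 / 16) ^ l) ≤ 2 * (σ ^ 2 / n) := by
  have hL0 : 0 < L := by rw [hL]; positivity
  have h16 : ((1 : ℝ) / 16) ^ l = 1 / L ^ 4 := by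
    rw [hL, ← pow_mul, mul_comm l 4, pow_mul, ← one_div_pow]; norm_num
  have hl : (l : ℝ) ≤ L := by
    rw [hL]; exact_mod_cast (Nat.lt_two_pow_self (n := l)).le
  have hL1 : 1 ≤ L := by rw [hL]; exact one_le_pow₀ one_le_two
  have e : (L * σ) ^ 2 * (l * (1 / 16) ^ l) = σ ^ 2 * (l / L ^ 2) := by
    rw [h16]; field_simp
  have h1 : l / L ^ 2 ≤ 2 / n := by
    rw [div_le_div_iff₀ (by positivity) hn]
    nlinarith [mul_le_mul hl hnL hn.le hL0.le]
  rw [e]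
  calc σ ^ 2 * (l / L ^ 2) ≤ σ ^ 2 * (2 / n) := by gcongr
    _ = _ := by ring

/-- For `l ≤ 2`, that is `n ≤ 7`, an error of the order `c` of one crude cell is affordable. -/
lemma crude_error_le {σ c : ℝ} {l n : ℕ} (hσ : 0 < σ) (hn : 1 ≤ n) (hnl : n < 2 ^ (l + 1))
    (hc0 : 0 < c) (hc : c ≤ 8 * (2 ^ l * σ)) :
    (if l ≤ 2 then 52 * c ^ 2 else 0) ≤ 372736 * (σ ^ 2 / n) := by
  have hn0 : (0 : ℝ) < n := by exact_mod_cast hn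
  split_ifs with hl
  · have hn7 : (n : ℝ) ≤ 7 := by
      have h2 : 2 ^ (l + 1) ≤ 2 ^ 3 := Nat.pow_le_pow_right (by norm_num) (by omega)
      exact_mod_cast (by omega : n ≤ 7)
    have hL4 : (2 : ℝ) ^ l ≤ 4 := by
      calc (2 : ℝ) ^ l ≤ 2 ^ 2 := pow_le_pow_right₀ one_le_two hl
        _ = 4 := by norm_num
    have h1 : c ^ 2 ≤ (32 * σ) ^ 2 := pow_le_pow_left₀ hc0.le (by nlinarith) 2
    have h2 : σ ^ 2 ≤ 7 * (σ ^ 2 / n) := by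
      rw [← mul_div_assoc, le_div_iff₀ hn0]
      nlinarith [sq_nonneg σ]
    linarith
  · positivity

/-- The fourth moment `σ⁴` of the slip, divided by `c²`, gains a factor `4⁻ˡ` over `σ²`. -/
lemma slip_error_le {σ c L n P : ℝ} {l : ℕ} (hσ : 0 < σ) (hn : 0 < n) (hL : L = 2 ^ l)
    (hnL : n ≤ 2 * L) (hc : 4 * (L * σ) ≤ c) (hP0 : 0 ≤ P) (hP : σ * P ≤ 1) :
    107584 / c ^ 2 * (12288 * (σ + 4 * σ ^ 2 * P) ^ 4) ≤
      107584 * 12288 * 625 / 8 * (σ ^ 2 / n) := by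
  have hL1 : 1 ≤ L := by rw [hL]; exact one_le_pow₀ one_le_two
  have h3 : (σ + 4 * σ ^ 2 * P) ^ 4 ≤ (5 * σ) ^ 4 :=
    pow_le_pow_left₀ (by positivity) (by nlinarith) 4
  have h4 : (4 * (L * σ)) ^ 2 ≤ c ^ 2 := pow_le_pow_left₀ (by positivity) hc 2
  have h4' : 0 < (4 * (L * σ)) ^ 2 := by positivity
  have h5 : 1 / L ^ 2 ≤ 2 / n := by
    rw [div_le_div_iff₀ (by positivity) hn]
    nlinarith
  have h6 : 107584 / c ^ 2 ≤ 107584 / (4 * (L * σ)) ^ 2 :=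
    div_le_div_of_nonneg_left (by norm_num) h4' h4
  have e : 107584 / (4 * (L * σ)) ^ 2 * (12288 * (5 * σ) ^ 4) =
      107584 * 12288 * 625 / 16 * (σ ^ 2 * (1 / L ^ 2)) := by
    rw [mul_pow, mul_pow L, mul_pow 5]
    field_simp
    norm_num
  calc _ ≤ 107584 / (4 * (L * σ)) ^ 2 * (12288 * (5 * σ) ^ 4) :=
        mul_le_mul h6 (mul_le_mul_of_nonneg_left h3 (by norm_num)) (by positivity) (by positivity)
    _ = _ := e
    _ ≤ 107584 * 12288 * 625 / 16 * (σ ^ 2 * (2 / n)) := by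
        have := mul_le_mul_of_nonneg_left h5 (sq_nonneg σ)
        linarith
    _ = _ := by ring

section Risk

variable {m : ℕ} {σ : ℝ} {b : Fin m → ℕ}

lemma two_pow_ll_bounds (hn : 1 ≤ nn σ b) :
    (2 : ℝ) ^ ll σ b ≤ nn σ b ∧ (nn σ b : ℝ) ≤ 2 * 2 ^ ll σ b := by
  constructor
  · exact_mod_cast Nat.pow_log_le_self 2 (by omega : nn σ b ≠ 0)
  · have : nn σ b < 2 ^ (ll σ b + 1) := Nat.lt_pow_succ_log_self one_lt_two _
    rw [pow_succ'] at this
    exact_mod_cast this.le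

lemma lintegral_meanV_le (hb : ∀ i, 1 ≤ b i) (hn : 1 ≤ nn σ b) (hq : special σ b ≤ m) (θ : ℝ) :
    Measurable (fun x : Fin m → ℝ => meanV σ b (fun i => refEncode σ b i (x i))) ∧
    ∫⁻ x, ENNReal.ofReal ((meanV σ b (fun i => refEncode σ b i (x i)) -
      conv σ (refine σ) θ) ^ 2) ∂(Measure.pi fun _ : Fin m => normal θ σ) ≤
      ENNReal.ofReal (1 / nn σ b) := by
  have hsp : special σ b = ll σ b ^ 2 + 2 * nn σ b := rfl
  have h : ll σ b ^ 2 + nn σ b ≤ m := by omega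
  have hg : Measurable fun u => bit (refine σ u) := measurable_bit.comp (measurable_refine σ)
  simp only [meanV_refEncode hb h]
  constructor
  · exact (Finset.measurable_sum _ fun i _ => hg.comp (measurable_pi_apply i)).const_mul _
  · have := lintegral_mean_sub_sq_le (normal θ σ) hg (fun u => bit_mem _) (block m _ _ h)
      (by rw [card_block]; omega)
    rwa [card_block] at this

lemma lintegral_meanVbar_le (hb : ∀ i, 1 ≤ b i) (hn : 1 ≤ nn σ b) (hq : special σ b ≤ m) (θ : ℝ) :
    Measurable (fun x : Fin m → ℝ => meanVbar σ b (fun i => refEncode σ b i (x i))) ∧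
    ∫⁻ x, ENNReal.ofReal ((meanVbar σ b (fun i => refEncode σ b i (x i)) -
      conv σ (conjRefine σ) θ) ^ 2) ∂(Measure.pi fun _ : Fin m => normal θ σ) ≤
      ENNReal.ofReal (1 / nn σ b) := by
  have hsp : special σ b = ll σ b ^ 2 + 2 * nn σ b := rfl
  have h : ll σ b ^ 2 + nn σ b + nn σ b ≤ m := by omega
  have hg : Measurable fun u => bit (conjRefine σ u) :=
    measurable_bit.comp (measurable_conjRefine σ)
  simp only [meanVbar_refEncode hb h]
  constructor
  · exact (Finset.measurable_sum _ fun i _ => hg.comp (measurable_pi_apply i)).const_mul _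
  · have := lintegral_mean_sub_sq_le (normal θ σ) hg (fun u => bit_mem _) (block m _ _ h)
      (by rw [card_block]; omega)
    rwa [card_block] at this

/-- The constant in the bound `σ² / n` for the risk of localization and refinement with `n` pairs of
refinement bits. Its summands come from small `l` (where `σ² / n` is of the order `σ²`), the refinement
bits, the crude localization bits and the votes. -/
noncomputable def refConst : ℝ := 372736 + 4 / slope ^ 2 + 107584 * 12288 * 625 / 8 + 4608

lemma refConst_pos : 0 < refConst := by
  have := slope_pos
  unfold refConst
  positivity

/-- The case `λ - l ≤ 3`, in which there are enough votes to do without crude localization bits. -/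
lemma lintegral_refEstimate_le_of_le (hb : ∀ i, 1 ≤ b i) (hσ : 0 < σ) (hn : 1 ≤ nn σ b)
    (hq : special σ b ≤ m) (h3 : lev σ - ll σ b ≤ 3) {e : Transcripts b → ℝ}
    (he : ∀ z, e z ∈ I1 σ b z) {θ : ℝ} (hθ : θ ∈ Icc (0 : ℝ) 1) :
    ∫⁻ x, ENNReal.ofReal ((refEstimate σ b (fun i => refEncode σ b i (x i)) e - θ) ^ 2)
      ∂(Measure.pi fun _ : Fin m => normal θ σ) ≤
      ENNReal.ofReal (refConst * (σ ^ 2 / nn σ b)) := by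
  have hs := slope_pos
  have hn0 : (0 : ℝ) < nn σ b := by exact_mod_cast hn
  obtain ⟨hV, hV'⟩ := lintegral_meanV_le hb hn hq θ
  obtain ⟨hW, hW'⟩ := lintegral_meanVbar_le hb hn hq θ
  refine (lintegral_le_of_le_sum (h := fun _ => 0) (a₀ := 0) (a₁ := 2 * σ ^ 2 / slope ^ 2)
    (a₂ := 0) (a₃ := 4) (s := 0) ((hV.sub_const _).pow_const 2) ((hW.sub_const _).pow_const 2)
    measurable_const (fun x => sq_nonneg _) (fun x => sq_nonneg _) (fun x => le_rfl) le_rfl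
    (by positivity) le_rfl (by norm_num) (by positivity) le_rfl (by positivity) ?_ hV' hW' (by simp)
    (measure_not_votesGood_le hb hσ hq θ)).trans (ENNReal.ofReal_le_ofReal ?_)
  · intro x
    set z : Transcripts b := fun i => refEncode σ b i (x i) with hz
    refine ENNReal.ofReal_le_ofReal ?_
    by_cases hx : VotesGood σ b z θ
    · have h := sq_le_of_mul_abs_le hs (refEstimate_error_of_votes_of_le hσ e hθ h3 hx)
      rw [indicator_of_notMem (by simpa using hx)]
      linarith
    · rw [indicator_of_mem (by simpa using hx)]
      have h := abs_refEstimate_sub_le_two hσ (he z) hθ h3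
      have h' := sq_abs (refEstimate σ b z e - θ)
      have : (refEstimate σ b z e - θ) ^ 2 ≤ 4 := by
        rw [← h']; nlinarith [abs_nonneg (refEstimate σ b z e - θ)]
      have i1 : 0 ≤ 2 * σ ^ 2 / slope ^ 2 * (meanV σ b z - conv σ (refine σ) θ) ^ 2 := by positivity
      have i2 : 0 ≤ 2 * σ ^ 2 / slope ^ 2 * (meanVbar σ b z - conv σ (conjRefine σ) θ) ^ 2 := by
        positivity
      linarith
  · have htail := sq_mul_vote_tail_le (σ := σ) (l := ll σ b) rfl hn0 (two_pow_ll_bounds hn).2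
    have hscale : 1 ≤ 16 * ((2 : ℝ) ^ ll σ b * σ) := by
      have h1 := (zpow_lev_bounds hσ).2
      have h2 : (1 : ℝ) ≤ 8 * (2 ^ ll σ b * 2 ^ (-lev σ)) := by
        calc (1 : ℝ) = 2 ^ (0 : ℤ) := by norm_num
          _ ≤ 2 ^ (3 + ((ll σ b : ℤ) + -lev σ)) := zpow_le_zpow_right₀ one_le_two (by omega)
          _ = _ := by rw [zpow_add₀ two_ne_zero, zpow_add₀ two_ne_zero, zpow_natCast]; norm_num
      have hp : (0 : ℝ) < 2 ^ ll σ b := by positivity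
      nlinarith [mul_lt_mul_of_pos_left h1 hp]
    have hp0 : 0 ≤ (ll σ b : ℝ) * (1 / 16) ^ ll σ b := by positivity
    have h1 : (ll σ b : ℝ) * (1 / 16) ^ ll σ b ≤
        256 * (((2 : ℝ) ^ ll σ b * σ) ^ 2 * (ll σ b * (1 / 16) ^ ll σ b)) := by
      have : 1 ≤ 256 * ((2 : ℝ) ^ ll σ b * σ) ^ 2 := by nlinarith
      nlinarith
    have e1 : 2 * σ ^ 2 / slope ^ 2 * (1 / (nn σ b : ℝ)) = 2 / slope ^ 2 * (σ ^ 2 / nn σ b) := by ring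
    have e2 : 4 / slope ^ 2 = 2 * (2 / slope ^ 2) := by ring
    have hT : 0 ≤ σ ^ 2 / nn σ b := by positivity
    rw [e1, refConst, e2]
    nlinarith

/-- The case `λ - l ≥ 4`. -/
lemma lintegral_refEstimate_le_of_lt (hm : 1 ≤ m) (hb : ∀ i, 1 ≤ b i) (hσ : 0 < σ) (hn : 1 ≤ nn σ b)
    (hq : special σ b ≤ m) (hB : lev σ + special σ b ≤ (∑ i, b i : ℕ))
    (h3 : ¬ lev σ - ll σ b ≤ 3) {e : Transcripts b → ℝ}
    (he : ∀ z, e z ∈ I1 σ b z) {θ : ℝ} (hθ : θ ∈ Icc (0 : ℝ) 1) :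
    ∫⁻ x, ENNReal.ofReal ((refEstimate σ b (fun i => refEncode σ b i (x i)) e - θ) ^ 2)
      ∂(Measure.pi fun _ : Fin m => normal θ σ) ≤
      ENNReal.ofReal (refConst * (σ ^ 2 / nn σ b)) := by
  have hs := slope_pos
  have hn0 : (0 : ℝ) < nn σ b := by exact_mod_cast hn
  obtain ⟨hV, hV'⟩ := lintegral_meanV_le hb hn hq θ
  obtain ⟨hW, hW'⟩ := lintegral_meanVbar_le hb hn hq θ
  obtain ⟨κ, hκ, hκ2⟩ := exists_level h3
  obtain ⟨i, hi⟩ := exists_crude_machines hm b (special σ b) (κ - 1) (by omega)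
  set S : (Fin m → ℝ) → ℝ := fun x => slip θ (fun k => gray k (x (i k))) (κ - 1) with hS
  have hS0 : ∀ x, 0 ≤ S x := fun x => slip_nonneg _ _ _
  have hSz : ∀ x, slip θ (crudeBit b (special σ b) (fun i => refEncode σ b i (x i))) (κ - 1) = S x := by
    intro x
    refine Finset.sum_congr rfl fun k hk => ?_
    rw [hi _ x (refEncode_crude x) (k + 1) (by omega) (by have := Finset.mem_range.1 hk; omega)]
  obtain ⟨hnL, hnL'⟩ := two_pow_ll_bounds hn
  set l := ll σ b with hl
  set c : ℝ := (2 ^ κ)⁻¹ with hc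
  have hc0 : 0 < c := by positivity
  obtain ⟨hc1, hc2⟩ : 4 * (2 ^ l * σ) ≤ c ∧ c ≤ 8 * (2 ^ l * σ) := by
    have h1 := zpow_lev_bounds hσ
    have h2 : c = 4 * (2 ^ l * 2 ^ (-lev σ)) := by
      rw [hc, ← zpow_natCast, ← zpow_neg, show -(κ : ℤ) = 2 + (l + -lev σ) by omega,
        zpow_add₀ two_ne_zero, zpow_add₀ two_ne_zero, zpow_natCast]
      norm_num
    have hp : (0 : ℝ) < 2 ^ l := by positivity
    constructor <;>
    nlinarith [mul_lt_mul_of_pos_left h1.2 hp, mul_le_mul_of_nonneg_left h1.1 hp.le]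
  -- The error is at most `5 c + S x`. This suffices for `l ≤ 2`, and also if `S x > c / 8`, when it is
  -- of the order `S x`; for wrong votes it is of the order `c`, and otherwise the refinement counts.
  refine (lintegral_le_of_le_sum (a₀ := if l ≤ 2 then 52 * c ^ 2 else 0)
    (a₁ := 2 * σ ^ 2 / slope ^ 2) (a₂ := 107584 / c ^ 2) (a₃ := 36 * c ^ 2)
    ((hV.sub_const _).pow_const 2) ((hW.sub_const _).pow_const 2)
    ((measurable_slip θ i (κ - 1)).pow_const 4) (fun x => sq_nonneg _) (fun x => sq_nonneg _)
    (fun x => by have := hS0 x; positivity) (by split_ifs <;> positivity)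
    (by positivity) (by positivity) (by positivity) (by positivity) (by positivity) (by positivity)
    ?_ hV' hW' (lintegral_slip_pow_le hσ hθ i (κ - 1))
    (measure_not_votesGood_le hb hσ hq θ)).trans (ENNReal.ofReal_le_ofReal ?_)
  · intro x
    set z : Transcripts b := fun i => refEncode σ b i (x i) with hz
    refine ENNReal.ofReal_le_ofReal ?_
    have hSx := hS0 x
    change _ ≤ _ + 107584 / c ^ 2 * S x ^ 4 + _
    have herr := abs_refEstimate_sub_le hσ (he z) hθ hκ hκ2
    rw [hSz, ← hc] at herr
    have hE := sq_abs (refEstimate σ b z e - θ)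
    have hE0 := abs_nonneg (refEstimate σ b z e - θ)
    have i1 : 0 ≤ 2 * σ ^ 2 / slope ^ 2 * (meanV σ b z - conv σ (refine σ) θ) ^ 2 := by positivity
    have i2 : 0 ≤ 2 * σ ^ 2 / slope ^ 2 * (meanVbar σ b z - conv σ (conjRefine σ) θ) ^ 2 := by
      positivity
    have i4 : 0 ≤ {x | ¬ VotesGood σ b (fun i => refEncode σ b i (x i)) θ}.indicator
        (fun _ => 36 * c ^ 2) x := indicator_nonneg (fun _ _ => by positivity) x
    by_cases hl2 : l ≤ 2
    · rw [if_pos hl2]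
      have h1 : 2 * S x ^ 2 ≤ 2 * c ^ 2 + 107584 / c ^ 2 * S x ^ 4 := by
        rw [div_mul_eq_mul_div, ← sub_le_iff_le_add', le_div_iff₀ (by positivity)]
        nlinarith [sq_nonneg (S x ^ 2 - c ^ 2), sq_nonneg (S x ^ 2), sq_nonneg (c ^ 2)]
      have h2 : (refEstimate σ b z e - θ) ^ 2 ≤ 50 * c ^ 2 + 2 * S x ^ 2 := by
        rw [← hE]; nlinarith [sq_nonneg (5 * c - S x)]
      linarith
    · rw [if_neg hl2]
      have i3 : 0 ≤ 107584 / c ^ 2 * S x ^ 4 := by positivity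
      rcases le_or_gt (S x) (1 / 8 * c) with hle | hlt
      · by_cases hx : VotesGood σ b z θ
        · have h := sq_le_of_mul_abs_le hs (refEstimate_error_of_votes hσ e hθ hκ hκ2
            (by omega) (by rw [hSz]; exact hle) hx)
          linarith
        · rw [indicator_of_mem (by simpa using hx)]
          have : (refEstimate σ b z e - θ) ^ 2 ≤ 36 * c ^ 2 := by
            rw [← hE]; nlinarith
          linarith
      · have h1 : (refEstimate σ b z e - θ) ^ 2 ≤ (41 * S x) ^ 2 := by
          rw [← hE]; exact pow_le_pow_left₀ hE0 (by linarith) 2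
        have h2 : (41 * S x) ^ 2 ≤ 107584 / c ^ 2 * S x ^ 4 := by
          have h3 : c ^ 2 ≤ (8 * S x) ^ 2 := pow_le_pow_left₀ hc0.le (by linarith) 2
          rw [div_mul_eq_mul_div, le_div_iff₀ (by positivity)]
          nlinarith [mul_le_mul_of_nonneg_left h3 (sq_nonneg (S x))]
        linarith
  · have hP : σ * 2 ^ (κ - 1) ≤ 1 := by
      calc σ * 2 ^ (κ - 1) ≤ 2 ^ (-lev σ) * 2 ^ (lev σ) := by
            have := (zpow_lev_bounds hσ).1
            gcongr
            rw [← zpow_natCast]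
            exact zpow_le_zpow_right₀ one_le_two (by omega)
        _ = 1 := by rw [← zpow_add₀ two_ne_zero]; simp
    have hn8 : nn σ b < 2 ^ (l + 1) := Nat.lt_pow_succ_log_self one_lt_two _
    have t0 := crude_error_le hσ hn hn8 hc0 hc2
    have t1 : 2 * σ ^ 2 / slope ^ 2 * (1 / (nn σ b : ℝ)) = 2 / slope ^ 2 * (σ ^ 2 / nn σ b) := by ring
    have t2 := slip_error_le hσ hn0 rfl hnL' hc1 (by positivity) hP
    have t3 : 36 * c ^ 2 * (l * (1 / 16) ^ l) ≤ 4608 * (σ ^ 2 / nn σ b) := by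
      have htail := sq_mul_vote_tail_le (σ := σ) (l := l) rfl hn0 hnL'
      have h1 : c ^ 2 ≤ (8 * (2 ^ l * σ)) ^ 2 := pow_le_pow_left₀ hc0.le hc2 2
      have h2 : (0 : ℝ) ≤ l * (1 / 16) ^ l := by positivity
      linarith [mul_le_mul_of_nonneg_right h1 h2]
    have e2 : 4 / slope ^ 2 * (σ ^ 2 / nn σ b) =
        2 / slope ^ 2 * (σ ^ 2 / nn σ b) + 2 / slope ^ 2 * (σ ^ 2 / nn σ b) := by ring
    rw [t1, refConst, add_mul, add_mul, add_mul, e2]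
    linarith

/-- The risk of localization and refinement, for `B - λ ≤ m`. -/
lemma maxRisk_refinement_le (hm : 1 ≤ m) (hb : ∀ i, 1 ≤ b i) (hσ : 0 < σ)
    (hD : 2 ≤ ((∑ i, b i : ℕ) : ℤ) - lev σ) (hDm : ((∑ i, b i : ℕ) : ℤ) - lev σ ≤ m)
    {e : Transcripts b → ℝ} (he : ∀ z, e z ∈ I1 σ b z) :
    (refinement σ b e).maxRisk σ ≤
      ENNReal.ofReal (8 * refConst * (σ ^ 2 / (((∑ i, b i : ℕ) : ℝ) - lev σ))) := by
  obtain ⟨h1, h2, h3⟩ := numRef_spec hD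
  change 1 ≤ nn σ b at h1
  change ((special σ b : ℕ) : ℤ) ≤ _ at h2
  change _ ≤ 8 * (nn σ b : ℤ) at h3
  have hq : special σ b ≤ m := by exact_mod_cast h2.trans hDm
  have hD' : (2 : ℝ) ≤ ((∑ i, b i : ℕ) : ℝ) - lev σ := by exact_mod_cast hD
  have h3' : ((∑ i, b i : ℕ) : ℝ) - lev σ ≤ 8 * nn σ b := by exact_mod_cast h3
  have hn0 : (0 : ℝ) < nn σ b := by exact_mod_cast h1
  have hle : refConst * (σ ^ 2 / nn σ b) ≤
      8 * refConst * (σ ^ 2 / (((∑ i, b i : ℕ) : ℝ) - lev σ)) := by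
    have : σ ^ 2 / nn σ b ≤ 8 * (σ ^ 2 / (((∑ i, b i : ℕ) : ℝ) - lev σ)) := by
      rw [← mul_div_assoc, div_le_div_iff₀ hn0 (by linarith)]
      nlinarith [sq_nonneg σ]
    nlinarith [refConst_pos]
  refine Protocol.maxRisk_le fun θ hθ => le_trans ?_ (ENNReal.ofReal_le_ofReal hle)
  by_cases h : lev σ - ll σ b ≤ 3
  · exact lintegral_refEstimate_le_of_le hb hσ h1 hq h he hθ
  · exact lintegral_refEstimate_le_of_lt hm hb hσ h1 hq (by omega) h he hθ

lemma I1_nonempty (σ : ℝ) (b : Fin m → ℕ) (z : Transcripts b) : (I1 σ b z).Nonempty := by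
  by_cases h : lev σ - ll σ b ≤ 3
  · rw [I1, if_pos h]; exact nonempty_Icc.2 zero_le_one
  · obtain ⟨x, hx⟩ := dec_nonempty (crudeBit b (special σ b) z) (lev σ - ll σ b - 3).toNat
    rw [I1, if_neg h]
    refine ⟨x, Metric.self_subset_cthickening _ ?_, hx.1⟩
    rw [I1', if_neg h]
    exact hx

end Risk

/-! ### The whole procedure -/

lemma mul_two_pow_le_of_le_logb {σ : ℝ} (hσ : 0 < σ) {B k : ℕ}
    (h : (B : ℝ) ≤ Real.logb 2 (1 / σ) + k) : σ * 2 ^ B ≤ 2 ^ k := by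
  have h1 : (2 : ℝ) ^ (B : ℝ) ≤ 2 ^ (Real.logb 2 (1 / σ) + k) :=
    Real.rpow_le_rpow_of_exponent_le one_le_two h
  rw [Real.rpow_add two_pos, Real.rpow_logb two_pos (by norm_num) (by positivity),
    Real.rpow_natCast, Real.rpow_natCast, div_mul_eq_mul_div, one_mul, le_div_iff₀ hσ] at h1
  linarith

lemma two_pow_le_mul_of_logb_le {σ : ℝ} (hσ : 0 < σ) {B k : ℕ}
    (h : Real.logb 2 (1 / σ) + k ≤ (B : ℝ)) : 2 ^ k ≤ σ * 2 ^ B := by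
  have h1 : (2 : ℝ) ^ (Real.logb 2 (1 / σ) + k) ≤ 2 ^ (B : ℝ) :=
    Real.rpow_le_rpow_of_exponent_le one_le_two h
  rw [Real.rpow_add two_pos, Real.rpow_logb two_pos (by norm_num) (by positivity),
    Real.rpow_natCast, Real.rpow_natCast, div_mul_eq_mul_div, one_mul, div_le_iff₀ hσ] at h1
  linarith

lemma zpow_neg_two_mul (B : ℕ) : (2 : ℝ) ^ (-2 * (B : ℤ)) = ((2 ^ B) ^ 2)⁻¹ := by
  rw [neg_mul, zpow_neg, mul_comm, zpow_mul, zpow_natCast]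
  norm_cast

/-- `4 ^ (-B) ≤ σ ^ 2` as soon as `B ≥ log (1/σ)`. -/
lemma zpow_neg_two_mul_le_sq {σ : ℝ} (hσ : 0 < σ) {B : ℕ} (h : Real.logb 2 (1 / σ) ≤ (B : ℝ)) :
    (2 : ℝ) ^ (-2 * (B : ℤ)) ≤ σ ^ 2 := by
  have h1 := two_pow_le_mul_of_logb_le (k := 0) hσ (by simpa using h)
  rw [zpow_neg_two_mul, inv_le_iff_one_le_mul₀ (by positivity), ← mul_pow]
  exact one_le_pow₀ (by simpa using h1)

/-- Budgets can be reduced to any smaller total that leaves one bit for each machine. -/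
lemma exists_reduced_budget {m : ℕ} {b : Fin m → ℕ} (hb : ∀ i, 1 ≤ b i) {s : ℕ} (h1 : m ≤ s)
    (h2 : s ≤ ∑ i, b i) :
    ∃ b' : Fin m → ℕ, (∀ i, 1 ≤ b' i) ∧ (∀ i, b' i ≤ b i) ∧ ∑ i, b' i = s := by
  induction s, h1 using Nat.le_induction with
  | base => exact ⟨fun _ => 1, fun _ => le_rfl, hb, by simp⟩
  | succ s hs ih =>
    obtain ⟨b', g1, g2, g3⟩ := ih (by omega)
    obtain ⟨i, -, hi⟩ := Finset.exists_lt_of_sum_lt (s := Finset.univ) (f := b') (g := b) (by omega)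
    refine ⟨Function.update b' i (b' i + 1), fun j => ?_, fun j => ?_, ?_⟩
    · by_cases hj : j = i
      · subst hj; simp
      · simpa [hj] using g1 j
    · by_cases hj : j = i
      · subst hj; simpa using hi
      · simpa [hj] using g2 j
    · rw [Finset.sum_update_of_mem (Finset.mem_univ i), ← g3,
        ← Finset.add_sum_erase _ b' (Finset.mem_univ i), Finset.sdiff_singleton_eq_erase]
      ring

lemma exists_isModgame {m : ℕ} (hm : 1 ≤ m) {b : Fin m → ℕ} (hb : ∀ i, 1 ≤ b i) {σ : ℝ}
    (hσ : 0 < σ) : ∃ P : Protocol b, IsModgame σ b P := by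
  rcases le_or_gt 1 σ with h1 | h1
  · exact ⟨_, IsModgame.large h1 hb⟩
  rcases lt_or_ge ((∑ i, b i : ℕ) : ℝ) (Real.logb 2 (1 / σ) + 2) with h2 | h2
  · exact ⟨_, IsModgame.localize h1 h2⟩
  rcases le_or_gt ((∑ i, b i : ℕ) : ℝ) (Real.logb 2 (1 / σ) + m) with h3 | h3
  · exact ⟨_, IsModgame.refine h1 h2 h3 _ fun z => (I1_nonempty σ b z).some_mem⟩
  have hlev := lev_nonneg hσ h1
  have hle : lev σ + m ≤ ((∑ i, b i : ℕ) : ℤ) := by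
    have hfl : (lev σ : ℝ) ≤ Real.logb 2 (1 / σ) := Int.floor_le _
    have : ((lev σ + m : ℤ) : ℝ) ≤ (((∑ i, b i : ℕ) : ℤ) : ℝ) := by
      rw [Int.cast_add, Int.cast_natCast, Int.cast_natCast]
      linarith
    exact_mod_cast this
  obtain ⟨b', g1, g2, g3⟩ := exists_reduced_budget hb (s := (lev σ + m).toNat) (by omega) (by omega)
  have hsum : ((∑ i, b' i : ℕ) : ℤ) = lev σ + m := by omega
  rcases hm.eq_or_lt with rfl | hm2
  · exact ⟨_, IsModgame.reduceOne h1 h3 rfl b' g1 g2 hsum⟩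
  · exact ⟨_, IsModgame.reduce h1 h3 hm2 b' g1 g2 hsum _ fun z => (I1_nonempty σ b' z).some_mem⟩

lemma le_ofReal_of_le {r : ℝ≥0∞} {c C t u : ℝ} (h : r ≤ ENNReal.ofReal (c * t)) (hc : 0 ≤ c)
    (hcC : c ≤ C) (hu : 0 ≤ u) (htu : t ≤ u) : r ≤ ENNReal.ofReal (C * u) :=
  h.trans (ENNReal.ofReal_le_ofReal ((mul_le_mul_of_nonneg_left htu hc).trans
    (mul_le_mul_of_nonneg_right hcC hu)))

end Modgame

theorem theorem1 :
    ∃ C : ℝ, 0 < C ∧ ∀ (m : ℕ) (b : Fin m → ℕ) (σ : ℝ),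
      1 ≤ m → (∀ i, 1 ≤ b i) → 0 < σ →
      (∃ P : Modgame.Protocol b, Modgame.IsModgame σ b P) ∧
      ∀ P : Modgame.Protocol b, Modgame.IsModgame σ b P →
        (((∑ i, b i : ℕ) : ℝ) < Real.logb 2 (1 / σ) + 2 →
          P.maxRisk σ ≤ ENNReal.ofReal (C * (2 : ℝ) ^ (-2 * ((∑ i, b i : ℕ) : ℤ)))) ∧
        (Real.logb 2 (1 / σ) + 2 ≤ ((∑ i, b i : ℕ) : ℝ) →
          ((∑ i, b i : ℕ) : ℝ) < Real.logb 2 (1 / σ) + m →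
          P.maxRisk σ ≤
            ENNReal.ofReal (C * (σ ^ 2 / (((∑ i, b i : ℕ) : ℝ) - Real.logb 2 (1 / σ))))) ∧
        (Real.logb 2 (1 / σ) + m ≤ ((∑ i, b i : ℕ) : ℝ) →
          P.maxRisk σ ≤ ENNReal.ofReal (C * min (σ ^ 2 / m) 1)) := by
  open Modgame in
  obtain ⟨C₁, hC₁⟩ : ∃ C₁ : ℝ, C₁ = 3 + 12288 * 68 ^ 4 := ⟨_, rfl⟩
  obtain ⟨C₂, hC₂⟩ : ∃ C₂ : ℝ, C₂ = 8 * refConst := ⟨_, rfl⟩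
  obtain ⟨C₃, hC₃⟩ : ∃ C₃ : ℝ, C₃ = max 1 (1 / gaussianPDFReal 0 1 1 ^ 2) := ⟨_, rfl⟩
  have p₁ : 0 < C₁ := by rw [hC₁]; norm_num
  have p₂ : 0 < C₂ := by have := refConst_pos; rw [hC₂]; positivity
  have p₃ : 0 < C₃ := by rw [hC₃]; exact lt_max_of_lt_left one_pos
  refine ⟨4 * C₁ + C₂ + 4 * C₃, by positivity, fun m b σ hm hb hσ =>
    ⟨exists_isModgame hm hb hσ, fun P hP => ?_⟩⟩
  have hm1 : (1 : ℝ) ≤ m := by exact_mod_cast hm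
  have hfl : (lev σ : ℝ) ≤ Real.logb 2 (1 / σ) := Int.floor_le _
  have hfl' : Real.logb 2 (1 / σ) < lev σ + 1 := Int.lt_floor_add_one _
  have hmin0 : 0 ≤ min (σ ^ 2 / m) 1 := le_min (by positivity) zero_le_one
  -- below the noise level `1`, the second bound for `B ≥ log (1/σ) + m` is redundant
  have hmin : σ < 1 → σ ^ 2 / m ≤ min (σ ^ 2 / m) 1 := fun h1 => by
    refine le_min le_rfl ?_
    rw [div_le_one (by linarith)]
    nlinarith
  cases hP with
  | localize hσ1 hB =>
    have hr := maxRisk_localization_le hm b hσ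
      ((mul_two_pow_le_of_le_logb (k := 2) hσ (by exact_mod_cast hB.le)).trans (by norm_num))
    rw [← hC₁] at hr
    refine ⟨fun _ => le_ofReal_of_le hr p₁.le (by linarith) (by positivity) le_rfl,
      fun h => absurd hB h.not_gt, fun h => le_ofReal_of_le hr p₁.le (by linarith) hmin0 ?_⟩
    have hm2 : m = 1 := by
      have : (m : ℝ) < 2 := by linarith
      have : m < 2 := by exact_mod_cast this
      omega
    subst hm2
    refine le_trans ?_ (hmin hσ1)
    rw [Nat.cast_one, div_one]
    exact zpow_neg_two_mul_le_sq hσ (by linarith)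
  | refine hσ1 hB hB' e he =>
    have hD : 2 ≤ ((∑ i, b i : ℕ) : ℤ) - lev σ := by
      have : ((2 : ℤ) : ℝ) ≤ ((((∑ i, b i : ℕ) : ℤ) - lev σ : ℤ) : ℝ) := by
        rw [Int.cast_sub, Int.cast_natCast]; push_cast at *; linarith
      exact_mod_cast this
    have hDm : ((∑ i, b i : ℕ) : ℤ) - lev σ ≤ m := by
      have : ((((∑ i, b i : ℕ) : ℤ) - lev σ : ℤ) : ℝ) < ((m + 1 : ℤ) : ℝ) := by
        rw [Int.cast_sub, Int.cast_natCast]; push_cast at *; linarith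
      have : ((∑ i, b i : ℕ) : ℤ) - lev σ < m + 1 := by exact_mod_cast this
      omega
    have hr := maxRisk_refinement_le hm hb hσ hD hDm he
    rw [← hC₂] at hr
    refine ⟨fun h => absurd h hB.not_gt, fun _ _ => ?_, fun h => ?_⟩
    · refine le_ofReal_of_le hr p₂.le (by linarith) (div_nonneg (sq_nonneg σ) (by linarith)) ?_
      exact div_le_div_of_nonneg_left (sq_nonneg σ) (by linarith) (by linarith)
    · refine le_ofReal_of_le hr p₂.le (by linarith) hmin0 (le_trans ?_ (hmin hσ1))
      exact div_le_div_of_nonneg_left (sq_nonneg σ) (by linarith) (by linarith)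
  | reduce hσ1 hB hm2 b' hb' hle hsum e he =>
    have hm2' : (2 : ℝ) ≤ m := by exact_mod_cast hm2
    have hr := maxRisk_refinement_le hm hb' hσ (by omega) (by omega) he
    have hsum' : ((∑ i, b' i : ℕ) : ℝ) - lev σ = m := by
      have : (((∑ i, b' i : ℕ) : ℤ) : ℝ) = ((lev σ + m : ℤ) : ℝ) := by rw [hsum]
      rw [Int.cast_natCast] at this
      rw [this]; push_cast; ring
    rw [← hC₂, hsum'] at hr
    rw [Protocol.maxRisk_pad]
    exact ⟨fun h => by linarith, fun _ h => by linarith,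
      fun h => le_ofReal_of_le hr p₂.le (by linarith) hmin0 (hmin hσ1)⟩
  | reduceOne hσ1 hB hm2 b' hb' hle hsum =>
    subst hm2
    have hsum' : ((∑ i, b' i : ℕ) : ℝ) = lev σ + 1 := by
      have : (((∑ i, b' i : ℕ) : ℤ) : ℝ) = ((lev σ + (1 : ℕ) : ℤ) : ℝ) := by rw [hsum]
      rw [Int.cast_natCast] at this
      rw [this]; push_cast; ring
    have hr := maxRisk_localization_le le_rfl b' hσ
      ((mul_two_pow_le_of_le_logb (k := 2) hσ (by rw [hsum']; push_cast; linarith)).trans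
        (by norm_num))
    rw [← hC₁] at hr
    rw [Protocol.maxRisk_pad]
    refine ⟨fun h => ?_, fun h h' => ?_, fun h => ?_⟩
    · -- the reduction of the budget costs at most one bit
      have hB2 : ((∑ i, b i : ℕ) : ℤ) ≤ ((∑ i, b' i : ℕ) : ℤ) + 1 := by
        have : (((∑ i, b i : ℕ) : ℤ) : ℝ) < ((((∑ i, b' i : ℕ) : ℤ) + 2 : ℤ) : ℝ) := by
          rw [Int.cast_add, Int.cast_natCast, Int.cast_natCast, hsum']; push_cast at *; linarith
        have : ((∑ i, b i : ℕ) : ℤ) < ((∑ i, b' i : ℕ) : ℤ) + 2 := by exact_mod_cast this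
        omega
      have h1 : (2 : ℝ) ^ (-2 * ((∑ i, b' i : ℕ) : ℤ)) ≤
          4 * (2 : ℝ) ^ (-2 * ((∑ i, b i : ℕ) : ℤ)) := by
        calc (2 : ℝ) ^ (-2 * ((∑ i, b' i : ℕ) : ℤ)) ≤
              2 ^ (2 + -2 * ((∑ i, b i : ℕ) : ℤ)) := zpow_le_zpow_right₀ one_le_two (by omega)
          _ = _ := by rw [zpow_add₀ two_ne_zero]; norm_num
      rw [show C₁ = (4 * C₁) / 4 by ring, div_mul_eq_mul_div, mul_div_assoc] at hr
      refine le_ofReal_of_le hr (by positivity) (by linarith) (by positivity) ?_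
      linarith
    · rw [Nat.cast_one] at h'; linarith
    · refine le_ofReal_of_le hr p₁.le (by linarith) hmin0 (le_trans ?_ (hmin hσ1))
      rw [Nat.cast_one, div_one]
      exact zpow_neg_two_mul_le_sq hσ (by rw [hsum']; linarith)
  | large hσ1 hb1 =>
    have hr := maxRisk_oneBit_le hm hσ1
    rw [← hC₃] at hr
    rw [Protocol.maxRisk_pad]
    have hL : Real.logb 2 (1 / σ) ≤ 0 :=
      Real.logb_nonpos one_lt_two (by positivity) ((div_le_one hσ).2 hσ1)
    refine ⟨fun h => ?_, fun h h' => ?_, fun h => ?_⟩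
    · have hB1 : ∑ i, b i ≤ 1 := by
        have : ((∑ i, b i : ℕ) : ℝ) < (2 : ℕ) := by push_cast at *; linarith
        have : ∑ i, b i < 2 := by exact_mod_cast this
        omega
      have h4 : (1 : ℝ) ≤ 4 * (2 : ℝ) ^ (-2 * ((∑ i, b i : ℕ) : ℤ)) := by
        calc (1 : ℝ) = 4 * 2 ^ (-2 : ℤ) := by norm_num
          _ ≤ _ := by gcongr <;> [norm_num; omega]
      rw [show C₃ = (4 * C₃) / 4 by ring, div_mul_eq_mul_div, mul_div_assoc] at hr
      refine le_ofReal_of_le hr (by positivity) (by linarith) (by positivity) ?_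
      linarith [min_le_right (σ ^ 2 / (m : ℝ)) 1]
    · refine le_ofReal_of_le hr p₃.le (by linarith) (div_nonneg (sq_nonneg σ) (by linarith))
        ((min_le_left _ _).trans ?_)
      exact div_le_div_of_nonneg_left (sq_nonneg σ) (by linarith) (by linarith)
    · exact le_ofReal_of_le hr p₃.le (by linarith) hmin0 le_rfl
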